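/- Let $0<\gamma_1<\gamma_2$ and put $$C(p)=\sqrt{\gamma_1^2+\gamma_2^2+2\gamma_1\gamma_2\cos p},\quad G(p)=\gamma_2-\gamma_1+C(p),\quad J(p)=G^2(2p)+4\gamma_1\gamma_2\cos^2p,\quad \omega_2(p)=\sqrt{\gamma_1+\gamma_2+C(2p)},$$ $$\mathcal B(p)=\frac1{J(p)}\begin{pmatrix}4\gamma_1\gamma_2\cos^2p&-2\gamma_1G(2p)\cos p\\-2\gamma_2G(2p)\cos p&G^2(2p)\end{pmatrix}.$$ For a real-valued Schwartz function $W$ on $\mathbb R$ let $\tilde V^0(p)=\bigl(\sum_{k\in\mathbb Z}W(2k)e^{-2ikp},\ \sum_{k\in\mathbb Z}W(2k+1)e^{-i(2k+1)p}\bigr)^T$ (the case $\delta=h/\mu=1$), and for $\mu>0$ $$I^{opt}(x,t)=\frac1\pi\int_{-\pi/2}^{\pi/2}\mathcal B(p)\tilde V^0(p)e^{\frac i\mu(px+\omega_2(p)t)}\,dp .$$ Then there is a point $p^*\in(0,\pi/2)$ with $\omega_2''(p^*)=0$, $\omega_2''<0$ on $(0,p^*)$, $\omega_2''>0$ on $(p^*,\pi/2)$,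 $c^*:=-\omega_2'(p^*)>0$ and $q^*:=\omega_2'''(p^*)/2>0$, and the following holds. For $\eta>0$ let $$F_1(\eta)=\tfrac12\bigl(\tilde V^0(p^*-\sqrt\eta)+\tilde V^0(p^*+\sqrt\eta)\bigr),\qquad F_2(\eta)=\tfrac1{2\sqrt\eta}\bigl(\tilde V^0(p^*-\sqrt\eta)-\tilde V^0(p^*+\sqrt\eta)\bigr),$$ let $F_{1,2}(0)$ be the limits for $\eta\to0+$, and continue by $F_{1,2}(z)=3F_{1,2}(0)-3F_{1,2}(-z)+F_{1,2}(-2z)$ for $z<0$. Let $\Phi_1=p^*x+\omega_2(p^*)t$, $\Phi_2=p^*x-\omega_2(p^*)t$, $\varepsilon=(\mu/(q^*t))^{1/3}$, let $\mathrm{Ai}(z)=\frac1\pi\int_0^{\infty}\cos(zs+s^3/3)\,ds$ be the Airy function, and put $$a_1=e^{\frac i\mu\Phi_1}\mathcal B(p^*)\Bigl(F_1\bigl(-\tfrac{x-c^*t}{q^*t}\bigr)\mathrm{Ai}\bigl(\tfrac{x-c^*t}{\mu^{2/3}(q^*t)^{1/3}}\bigr)+i\varepsilon F_2\bigl(-\tfrac{x-c^*t}{q^*t}\bigr)\mathrm{Ai}'\bigl(\tfrac{x-c^*t}{\mu^{2/3}(q^*t)^{1/3}}\bigr)\Bigr),$$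 $$a_2=e^{\frac i\mu\Phi_2}\mathcal B(p^*)\Bigl(F_1\bigl(\tfrac{x+c^*t}{q^*t}\bigr)\mathrm{Ai}\bigl(-\tfrac{x+c^*t}{\mu^{2/3}(q^*t)^{1/3}}\bigr)-i\varepsilon F_2\bigl(\tfrac{x+c^*t}{q^*t}\bigr)\mathrm{Ai}'\bigl(-\tfrac{x+c^*t}{\mu^{2/3}(q^*t)^{1/3}}\bigr)\Bigr).$$ For every $W$, $0<t_0\le t_1$ and $K>0$ there are $C,\mu_0>0$ such that for all $0<\mu<\mu_0$ and $t\in[t_0,t_1]$, and with $a=a_1$ if $|x-c^*t|\le K\mu^{2/3}$, $a=a_2$ if $|x+c^*t|\le K\mu^{2/3}$, each of the two components ($j=1,2$) satisfies $$\bigl|\mathrm{Re}\,I^{opt}_j(x,t)-2\varepsilon\,\mathrm{Re}\,a_j\bigr|\le C\mu^{1/3}\,\varepsilon\,\bigl(N+\varepsilon\bigr),\qquad N=\max_k|\tilde V^0_k(p^*)| .$$ That is, $\mathrm{Re}\,I^{opt}$ equals $2(\mu/(q^*t))^{1/3}\,\mathrm{Re}\,a$ with an error that is $O(\mu^{1/3})$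 relative to the size of the amplitude: for every $\kappa>0$, wherever $|a_j|\ge\kappa(N+\varepsilon)$, one has $\mathrm{Re}\,I^{opt}_j=2\varepsilon\,\mathrm{Re}\,\bigl(a_j(1+\rho)\bigr)$ with some $\rho\in\mathbb C$, $|\rho|\le \frac C\kappa\mu^{1/3}$. -/

import Mathlib

namespace DiatomicLattice

open Complex Filter

noncomputable section

/-- The Airy function `Ai z = (1/π) ∫_0^∞ cos (z s + s³/3) ds`. The integral converges only
conditionally, so it is the limit of the integrals over `[0, R]`, `R → ∞`. -/
def airyAi (z : ℝ) : ℝ :=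
  limUnder atTop (fun R : ℝ => (1 / Real.pi) * ∫ s in (0 : ℝ)..R, Real.cos (z * s + s ^ 3 / 3))

/-- The derivative `Ai'`. -/
def airyAiDeriv (z : ℝ) : ℝ := deriv airyAi z

/-- `C(p) = √(γ₁² + γ₂² + 2 γ₁ γ₂ cos p)`. -/
def auxC (γ₁ γ₂ p : ℝ) : ℝ := Real.sqrt (γ₁ ^ 2 + γ₂ ^ 2 + 2 * γ₁ * γ₂ * Real.cos p)

/-- `G(p) = γ₂ - γ₁ + C(p)`. -/
def auxG (γ₁ γ₂ p : ℝ) : ℝ := γ₂ - γ₁ + auxC γ₁ γ₂ p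

/-- `J(p) = G(2p)² + 4 γ₁ γ₂ cos² p`. -/
def auxJ (γ₁ γ₂ p : ℝ) : ℝ := auxG γ₁ γ₂ (2 * p) ^ 2 + 4 * γ₁ * γ₂ * Real.cos p ^ 2

/-- The optical branch of the dispersion relation, `ω₂(p) = √(γ₁ + γ₂ + C(2p))`. -/
def omega₂ (γ₁ γ₂ p : ℝ) : ℝ := Real.sqrt (γ₁ + γ₂ + auxC γ₁ γ₂ (2 * p))

/-- The spectral projection `ℬ(p)` onto the optical mode. -/
def matB (γ₁ γ₂ p : ℝ) : Matrix (Fin 2) (Fin 2) ℝ :=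
  (1 / auxJ γ₁ γ₂ p) •
    !![4 * γ₁ * γ₂ * Real.cos p ^ 2, -(2 * γ₁ * auxG γ₁ γ₂ (2 * p) * Real.cos p);
       -(2 * γ₂ * auxG γ₁ γ₂ (2 * p) * Real.cos p), auxG γ₁ γ₂ (2 * p) ^ 2]

/-- `ℬ(p)` acting on complex vectors. -/
def applyB (γ₁ γ₂ p : ℝ) (v : Fin 2 → ℂ) : Fin 2 → ℂ :=
  ((matB γ₁ γ₂ p).map (fun r : ℝ => (r : ℂ))).mulVec v

/-- The vector `Ṽ⁰(p)` of the semi-discrete Fourier transforms of the initial perturbation on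
the even and on the odd sites of the lattice, for `δ = h / μ = 1`. -/
def tildeV (W : SchwartzMap ℝ ℝ) (p : ℝ) : Fin 2 → ℂ :=
  ![∑' k : ℤ, (W (2 * (k : ℝ)) : ℂ) * cexp (-I * (p : ℂ) * (2 * (k : ℂ))),
    ∑' k : ℤ, (W (2 * (k : ℝ) + 1) : ℂ) * cexp (-I * (p : ℂ) * (2 * (k : ℂ) + 1))]

/-- The optical part of the solution,
`I^opt(x,t) = (1/π) ∫_{-π/2}^{π/2} ℬ(p) Ṽ⁰(p) exp (i (p x + ω₂(p) t) / μ) dp`. -/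
def Iopt (γ₁ γ₂ : ℝ) (W : SchwartzMap ℝ ℝ) (μ x t : ℝ) : Fin 2 → ℂ := fun j =>
  (1 / (Real.pi : ℂ)) * ∫ p in (-(Real.pi / 2))..(Real.pi / 2),
    applyB γ₁ γ₂ p (tildeV W p) j * cexp (I * (((p * x + omega₂ γ₁ γ₂ p * t) / μ : ℝ) : ℂ))

/-- `c* = -ω₂'(p*)`. -/
def cStar (γ₁ γ₂ pstar : ℝ) : ℝ := -deriv (omega₂ γ₁ γ₂) pstar

/-- `q* = ω₂'''(p*) / 2`. -/
def qStar (γ₁ γ₂ pstar : ℝ) : ℝ := iteratedDeriv 3 (omega₂ γ₁ γ₂) pstar / 2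

/-- The three-point continuation to `z < 0` of a function given for `z ≥ 0`. -/
def threePointExt (F : ℝ → Fin 2 → ℂ) (z : ℝ) : Fin 2 → ℂ :=
  if 0 ≤ z then F z else (3 : ℂ) • F 0 - (3 : ℂ) • F (-z) + F (-2 * z)

/-- `F₁(η) = (Ṽ⁰(p* - √η) + Ṽ⁰(p* + √η)) / 2`, continued to `η < 0`. -/
def F₁ (W : SchwartzMap ℝ ℝ) (pstar : ℝ) : ℝ → Fin 2 → ℂ :=
  threePointExt fun η =>
    (1 / 2 : ℂ) • (tildeV W (-Real.sqrt η + pstar) + tildeV W (Real.sqrt η + pstar))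

/-- `F₂(η) = (Ṽ⁰(p* - √η) - Ṽ⁰(p* + √η)) / (2 √η)`, continued to `η < 0`. At `η = 0` the value
is the limit for `η → 0+`, which is `-(Ṽ⁰)'(p*)`. -/
def F₂ (W : SchwartzMap ℝ ℝ) (pstar : ℝ) : ℝ → Fin 2 → ℂ :=
  threePointExt fun η =>
    if η = 0 then -deriv (tildeV W) pstar
    else (1 / (2 * (Real.sqrt η : ℂ))) •
      (tildeV W (-Real.sqrt η + pstar) - tildeV W (Real.sqrt η + pstar))

/-- `Φ₁(p; x, t) = p x + ω₂(p) t`. -/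
def Phi₁ (γ₁ γ₂ p x t : ℝ) : ℝ := p * x + omega₂ γ₁ γ₂ p * t

/-- `Φ₂(p; x, t) = p x - ω₂(p) t`. -/
def Phi₂ (γ₁ γ₂ p x t : ℝ) : ℝ := p * x - omega₂ γ₁ γ₂ p * t

/-- The small parameter `ε = (μ / (q* t))^{1/3}`. -/
def eps (γ₁ γ₂ pstar μ t : ℝ) : ℝ := (μ / (qStar γ₁ γ₂ pstar * t)) ^ (1 / 3 : ℝ)

/-- The complex amplitude at the front `x = c* t`:
`e^{iΦ₁(p*)/μ} ℬ(p*) (F₁(-y/(q*t)) Ai(z) + i ε F₂(-y/(q*t)) Ai'(z))` with `y = x - c* t` and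
`z = y / (μ^{2/3} (q*t)^{1/3})`. -/
def ampRight (γ₁ γ₂ : ℝ) (W : SchwartzMap ℝ ℝ) (pstar μ x t : ℝ) : Fin 2 → ℂ :=
  let q := qStar γ₁ γ₂ pstar
  let y := x - cStar γ₁ γ₂ pstar * t
  let z := y / (μ ^ (2 / 3 : ℝ) * (q * t) ^ (1 / 3 : ℝ))
  cexp (I * ((Phi₁ γ₁ γ₂ pstar x t / μ : ℝ) : ℂ)) •
    applyB γ₁ γ₂ pstar
      ((airyAi z : ℂ) • F₁ W pstar (-(y / (q * t))) +
        (I * (eps γ₁ γ₂ pstar μ t : ℂ) * (airyAiDeriv z : ℂ)) • F₂ W pstar (-(y / (q * t))))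

/-- The complex amplitude at the front `x = -c* t`:
`e^{iΦ₂(p*)/μ} ℬ(p*) (F₁(y/(q*t)) Ai(-z) - i ε F₂(y/(q*t)) Ai'(-z))` with `y = x + c* t` and
`z = y / (μ^{2/3} (q*t)^{1/3})`. -/
def ampLeft (γ₁ γ₂ : ℝ) (W : SchwartzMap ℝ ℝ) (pstar μ x t : ℝ) : Fin 2 → ℂ :=
  let q := qStar γ₁ γ₂ pstar
  let y := x + cStar γ₁ γ₂ pstar * t
  let z := y / (μ ^ (2 / 3 : ℝ) * (q * t) ^ (1 / 3 : ℝ))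
  cexp (I * ((Phi₂ γ₁ γ₂ pstar x t / μ : ℝ) : ℂ)) •
    applyB γ₁ γ₂ pstar
      ((airyAi (-z) : ℂ) • F₁ W pstar (y / (q * t)) -
        (I * (eps γ₁ γ₂ pstar μ t : ℂ) * (airyAiDeriv (-z) : ℂ)) • F₂ W pstar (y / (q * t)))

/-- `Re u = 2 ε Re (a (1 + O(μ^{1/3})))` with constant `C`, where `ε` is the small parameter and
`N + ε` is the size of the amplitude `a` (`N` bounds its Airy part, `ε` its part with `Ai'`).
Both `Re u` and `Re a` change sign at different points, so the error is measured against
`N + ε`, and it is a factor `1 + ρ` wherever `|a|` is not small compared with `N + ε`. -/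
def FactorApprox (C μ ε N : ℝ) (u a : ℂ) : Prop :=
  |u.re - 2 * ε * a.re| ≤ C * μ ^ (1 / 3 : ℝ) * (ε * (N + ε)) ∧
    ∀ κ : ℝ, 0 < κ → κ * (N + ε) ≤ ‖a‖ →
      ∃ ρ : ℂ, ‖ρ‖ ≤ C / κ * μ ^ (1 / 3 : ℝ) ∧ u.re = 2 * ε * (a * (1 + ρ)).re

end

end DiatomicLattice

/-!
At the inflection point `p*` of `ω₂` the phase of `I^opt` is, after subtraction of its tangent, a
cubic to leading order: with `p = p* + s` it reads `z s / ε + Θ(s) / ε³`, where `Θ(s) ~ s³ / 3` and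
`z` is the scaled distance to the front, which stays bounded. The scaling `s = ε σ` turns the cubic
phase into the one of the Airy function. Deforming `Θ` into `s³ / 3` costs one power of `ε`, because
the `n`-th moment of the oscillatory exponential is `O(ε ^ (n + 1))`, as follows by integrating by
parts for `s ≥ R ε`. Hence only the value and the first derivative of the amplitude at `p*` matter;
they multiply `Ai` and `Ai'`. Since `F₁` and `F₂` are the even part and the odd difference quotient
of `Ṽ⁰` about `p*`, and the argument `η` at which they are taken is `O(ε²)`, they equal `Ṽ⁰(p*)` and
`-(Ṽ⁰)'(p*)` up to `O(ε²)` and `O(ε)`. The left front is reduced to the right one by the reflection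
`p ↦ -p` and complex conjugation.
-/

namespace DiatomicLattice

open Complex Filter Topology Set MeasureTheory Asymptotics
open scoped ContDiff ComplexConjugate

/-! ### Parametric integrals and Taylor remainders -/

theorem hasDerivAt_intervalIntegral_of_continuous {E : Type*} [NormedAddCommGroup E]
    [NormedSpace ℝ E] {F F' : ℝ → ℝ → E} (a b : ℝ)
    (hF : Continuous (Function.uncurry F)) (hF' : Continuous (Function.uncurry F'))
    (h : ∀ x s, HasDerivAt (fun x => F x s) (F' x s) x) (x₀ : ℝ) :
    HasDerivAt (fun x => ∫ s in a..b, F x s) (∫ s in a..b, F' x₀ s) x₀ := by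
  obtain ⟨C, hC⟩ := ((isCompact_closedBall x₀ 1).prod
    (isCompact_uIcc (a := a) (b := b))).exists_bound_of_continuousOn hF'.continuousOn
  have hc : ∀ x, Continuous (F x) := fun x => hF.comp (by fun_prop : Continuous fun s => (x, s))
  have hc' : ∀ x, Continuous (F' x) := fun x => hF'.comp (by fun_prop : Continuous fun s => (x, s))
  refine (intervalIntegral.hasDerivAt_integral_of_dominated_loc_of_deriv_le
    (bound := fun _ => C) (s := Metric.ball x₀ 1) (Metric.ball_mem_nhds _ one_pos)
    (Eventually.of_forall fun x => (hc x).aestronglyMeasurable)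
    ((hc x₀).intervalIntegrable _ _) (hc' x₀).aestronglyMeasurable
    (Eventually.of_forall fun s hs x hx => ?_) (by simp)
    (Eventually.of_forall fun s _ x _ => h x s)).2
  exact hC (x, s) ⟨Metric.ball_subset_closedBall hx, uIoc_subset_uIcc hs⟩

section TaylorMean

variable {E : Type*} [NormedAddCommGroup E] [NormedSpace ℝ E]

/-- The averages `s ↦ ∫₀¹ vⁿ h(s v) dv`, in which Taylor remainders and antiderivatives of
`sⁿ h(s)` are expressed. -/
noncomputable def taylorMean (n : ℕ) (h : ℝ → E) (s : ℝ) : E :=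
  ∫ v in (0 : ℝ)..1, v ^ n • h (s * v)

theorem hasDerivAt_taylorMean (n : ℕ) {h : ℝ → E} (hh : ContDiff ℝ ∞ h) (s : ℝ) :
    HasDerivAt (taylorMean n h) (taylorMean (n + 1) (deriv h) s) s := by
  have hd : Continuous (deriv h) := hh.continuous_deriv (by simp)
  have hc := hh.continuous
  refine hasDerivAt_intervalIntegral_of_continuous (F := fun s v => v ^ n • h (s * v))
    (F' := fun s v => v ^ (n + 1) • deriv h (s * v)) 0 1 ?_ ?_ (fun x v => ?_) s
  · simp only [Function.uncurry_def]; fun_prop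
  · simp only [Function.uncurry_def]; fun_prop
  · have hcomp : HasDerivAt (fun x => h (x * v)) ((1 * v) • deriv h (x * v)) x :=
      (hh.differentiable (by simp) _).hasDerivAt.scomp x ((hasDerivAt_id x).mul_const v)
    simpa [smul_smul, ← pow_succ] using hcomp.fun_const_smul (v ^ n)

theorem contDiff_taylorMean (n : ℕ) {h : ℝ → E} (hh : ContDiff ℝ ∞ h) :
    ContDiff ℝ ∞ (taylorMean n h) := by
  rw [contDiff_infty]
  intro m
  induction m generalizing n h with
  | zero =>
    rw [Nat.cast_zero, contDiff_zero]
    exact continuous_iff_continuousAt.2 fun s => (hasDerivAt_taylorMean n hh s).continuousAt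
  | succ m ih =>
    rw [Nat.cast_succ, contDiff_succ_iff_deriv]
    refine ⟨fun s => (hasDerivAt_taylorMean n hh s).differentiableAt, by simp, ?_⟩
    rw [show deriv (taylorMean n h) = taylorMean (n + 1) (deriv h) from
      funext fun s => (hasDerivAt_taylorMean n hh s).deriv]
    exact ih (n + 1) (contDiff_infty_iff_deriv.1 hh).2

variable [CompleteSpace E]

theorem taylorMean_zero_right (n : ℕ) (h : ℝ → E) :
    taylorMean n h 0 = (1 / (n + 1 : ℝ)) • h 0 := by
  simp [taylorMean, intervalIntegral.integral_smul_const]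

/-- Integrate the derivative of `v ^ (n + 1) • h (s * v)` over `[0, 1]`. -/
theorem smul_taylorMean_add_smul_taylorMean (n : ℕ) {h : ℝ → E} (hh : ContDiff ℝ ∞ h) (s : ℝ) :
    (n + 1 : ℝ) • taylorMean n h s + s • taylorMean (n + 1) (deriv h) s = h s := by
  have hd : Continuous (deriv h) := hh.continuous_deriv (by simp)
  have hc := hh.continuous
  have hderiv : ∀ v ∈ uIcc (0 : ℝ) 1, HasDerivAt (fun v => v ^ (n + 1) • h (s * v))
      ((n + 1 : ℝ) • (v ^ n • h (s * v)) + s • (v ^ (n + 1) • deriv h (s * v))) v := fun v _ => by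
    have hcomp : HasDerivAt (fun v => h (s * v)) ((s * 1) • deriv h (s * v)) v :=
      (hh.differentiable (by simp) _).hasDerivAt.scomp v ((hasDerivAt_id v).const_mul s)
    refine ((hasDerivAt_pow (n + 1) v).fun_smul hcomp).congr_deriv ?_
    push_cast
    simp only [mul_one, smul_smul]
    rw [add_comm, mul_comm (_ ^ _) s]
  have hftc := intervalIntegral.integral_eq_sub_of_hasDerivAt hderiv
    (Continuous.intervalIntegrable (by fun_prop) _ _)
  rw [intervalIntegral.integral_add (Continuous.intervalIntegrable (by fun_prop) _ _)
    (Continuous.intervalIntegrable (by fun_prop) _ _), intervalIntegral.integral_smul,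
    intervalIntegral.integral_smul] at hftc
  simpa [taylorMean] using hftc

theorem hasDerivAt_pow_smul_taylorMean (n : ℕ) {h : ℝ → E} (hh : ContDiff ℝ ∞ h) (s : ℝ) :
    HasDerivAt (fun s => s ^ (n + 1) • taylorMean n h s) (s ^ n • h s) s := by
  refine ((hasDerivAt_pow (n + 1) s).fun_smul (hasDerivAt_taylorMean n hh s)).congr_deriv ?_
  rw [← smul_taylorMean_add_smul_taylorMean n hh s, smul_add, smul_smul, smul_smul, add_comm,
    ← pow_succ]
  push_cast
  rw [mul_comm (s ^ _)]

theorem eq_pow_smul_taylorMean {n : ℕ} {F h : ℝ → E} (hh : ContDiff ℝ ∞ h)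
    (hF : ∀ s, HasDerivAt F (s ^ n • h s) s) (h0 : F 0 = 0) (s : ℝ) :
    F s = s ^ (n + 1) • taylorMean n h s := by
  have hderiv : ∀ s, HasDerivAt (fun s => F s - s ^ (n + 1) • taylorMean n h s) 0 s := fun s => by
    simpa using (hF s).fun_sub (hasDerivAt_pow_smul_taylorMean n hh s)
  have := is_const_of_deriv_eq_zero (fun s => (hderiv s).differentiableAt)
    (fun s => (hderiv s).deriv) s 0
  simpa [h0, sub_eq_zero] using this

theorem sub_eq_smul_taylorMean {h : ℝ → E} (hh : ContDiff ℝ ∞ h) (s : ℝ) :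
    h s - h 0 = s • taylorMean 0 (deriv h) s := by
  simpa using eq_pow_smul_taylorMean (n := 0) (F := fun s => h s - h 0)
    (contDiff_infty_iff_deriv.1 hh).2
    (fun s => by simpa using (hh.differentiable (by simp) s).hasDerivAt.sub_const (h 0))
    (sub_self _) s

end TaylorMean

theorem exists_eq_add_smul_add_sq_smul {E : Type*} [NormedAddCommGroup E] [NormedSpace ℝ E]
    [CompleteSpace E] {g : ℝ → E} (hg : ContDiff ℝ ∞ g) :
    ∃ h : ℝ → E, ContDiff ℝ ∞ h ∧ (∀ s, g s = g 0 + s • deriv g 0 + s ^ 2 • h s) ∧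
      h 0 = (1 / 2 : ℝ) • deriv (deriv g) 0 := by
  have hg' : ContDiff ℝ ∞ (deriv g) := (contDiff_infty_iff_deriv.1 hg).2
  set h₁ := taylorMean 0 (deriv g) with hh₁
  have h₁s : ContDiff ℝ ∞ h₁ := contDiff_taylorMean 0 hg'
  have h₁_zero : h₁ 0 = deriv g 0 := by simp [hh₁, taylorMean_zero_right]
  refine ⟨taylorMean 0 (deriv h₁), contDiff_taylorMean 0 (contDiff_infty_iff_deriv.1 h₁s).2,
    fun s => ?_, ?_⟩
  · have hfirst := sub_eq_smul_taylorMean hg s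
    have hsecond := sub_eq_smul_taylorMean h₁s s
    rw [← hh₁, sub_eq_iff_eq_add'] at hfirst
    rw [h₁_zero, sub_eq_iff_eq_add'] at hsecond
    rw [hfirst, hsecond, smul_add, smul_smul, ← sq, add_assoc]
  · rw [taylorMean_zero_right, hh₁, (hasDerivAt_taylorMean 0 hg' 0).deriv, taylorMean_zero_right]
    norm_num

/-! ### Oscillatory integrals away from stationary points -/

theorem hasDerivAt_cexp_phase {ψ : ℝ → ℝ} {ψ' s : ℝ} (h : HasDerivAt ψ ψ' s) :
    HasDerivAt (fun s => cexp (I * (ψ s : ℂ))) (I * (ψ' : ℂ) * cexp (I * (ψ s : ℂ))) s := by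
  have := ((h.ofReal_comp).const_mul I).cexp
  rwa [mul_comm] at this

theorem integral_mul_deriv_cexp_phase {a b : ℝ} {u u' : ℝ → ℂ} {ψ ψ' : ℝ → ℝ}
    (hu : ∀ s ∈ uIcc a b, HasDerivAt u (u' s) s) (hψ : ∀ s ∈ uIcc a b, HasDerivAt ψ (ψ' s) s)
    (hu' : ContinuousOn u' (uIcc a b)) (hψ' : ContinuousOn ψ' (uIcc a b)) :
    ∫ s in a..b, u s * (I * (ψ' s : ℂ) * cexp (I * (ψ s : ℂ))) =
      u b * cexp (I * (ψ b : ℂ)) - u a * cexp (I * (ψ a : ℂ)) -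
        ∫ s in a..b, u' s * cexp (I * (ψ s : ℂ)) := by
  refine intervalIntegral.integral_mul_deriv_eq_deriv_mul hu
    (fun s hs => hasDerivAt_cexp_phase (hψ s hs)) hu'.intervalIntegrable ?_
  have hψc : ContinuousOn ψ (uIcc a b) := fun s hs => (hψ s hs).continuousAt.continuousWithinAt
  exact ContinuousOn.intervalIntegrable (by fun_prop)

theorem norm_integral_mul_cexp_phase_le {a b : ℝ} (hab : a ≤ b) {v v' : ℝ → ℂ}
    {ψ ψ' ψ'' B : ℝ → ℝ} (hv : ∀ s ∈ Icc a b, HasDerivAt v (v' s) s)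
    (hψ : ∀ s ∈ Icc a b, HasDerivAt ψ (ψ' s) s) (hψ' : ∀ s ∈ Icc a b, HasDerivAt ψ' (ψ'' s) s)
    (hv'c : ContinuousOn v' (Icc a b)) (hψ''c : ContinuousOn ψ'' (Icc a b))
    (hpos : ∀ s ∈ Icc a b, 0 < ψ' s) (hB : ContinuousOn B (Icc a b))
    (hbound : ∀ s ∈ Icc a b, ‖v' s‖ / ψ' s + ‖v s‖ * |ψ'' s| / ψ' s ^ 2 ≤ B s) :
    ‖∫ s in a..b, v s * cexp (I * (ψ s : ℂ))‖ ≤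
      ‖v a‖ / ψ' a + ‖v b‖ / ψ' b + ∫ s in a..b, B s := by
  rw [← uIcc_of_le hab] at hv hψ hψ' hv'c hψ''c hpos hB hbound
  have hvc : ContinuousOn v (uIcc a b) := fun s hs => (hv s hs).continuousAt.continuousWithinAt
  have hψ'c : ContinuousOn ψ' (uIcc a b) := fun s hs => (hψ' s hs).continuousAt.continuousWithinAt
  have hne : ∀ s ∈ uIcc a b, (I * (ψ' s : ℂ)) ≠ 0 := fun s hs =>
    mul_ne_zero I_ne_zero (ofReal_ne_zero.2 (hpos s hs).ne')
  have hnorm : ∀ s ∈ uIcc a b, ‖v s / (I * ψ' s) * cexp (I * ψ s)‖ = ‖v s‖ / ψ' s := fun s hs => by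
    simp [norm_exp_I_mul_ofReal, abs_of_pos (hpos s hs)]
  have hparts := integral_mul_deriv_cexp_phase (u := fun s => v s / (I * ψ' s))
    (fun s hs => (hv s hs).fun_div ((hψ' s hs).ofReal_comp.const_mul I) (hne s hs)) hψ
    (ContinuousOn.div (by fun_prop) (by fun_prop) fun s hs => pow_ne_zero 2 (hne s hs)) hψ'c
  have hcancel : ∫ s in a..b, v s * cexp (I * ψ s) =
      ∫ s in a..b, v s / (I * ψ' s) * (I * ψ' s * cexp (I * ψ s)) :=
    intervalIntegral.integral_congr fun s hs => by
      simp only [← mul_assoc, div_mul_cancel₀ _ (hne s hs)]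
  rw [hcancel, hparts]
  refine (norm_sub_le _ _).trans (add_le_add ((norm_sub_le _ _).trans_eq ?_) ?_)
  · rw [hnorm a left_mem_uIcc, hnorm b right_mem_uIcc, add_comm]
  refine intervalIntegral.norm_integral_le_of_norm_le hab (ae_of_all _ fun s hs => ?_)
    hB.intervalIntegrable
  have hs' : s ∈ uIcc a b := uIcc_of_le hab ▸ Ioc_subset_Icc_self hs
  have hp := hpos s hs'
  refine le_trans ?_ (hbound s hs')
  rw [norm_mul, norm_exp_I_mul_ofReal, mul_one, norm_div, norm_pow, norm_mul I, norm_I, one_mul,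
    norm_real, Real.norm_eq_abs, abs_of_pos hp, div_le_iff₀ (by positivity)]
  refine (norm_sub_le _ _).trans_eq ?_
  simp only [norm_mul, norm_I, norm_real, Real.norm_eq_abs, abs_of_pos hp]
  field_simp

theorem integral_one_div_sq_le {R R' : ℝ} (hR : 0 < R) (h : R ≤ R') :
    ∫ σ in R..R', 1 / σ ^ 2 ≤ 1 / R := by
  have hpos : ∀ σ ∈ uIcc R R', 0 < σ := fun σ hσ => hR.trans_le (uIcc_of_le h ▸ hσ).1
  have hderiv : ∀ σ ∈ uIcc R R', HasDerivAt (fun σ : ℝ => -σ⁻¹) (1 / σ ^ 2) σ := fun σ hσ => by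
    simpa using (hasDerivAt_inv (hpos σ hσ).ne').fun_neg
  rw [intervalIntegral.integral_eq_sub_of_hasDerivAt hderiv]
  · have : 0 < R'⁻¹ := inv_pos.2 (hR.trans_le h)
    rw [one_div]; linarith
  · refine ContinuousOn.intervalIntegrable (ContinuousOn.div (by fun_prop) (by fun_prop) ?_)
    exact fun σ hσ => pow_ne_zero 2 (hpos σ hσ).ne'

theorem pow_div_le_pow_div {j : ℕ} (hj : j ≤ 1) {R s : ℝ} (hR : 0 < R) (hs : R ≤ s) :
    s ^ j / s ≤ R ^ j / R := by
  have hs0 := hR.trans_le hs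
  interval_cases j
  · simpa using inv_anti₀ hR hs
  · simp [hR.ne', hs0.ne']

theorem div_add_mul_div_sq_le {j : ℕ} {s κ L A α α' β β' : ℝ} (hs : 0 < s) (hκ : 0 < κ)
    (hβ : κ * s ^ 2 ≤ β) (hβ'0 : 0 ≤ β') (hβ' : β' ≤ L * s) (hα0 : 0 ≤ α) (hα : α ≤ A * s ^ j)
    (hα'0 : 0 ≤ α') (hα' : α' * s ≤ A * s ^ j) :
    α' / β + α * β' / β ^ 2 ≤ A / κ * (1 + L / κ) * (s ^ j / s) * (1 / s ^ 2) :=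
  calc α' / β + α * β' / β ^ 2
      ≤ (A * s ^ j / s) / (κ * s ^ 2) + (A * s ^ j) * (L * s) / (κ * s ^ 2) ^ 2 := by
        gcongr
        · exact hα'0.trans ((le_div_iff₀ hs).2 hα')
        · exact (le_div_iff₀ hs).2 hα'
        · exact mul_nonneg (hα0.trans hα) (hβ'0.trans hβ')
        · exact hα0.trans hα
    _ = A / κ * (1 + L / κ) * (s ^ j / s) * (1 / s ^ 2) := by field_simp

theorem norm_integral_mul_cexp_cubic_le {j : ℕ} (hj : j ≤ 1) {R R' κ L A : ℝ} (hR : 0 < R)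
    (hRR' : R ≤ R') (hκ : 0 < κ) {v v' : ℝ → ℂ} {ψ ψ' ψ'' : ℝ → ℝ}
    (hv : ∀ s ∈ Icc R R', HasDerivAt v (v' s) s) (hψ : ∀ s ∈ Icc R R', HasDerivAt ψ (ψ' s) s)
    (hψ' : ∀ s ∈ Icc R R', HasDerivAt ψ' (ψ'' s) s) (hv'c : ContinuousOn v' (Icc R R'))
    (hψ''c : ContinuousOn ψ'' (Icc R R')) (hκψ' : ∀ s ∈ Icc R R', κ * s ^ 2 ≤ ψ' s)
    (hLψ'' : ∀ s ∈ Icc R R', |ψ'' s| ≤ L * s) (hvA : ∀ s ∈ Icc R R', ‖v s‖ ≤ A * s ^ j)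
    (hv'A : ∀ s ∈ Icc R R', ‖v' s‖ * s ≤ A * s ^ j) :
    ‖∫ s in R..R', v s * cexp (I * (ψ s : ℂ))‖ ≤ A / κ * (3 + L / κ) * (R ^ j / R ^ 2) := by
  have hpos : ∀ s ∈ Icc R R', 0 < s := fun s hs => hR.trans_le hs.1
  have hmem : R ∈ Icc R R' := left_mem_Icc.2 hRR'
  have hA : 0 ≤ A := nonneg_of_mul_nonneg_left ((norm_nonneg _).trans (hvA R hmem)) (by positivity)
  have hL : 0 ≤ L := nonneg_of_mul_nonneg_left ((abs_nonneg _).trans (hLψ'' R hmem)) hR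
  have hend : ∀ s ∈ Icc R R', ‖v s‖ / ψ' s ≤ A / κ * (R ^ j / R ^ 2) := fun s hs => by
    have h0 := hpos s hs
    have hle := hs.1
    calc ‖v s‖ / ψ' s ≤ (A * s ^ j) / (κ * s ^ 2) :=
          div_le_div₀ (by positivity) (hvA s hs) (by positivity) (hκψ' s hs)
      _ = A / κ * (s ^ j / s * (1 / s)) := by field_simp
      _ ≤ A / κ * (R ^ j / R * (1 / R)) := by have := pow_div_le_pow_div hj hR hle; gcongr
      _ = A / κ * (R ^ j / R ^ 2) := by field_simp
  have hparts := norm_integral_mul_cexp_phase_le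
    (B := fun s => A / κ * (1 + L / κ) * (R ^ j / R) * (1 / s ^ 2)) hRR' hv hψ hψ' hv'c hψ''c
    (fun s hs => (by have := hpos s hs; positivity : 0 < κ * s ^ 2).trans_le (hκψ' s hs))
    (ContinuousOn.mul (by fun_prop) (ContinuousOn.div (by fun_prop) (by fun_prop)
      fun s hs => pow_ne_zero 2 (hpos s hs).ne'))
    (fun s hs => (div_add_mul_div_sq_le (hpos s hs) hκ (hκψ' s hs) (abs_nonneg _) (hLψ'' s hs)
      (norm_nonneg _) (hvA s hs) (norm_nonneg _) (hv'A s hs)).trans (by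
        have := pow_div_le_pow_div hj hR hs.1
        have := hpos s hs
        gcongr))
  have hint : ∫ s in R..R', A / κ * (1 + L / κ) * (R ^ j / R) * (1 / s ^ 2) ≤
      A / κ * (1 + L / κ) * (R ^ j / R ^ 2) := by
    rw [intervalIntegral.integral_const_mul]
    refine (mul_le_mul_of_nonneg_left (integral_one_div_sq_le hR hRR') (by positivity)).trans_eq ?_
    field_simp
  linarith [hend R hmem, hend R' (right_mem_Icc.2 hRR')]

/-! ### The Airy function -/

/-- The integrand `exp (i (z σ + σ³ / 3))` of the Airy function in complex form. -/
noncomputable def airyExp (z σ : ℝ) : ℂ := cexp (I * ((z * σ + σ ^ 3 / 3 : ℝ) : ℂ))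

theorem continuous_airyExp : Continuous (Function.uncurry airyExp) := by
  simp only [Function.uncurry_def, airyExp]; fun_prop

/-- The truncated moments `∫₀ᴿ σ^j exp (i (z σ + σ³ / 3)) dσ`. -/
noncomputable def airyCut (j : ℕ) (z R : ℝ) : ℂ := ∫ σ in (0 : ℝ)..R, (σ : ℂ) ^ j * airyExp z σ

/-- The moments `∫₀^∞ σ^j exp (i (z σ + σ³ / 3)) dσ`, as improper integrals: they converge for
`j ≤ 1` only, and only conditionally. -/
noncomputable def airyMoment (j : ℕ) (z : ℝ) : ℂ := limUnder atTop (airyCut j z)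

theorem intervalIntegrable_pow_mul_airyExp (j : ℕ) (z a b : ℝ) :
    IntervalIntegrable (fun σ : ℝ => (σ : ℂ) ^ j * airyExp z σ) volume a b :=
  Continuous.intervalIntegrable (by unfold airyExp; fun_prop) _ _

theorem norm_airyCut_sub_le {j : ℕ} (hj : j ≤ 1) {z R R' : ℝ} (hR : 0 < R)
    (hzR : 2 * |z| ≤ R ^ 2) (hRR' : R ≤ R') :
    ‖airyCut j z R' - airyCut j z R‖ ≤ 14 * (R ^ j / R ^ 2) := by
  rw [airyCut, airyCut, intervalIntegral.integral_interval_sub_left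
    (intervalIntegrable_pow_mul_airyExp j z _ _) (intervalIntegrable_pow_mul_airyExp j z _ _)]
  have hpos : ∀ σ ∈ Icc R R', 0 < σ := fun σ hσ => hR.trans_le hσ.1
  refine (norm_integral_mul_cexp_cubic_le hj (κ := 1 / 2) (L := 2) (A := 1) hR hRR' (by norm_num)
    (v' := fun σ => j * (σ : ℂ) ^ (j - 1)) (ψ' := fun σ => z + σ ^ 2) (ψ'' := fun σ => 2 * σ)
    (fun σ _ => ((hasDerivAt_id' σ).ofReal_comp.fun_pow j).congr_deriv (by simp))
    (fun σ _ => (((hasDerivAt_id' σ).const_mul z).fun_add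
        (((hasDerivAt_id' σ).fun_pow 3).div_const 3)).congr_deriv (by push_cast; ring))
    (fun σ _ => (((hasDerivAt_id' σ).fun_pow 2).const_add z).congr_deriv (by push_cast; ring))
    (by fun_prop) (by fun_prop) (fun σ hσ => ?_) (fun σ hσ => ?_) (fun σ hσ => ?_)
    (fun σ _ => ?_)).trans_eq (by norm_num)
  · have := pow_le_pow_left₀ hR.le hσ.1 2
    linarith [neg_abs_le z]
  · rw [abs_of_pos (mul_pos two_pos (hpos σ hσ))]
  · simp [abs_of_pos (hpos σ hσ)]
  · interval_cases j <;> simp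

theorem tendsto_pow_div_sq_atTop {j : ℕ} (hj : j ≤ 1) :
    Tendsto (fun R : ℝ => 14 * (R ^ j / R ^ 2)) atTop (𝓝 0) := by
  simpa using (tendsto_pow_div_pow_atTop_zero (𝕜 := ℝ) (show j < 2 by omega)).const_mul 14

theorem eventually_two_mul_abs_le_sq (K : ℝ) : ∀ᶠ R : ℝ in atTop, 0 < R ∧ 2 * K ≤ R ^ 2 :=
  (eventually_gt_atTop 0).and ((tendsto_pow_atTop two_ne_zero).eventually_ge_atTop _)

theorem tendsto_airyCut {j : ℕ} (hj : j ≤ 1) (z : ℝ) :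
    Tendsto (airyCut j z) atTop (𝓝 (airyMoment j z)) := by
  refine CauchySeq.tendsto_limUnder (Metric.cauchySeq_iff'.2 fun δ hδ => ?_)
  obtain ⟨N, ⟨hN, hzN⟩, hδN⟩ := ((eventually_two_mul_abs_le_sq |z|).and
    ((tendsto_pow_div_sq_atTop hj).eventually_lt_const hδ)).exists
  exact ⟨N, fun R hR => (dist_eq_norm _ _).trans_lt ((norm_airyCut_sub_le hj hN hzN hR).trans_lt
    hδN)⟩

theorem norm_airyMoment_sub_le {j : ℕ} (hj : j ≤ 1) {z R : ℝ} (hR : 0 < R)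
    (hzR : 2 * |z| ≤ R ^ 2) :
    ‖airyMoment j z - airyCut j z R‖ ≤ 14 * (R ^ j / R ^ 2) := by
  refine le_of_tendsto ((tendsto_airyCut hj z).sub_const _).norm ?_
  filter_upwards [eventually_ge_atTop R] with R' hR' using norm_airyCut_sub_le hj hR hzR hR'

theorem tendstoLocallyUniformly_airyCut {j : ℕ} (hj : j ≤ 1) :
    TendstoLocallyUniformly (fun R z => airyCut j z R) (airyMoment j) atTop := by
  refine Metric.tendstoLocallyUniformly_iff.2 fun δ hδ z =>
    ⟨Metric.ball 0 (|z| + 1), Metric.isOpen_ball.mem_nhds (by simp), ?_⟩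
  filter_upwards [eventually_two_mul_abs_le_sq (|z| + 1),
    (tendsto_pow_div_sq_atTop hj).eventually_lt_const hδ] with R ⟨hR, hzR⟩ hδR w hw
  have hwz : |w| < |z| + 1 := mem_ball_zero_iff.1 hw
  exact (dist_eq_norm _ _).trans_lt
    ((norm_airyMoment_sub_le hj hR (by linarith)).trans_lt hδR)

theorem continuous_airyMoment {j : ℕ} (hj : j ≤ 1) : Continuous (airyMoment j) := by
  refine (tendstoLocallyUniformly_airyCut hj).continuous (Frequently.of_forall fun R => ?_)
  have := continuous_airyExp
  simp only [Function.uncurry_def] at this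
  exact intervalIntegral.continuous_parametric_intervalIntegral_of_continuous' (by
    simp only [Function.uncurry_def]; fun_prop) 0 R

theorem hasDerivAt_airyCut_zero (R z : ℝ) :
    HasDerivAt (fun z => airyCut 0 z R) (I * airyCut 1 z R) z := by
  have h := continuous_airyExp
  simp only [Function.uncurry_def] at h
  have := hasDerivAt_intervalIntegral_of_continuous (F := fun z σ : ℝ => (σ : ℂ) ^ 0 * airyExp z σ)
    (F' := fun z σ : ℝ => I * ((σ : ℂ) ^ 1 * airyExp z σ)) 0 R
    (by simp only [Function.uncurry_def]; fun_prop)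
    (by simp only [Function.uncurry_def]; fun_prop) (fun z σ => by
      have hphase : HasDerivAt (fun z : ℝ => z * σ + σ ^ 3 / 3) σ z := by
        simpa using ((hasDerivAt_id z).mul_const σ).add_const (σ ^ 3 / 3)
      simpa [airyExp, mul_assoc] using hasDerivAt_cexp_phase hphase) z
  rwa [intervalIntegral.integral_const_mul] at this

theorem hasDerivAt_airyMoment_zero (z : ℝ) :
    HasDerivAt (airyMoment 0) (I * airyMoment 1 z) z := by
  have hderiv : TendstoLocallyUniformlyOn (fun R z => I * airyCut 1 z R)
      (fun z => I * airyMoment 1 z) atTop univ :=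
    (uniformContinuous_const_smul I).comp_tendstoLocallyUniformlyOn
      (tendstoLocallyUniformly_airyCut le_rfl).tendstoLocallyUniformlyOn
  exact hasDerivAt_of_tendstoLocallyUniformlyOn isOpen_univ hderiv
    (Eventually.of_forall fun R w _ => hasDerivAt_airyCut_zero R w)
    (fun w _ => tendsto_airyCut zero_le_one w) (mem_univ z)

theorem airyAi_eq_re_airyMoment (z : ℝ) : airyAi z = (1 / Real.pi) * (airyMoment 0 z).re := by
  refine Tendsto.limUnder_eq (Tendsto.const_mul _ ?_)
  refine ((continuous_re.tendsto _).comp (tendsto_airyCut zero_le_one z)).congr fun R => ?_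
  refine (reCLM.intervalIntegral_comp_comm (intervalIntegrable_pow_mul_airyExp 0 z 0 R)).symm.trans
    (intervalIntegral.integral_congr fun σ _ => ?_)
  simp only [pow_zero, one_mul, airyExp, reCLM_apply]
  rw [mul_comm, exp_ofReal_mul_I_re]

theorem airyAiDeriv_eq_im_airyMoment (z : ℝ) :
    airyAiDeriv z = -((1 / Real.pi) * (airyMoment 1 z).im) := by
  have hre : HasDerivAt (fun z => (airyMoment 0 z).re) (I * airyMoment 1 z).re z :=
    reCLM.hasFDerivAt.comp_hasDerivAt z (hasDerivAt_airyMoment_zero z)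
  rw [airyAiDeriv, funext airyAi_eq_re_airyMoment, (hre.const_mul (1 / Real.pi)).deriv]
  simp

theorem continuous_airyAi : Continuous airyAi := by
  have := continuous_airyMoment zero_le_one
  rw [funext airyAi_eq_re_airyMoment]
  fun_prop

theorem continuous_airyAiDeriv : Continuous airyAiDeriv := by
  have := continuous_airyMoment le_rfl
  rw [funext airyAiDeriv_eq_im_airyMoment]
  fun_prop

/-- The improper integral `∫ σ^j exp (i (z σ + σ³ / 3)) dσ` over the whole line, `j ≤ 1`; the two
half lines contribute complex conjugates up to the parity of `σ^j`. -/
noncomputable def airyLineMoment (j : ℕ) (z : ℝ) : ℂ :=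
  airyMoment j z + (-1) ^ j * conj (airyMoment j z)

theorem airyLineMoment_zero (z : ℝ) : airyLineMoment 0 z = 2 * Real.pi * airyAi z := by
  rw [airyLineMoment, airyAi_eq_re_airyMoment, pow_zero, one_mul, add_conj]
  push_cast
  field_simp

theorem airyLineMoment_one (z : ℝ) :
    airyLineMoment 1 z = -(2 * Real.pi * I * airyAiDeriv z) := by
  rw [airyLineMoment, airyAiDeriv_eq_im_airyMoment, pow_one, neg_one_mul, ← sub_eq_add_neg,
    sub_conj]
  push_cast
  field_simp

/-! ### Oscillatory integrals with a degenerate stationary point -/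

/-- The exponential `exp (i (z s / ε + Θ(s) / ε³))`. With `Θ(s) ~ s³ / 3` near the stationary point
`0`, the substitution `s = ε σ` turns it into the integrand of the Airy function. -/
noncomputable def scaledExp (Θ : ℝ → ℝ) (z ε s : ℝ) : ℂ :=
  cexp (I * ((z * (s / ε) + Θ s / ε ^ 3 : ℝ) : ℂ))

theorem norm_scaledExp (Θ : ℝ → ℝ) (z ε s : ℝ) : ‖scaledExp Θ z ε s‖ = 1 :=
  norm_exp_I_mul_ofReal _

theorem continuousOn_scaledExp {Θ : ℝ → ℝ} {S : Set ℝ} (h : ContinuousOn Θ S) (z ε : ℝ) :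
    ContinuousOn (scaledExp Θ z ε) S := by
  unfold scaledExp; fun_prop

theorem continuous_scaledExp {Θ : ℝ → ℝ} (h : Continuous Θ) (z ε : ℝ) :
    Continuous (scaledExp Θ z ε) :=
  continuousOn_univ.1 (continuousOn_scaledExp h.continuousOn z ε)

theorem hasDerivAt_scaledExp {Θ : ℝ → ℝ} {Θ' s : ℝ} (h : HasDerivAt Θ Θ' s) (z ε : ℝ) :
    HasDerivAt (scaledExp Θ z ε)
      (I * ((z * (1 / ε) + Θ' / ε ^ 3 : ℝ) : ℂ) * scaledExp Θ z ε s) s :=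
  hasDerivAt_cexp_phase ((((hasDerivAt_id' s).div_const ε).const_mul z).fun_add
    (h.div_const (ε ^ 3)))

theorem scaledExp_neg (Θ : ℝ → ℝ) (z ε s : ℝ) :
    scaledExp Θ z ε (-s) = conj (scaledExp (fun s => -Θ (-s)) z ε s) := by
  rw [scaledExp, scaledExp, ← exp_conj, map_mul, conj_I, conj_ofReal]
  congr 1
  push_cast
  ring

theorem integral_neg_zero_mul_scaledExp (u : ℝ → ℂ) (Θ : ℝ → ℝ) (z ε c d : ℝ) :
    ∫ s in (-d)..(-c), u s * scaledExp Θ z ε s =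
      conj (∫ s in c..d, conj (u (-s)) * scaledExp (fun s => -Θ (-s)) z ε s) := by
  rw [← intervalIntegral.integral_comp_neg (fun s => u s * scaledExp Θ z ε s)]
  simp only [intervalIntegral, scaledExp_neg, map_sub, ← integral_conj, map_mul, conj_conj]

theorem integral_neg_mul_scaledExp {u : ℝ → ℂ} {Θ : ℝ → ℝ} (hu : Continuous u) (hΘ : Continuous Θ)
    (z ε r : ℝ) :
    ∫ s in (-r)..r, u s * scaledExp Θ z ε s =
      conj (∫ s in (0 : ℝ)..r, conj (u (-s)) * scaledExp (fun s => -Θ (-s)) z ε s) +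
        ∫ s in (0 : ℝ)..r, u s * scaledExp Θ z ε s := by
  have hint : ∀ c d, IntervalIntegrable (fun s => u s * scaledExp Θ z ε s) volume c d :=
    (hu.mul (continuous_scaledExp hΘ z ε)).intervalIntegrable
  rw [← integral_neg_zero_mul_scaledExp, neg_zero,
    intervalIntegral.integral_add_adjacent_intervals (hint _ _) (hint _ _)]

theorem norm_integral_mul_scaledExp_le {j : ℕ} (hj : j ≤ 1) {ρ d κ L A z ε : ℝ} (hρ : 0 < ρ)
    (hρd : ρ ≤ d) (hκ : 0 < κ) (hε : 0 < ε) (hz : 2 * |z| * ε ^ 2 ≤ κ * ρ ^ 2)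
    {v v' : ℝ → ℂ} {Θ f f' : ℝ → ℝ}
    (hv : ∀ s ∈ Icc ρ d, HasDerivAt v (v' s) s) (hΘ : ∀ s ∈ Icc ρ d, HasDerivAt Θ (f s) s)
    (hf : ∀ s ∈ Icc ρ d, HasDerivAt f (f' s) s) (hv'c : ContinuousOn v' (Icc ρ d))
    (hf'c : ContinuousOn f' (Icc ρ d)) (hκf : ∀ s ∈ Icc ρ d, κ * s ^ 2 ≤ f s)
    (hLf' : ∀ s ∈ Icc ρ d, |f' s| ≤ L * s) (hvA : ∀ s ∈ Icc ρ d, ‖v s‖ ≤ A * s ^ j)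
    (hv'A : ∀ s ∈ Icc ρ d, ‖v' s‖ * s ≤ A * s ^ j) :
    ‖∫ s in ρ..d, v s * scaledExp Θ z ε s‖ ≤
      A * (2 / κ) * (3 + 2 * L / κ) * (ρ ^ j / ρ ^ 2) * ε ^ 3 := by
  refine (norm_integral_mul_cexp_cubic_le hj (κ := κ / (2 * ε ^ 3)) (L := L / ε ^ 3) hρ hρd
    (by positivity) (ψ' := fun s => z * (1 / ε) + f s / ε ^ 3) (ψ'' := fun s => f' s / ε ^ 3) hv
    (fun s hs => (((hasDerivAt_id' s).div_const ε).const_mul z).fun_add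
      ((hΘ s hs).div_const (ε ^ 3)))
    (fun s hs => ((hf s hs).div_const (ε ^ 3)).const_add _) hv'c (by fun_prop)
    (fun s hs => ?_) (fun s hs => ?_) hvA hv'A).trans_eq (by field_simp)
  · have hzs : 2 * |z| * ε ^ 2 ≤ κ * s ^ 2 :=
      hz.trans (by have := hs.1; gcongr)
    have := hκf s hs
    have : -(z * ε ^ 2) ≤ |z| * ε ^ 2 := by nlinarith [neg_abs_le z, sq_nonneg ε]
    rw [← sub_nonneg, show z * (1 / ε) + f s / ε ^ 3 - κ / (2 * ε ^ 3) * s ^ 2 =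
      (2 * (z * ε ^ 2) + 2 * f s - κ * s ^ 2) / (2 * ε ^ 3) by field_simp]
    exact div_nonneg (by linarith) (by positivity)
  · rw [abs_div, abs_of_pos (pow_pos hε 3), div_mul_eq_mul_div]
    exact div_le_div_of_nonneg_right (hLf' s hs) (by positivity)

theorem integral_mul_scaledExp_by_parts {a b z ε : ℝ} (hε : ε ≠ 0) {Θ f : ℝ → ℝ} {u u' : ℝ → ℂ}
    (hu : ∀ s ∈ uIcc a b, HasDerivAt u (u' s) s) (hΘ : ∀ s ∈ uIcc a b, HasDerivAt Θ (f s) s)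
    (hu' : ContinuousOn u' (uIcc a b)) (hf : ContinuousOn f (uIcc a b)) (ha : u a = 0)
    (hb : u b = 0) :
    ∫ s in a..b, (f s : ℂ) * u s * scaledExp Θ z ε s =
      I * ε ^ 3 * (∫ s in a..b, u' s * scaledExp Θ z ε s) -
        z * ε ^ 2 * ∫ s in a..b, u s * scaledExp Θ z ε s := by
  have hΘc : ContinuousOn Θ (uIcc a b) := fun s hs => (hΘ s hs).continuousAt.continuousWithinAt
  have huc : ContinuousOn u (uIcc a b) := fun s hs => (hu s hs).continuousAt.continuousWithinAt
  have hEc := continuousOn_scaledExp hΘc z ε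
  have hε' : (ε : ℂ) ≠ 0 := ofReal_ne_zero.2 hε
  have hparts : ∫ s in a..b, u s * (I * ((z * (1 / ε) + f s / ε ^ 3 : ℝ) : ℂ) *
      scaledExp Θ z ε s) = -∫ s in a..b, u' s * scaledExp Θ z ε s := by
    rw [intervalIntegral.integral_mul_deriv_eq_deriv_mul hu
      (fun s hs => hasDerivAt_scaledExp (hΘ s hs) z ε) hu'.intervalIntegrable
      (ContinuousOn.intervalIntegrable (by fun_prop)), ha, hb, zero_mul, zero_mul, sub_zero,
      zero_sub]
  have hsplit : ∀ s, (f s : ℂ) * u s * scaledExp Θ z ε s =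
      -(I * ε ^ 3) * (u s * (I * ((z * (1 / ε) + f s / ε ^ 3 : ℝ) : ℂ) * scaledExp Θ z ε s)) -
        z * ε ^ 2 * (u s * scaledExp Θ z ε s) := fun s => by
    push_cast
    field_simp
    linear_combination ((ε ^ 2 * z + f s) * u s * scaledExp Θ z ε s : ℂ) * I_sq
  simp only [hsplit]
  rw [intervalIntegral.integral_sub (ContinuousOn.intervalIntegrable (by fun_prop))
    (ContinuousOn.intervalIntegrable (by fun_prop)), intervalIntegral.integral_const_mul,
    intervalIntegral.integral_const_mul, hparts]
  ring

theorem integral_pow_add_two_mul_scaledExp (m : ℕ) {a b z ε : ℝ} (hε : ε ≠ 0) {Θ k : ℝ → ℝ}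
    {c c' : ℝ → ℂ} (hc : ∀ s, HasDerivAt c (c' s) s) (hΘ : ∀ s, HasDerivAt Θ (s ^ 2 * k s) s)
    (hc' : Continuous c') (hk : Continuous k) (ha : c a = 0) (hb : c b = 0) :
    ∫ s in a..b, (s : ℂ) ^ (m + 2) * ((k s : ℂ) * c s) * scaledExp Θ z ε s =
      I * ε ^ 3 * (m * (∫ s in a..b, (s : ℂ) ^ (m - 1) * c s * scaledExp Θ z ε s) +
        ∫ s in a..b, (s : ℂ) ^ m * c' s * scaledExp Θ z ε s) -
      z * ε ^ 2 * ∫ s in a..b, (s : ℂ) ^ m * c s * scaledExp Θ z ε s := by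
  have hcc : Continuous c := continuous_iff_continuousAt.2 fun s => (hc s).continuousAt
  have hΘc : Continuous Θ := continuous_iff_continuousAt.2 fun s => (hΘ s).continuousAt
  have hEc := continuous_scaledExp hΘc z ε
  have hparts := integral_mul_scaledExp_by_parts (z := z) hε (u := fun s => (s : ℂ) ^ m * c s)
    (fun s _ => ((hasDerivAt_id' s).ofReal_comp.fun_pow m).fun_mul (hc s)) (fun s _ => hΘ s)
    (a := a) (b := b) (by fun_prop) (by fun_prop) (by simp only [ha, mul_zero])
    (by simp only [hb, mul_zero])
  rw [← intervalIntegral.integral_const_mul (m : ℂ), ← intervalIntegral.integral_add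
    (Continuous.intervalIntegrable (by fun_prop) _ _)
    (Continuous.intervalIntegrable (by fun_prop) _ _)]
  have hleft : ∀ s : ℝ, (s : ℂ) ^ (m + 2) * ((k s : ℂ) * c s) * scaledExp Θ z ε s =
      ((s ^ 2 * k s : ℝ) : ℂ) * ((s : ℂ) ^ m * c s) * scaledExp Θ z ε s := fun s => by
    push_cast; ring
  have hright : ∀ s : ℝ, m * ((s : ℂ) ^ (m - 1) * c s * scaledExp Θ z ε s) +
      (s : ℂ) ^ m * c' s * scaledExp Θ z ε s =
      (m * (s : ℂ) ^ (m - 1) * ((1 : ℝ) : ℂ) * c s + (s : ℂ) ^ m * c' s) * scaledExp Θ z ε s :=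
    fun s => by push_cast; ring
  simp only [hleft, hright, hparts]

/-- Trivial estimate on `[0, R ε]`, integration by parts on `[R ε, r]`. -/
theorem norm_integral_zero_mul_scaledExp_le {j : ℕ} (hj : j ≤ 1) {r R κ L A z ε : ℝ} (hR : 0 < R)
    (hκ : 0 < κ) (hε : 0 < ε) (hz : 2 * |z| ≤ κ * R ^ 2) (hRε : R * ε ≤ r)
    {v v' : ℝ → ℂ} {Θ f f' : ℝ → ℝ}
    (hv : ∀ s ∈ Icc 0 r, HasDerivAt v (v' s) s) (hΘ : ∀ s ∈ Icc 0 r, HasDerivAt Θ (f s) s)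
    (hf : ∀ s ∈ Icc 0 r, HasDerivAt f (f' s) s) (hv'c : ContinuousOn v' (Icc 0 r))
    (hf'c : ContinuousOn f' (Icc 0 r)) (hκf : ∀ s ∈ Icc 0 r, κ * s ^ 2 ≤ f s)
    (hLf' : ∀ s ∈ Icc 0 r, |f' s| ≤ L * s) (hvA : ∀ s ∈ Icc 0 r, ‖v s‖ ≤ A * s ^ j)
    (hv'A : ∀ s ∈ Icc 0 r, ‖v' s‖ * s ≤ A * s ^ j) :
    ‖∫ s in (0 : ℝ)..r, v s * scaledExp Θ z ε s‖ ≤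
      A * (R ^ (j + 1) + (2 / κ) * (3 + 2 * L / κ) * (R ^ j / R ^ 2)) * ε ^ (j + 1) := by
  have hρ : 0 < R * ε := mul_pos hR hε
  have hsub : Icc (R * ε) r ⊆ Icc 0 r := Icc_subset_Icc_left hρ.le
  have hA : 0 ≤ A := nonneg_of_mul_nonneg_left
    ((norm_nonneg _).trans (hvA (R * ε) ⟨hρ.le, hRε⟩)) (by positivity)
  have hint : ∀ c ∈ Icc 0 r, ∀ d ∈ Icc 0 r,
      IntervalIntegrable (fun s => v s * scaledExp Θ z ε s) volume c d := fun c hc d hd => by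
    refine (ContinuousOn.mono (ContinuousOn.mul (fun s hs => ?_) (continuousOn_scaledExp
      (fun s hs => ?_) z ε)) (uIcc_subset_Icc hc hd)).intervalIntegrable
    exacts [(hv s hs).continuousAt.continuousWithinAt, (hΘ s hs).continuousAt.continuousWithinAt]
  have hnear : ‖∫ s in (0 : ℝ)..(R * ε), v s * scaledExp Θ z ε s‖ ≤
      A * (R * ε) ^ j * |R * ε - 0| :=
    intervalIntegral.norm_integral_le_of_norm_le_const fun s hs => by
      rw [uIoc_of_le hρ.le] at hs
      rw [norm_mul, norm_scaledExp, mul_one]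
      exact (hvA s ⟨hs.1.le, hs.2.trans hRε⟩).trans (by have := hs.1.le; have := hs.2; gcongr)
  have hfar := norm_integral_mul_scaledExp_le hj hρ hRε hκ hε
    (by nlinarith [mul_le_mul_of_nonneg_right hz (sq_nonneg ε)]) (fun s hs => hv s (hsub hs))
    (fun s hs => hΘ s (hsub hs)) (fun s hs => hf s (hsub hs)) (hv'c.mono hsub) (hf'c.mono hsub)
    (fun s hs => hκf s (hsub hs)) (fun s hs => hLf' s (hsub hs)) (fun s hs => hvA s (hsub hs))
    (fun s hs => hv'A s (hsub hs))
  rw [← intervalIntegral.integral_add_adjacent_intervals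
    (hint 0 ⟨le_rfl, hρ.le.trans hRε⟩ _ ⟨hρ.le, hRε⟩) (hint _ ⟨hρ.le, hRε⟩ r
    ⟨hρ.le.trans hRε, le_rfl⟩)]
  refine (norm_add_le _ _).trans ((add_le_add hnear hfar).trans_eq ?_)
  rw [sub_zero, abs_of_pos hρ]
  field_simp
  ring

/-- The partial derivative of a function on the plane in its second variable. -/
noncomputable def derivSnd {E : Type*} [NormedAddCommGroup E] [NormedSpace ℝ E] (b : ℝ × ℝ → E)
    (p : ℝ × ℝ) : E :=
  fderiv ℝ b p (0, 1)

theorem contDiff_derivSnd {E : Type*} [NormedAddCommGroup E] [NormedSpace ℝ E] {b : ℝ × ℝ → E}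
    (hb : ContDiff ℝ ∞ b) : ContDiff ℝ ∞ (derivSnd b) :=
  (hb.fderiv_right (by simp)).clm_apply contDiff_const

theorem hasDerivAt_derivSnd {E : Type*} [NormedAddCommGroup E] [NormedSpace ℝ E] {b : ℝ × ℝ → E}
    (hb : ContDiff ℝ ∞ b) (θ s : ℝ) :
    HasDerivAt (fun s => b (θ, s)) (derivSnd b (θ, s)) s :=
  (hb.differentiable (by simp) _).hasFDerivAt.comp_hasDerivAt s
    ((hasDerivAt_const s θ).prodMk (hasDerivAt_id s))

theorem tsupport_derivSnd_subset {E : Type*} [NormedAddCommGroup E] [NormedSpace ℝ E]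
    {b : ℝ × ℝ → E} (hb : ContDiff ℝ ∞ b) (θ : ℝ) :
    tsupport (fun s => derivSnd b (θ, s)) ⊆ tsupport (fun s => b (θ, s)) := by
  rw [← funext fun s => (hasDerivAt_derivSnd hb θ s).deriv]
  exact tsupport_deriv_subset

theorem norm_integral_zero_pow_mul_scaledExp_le {j : ℕ} (hj : j ≤ 1) {r R κ A A' B B' z ε : ℝ}
    (hR : 0 < R) (hκ : 0 < κ) (hε : 0 < ε) (hz : 2 * |z| ≤ κ * R ^ 2) (hRε : R * ε ≤ r)
    {b b' : ℝ → ℂ} {k k' Θ : ℝ → ℝ}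
    (hb : ∀ s ∈ Icc 0 r, HasDerivAt b (b' s) s) (hk : ∀ s ∈ Icc 0 r, HasDerivAt k (k' s) s)
    (hΘ : ∀ s ∈ Icc 0 r, HasDerivAt Θ (s ^ 2 * k s) s) (hb'c : ContinuousOn b' (Icc 0 r))
    (hk'c : ContinuousOn k' (Icc 0 r)) (hκk : ∀ s ∈ Icc 0 r, κ ≤ k s)
    (hA : ∀ s ∈ Icc 0 r, ‖b s‖ ≤ A) (hA' : ∀ s ∈ Icc 0 r, ‖b' s‖ ≤ A')
    (hB : ∀ s ∈ Icc 0 r, ‖k s‖ ≤ B) (hB' : ∀ s ∈ Icc 0 r, ‖k' s‖ ≤ B') :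
    ‖∫ s in (0 : ℝ)..r, (s : ℂ) ^ j * b s * scaledExp Θ z ε s‖ ≤
      (A + A' * r) * (R ^ (j + 1) + (2 / κ) * (3 + 2 * (2 * B + B' * r) / κ) * (R ^ j / R ^ 2)) *
        ε ^ (j + 1) := by
  have hbc : ContinuousOn b (Icc 0 r) := fun s hs => (hb s hs).continuousAt.continuousWithinAt
  have hkc : ContinuousOn k (Icc 0 r) := fun s hs => (hk s hs).continuousAt.continuousWithinAt
  have hmul : ∀ s ∈ Icc 0 r, ∀ x y : ℝ, 0 ≤ x → x ≤ y → x * s ≤ y * r :=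
    fun s hs x y hx hxy => mul_le_mul hxy hs.2 hs.1 (hx.trans hxy)
  refine norm_integral_zero_mul_scaledExp_le hj hR hκ hε hz hRε
    (fun s hs => ((hasDerivAt_id' s).ofReal_comp.fun_pow j).fun_mul (hb s hs)) hΘ
    (fun s hs => ((hasDerivAt_id' s).fun_pow 2).fun_mul (hk s hs))
    (by fun_prop) (by fun_prop) (fun s hs => ?_) (fun s hs => ?_) (fun s hs => ?_) (fun s hs => ?_)
  · rw [mul_comm]
    exact mul_le_mul_of_nonneg_left (hκk s hs) (sq_nonneg s)
  · have h0 := hs.1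
    refine (abs_add_le _ _).trans ?_
    have := hmul s hs _ _ (norm_nonneg _) (hB' s hs)
    have := hB s hs
    simp only [abs_mul, abs_pow, abs_of_nonneg h0, Real.norm_eq_abs] at *
    norm_num
    nlinarith
  · have h0 := hs.1
    have := (hA s hs).trans (le_add_of_nonneg_right
      ((mul_nonneg (norm_nonneg _) h0).trans (hmul s hs _ _ (norm_nonneg _) (hA' s hs))))
    rw [norm_mul, norm_pow, norm_real, Real.norm_of_nonneg h0, mul_comm]
    gcongr
  · have h0 := hs.1
    have h1 := hA s hs
    have h2 := hmul s hs _ _ (norm_nonneg _) (hA' s hs)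
    interval_cases j
    · simpa using h2.trans (le_add_of_nonneg_left ((norm_nonneg _).trans h1))
    · refine (mul_le_mul_of_nonneg_right (norm_add_le _ _) h0).trans ?_
      simp [abs_of_nonneg h0]
      nlinarith

theorem isBigO_pow_of_le {ι : Type*} {l : Filter ι} {ε : ι → ℝ} {m n : ℕ}
    (hε : ε =O[l] fun _ => (1 : ℝ)) (h : m ≤ n) : (fun i => ε i ^ n) =O[l] fun i => ε i ^ m := by
  simpa [← pow_add, Nat.add_sub_cancel' h] using (isBigO_refl (ε · ^ m) l).mul (hε.pow (n - m))

theorem isBigO_conj_left {ι : Type*} {l : Filter ι} {f : ι → ℂ} {g : ι → ℝ} :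
    (fun i => conj (f i)) =O[l] g ↔ f =O[l] g := by
  rw [← isBigO_norm_left, ← isBigO_norm_left (f' := f)]
  simp only [RCLike.norm_conj]

section Moments

variable {ι : Type*} {l : Filter ι} {ε z θ : ι → ℝ}

theorem isBigO_integral_zero_pow_mul_scaledExp {j : ℕ} (hj : j ≤ 1) {r : ℝ} (hr : 0 < r)
    {b : ℝ × ℝ → ℂ} {k : ℝ × ℝ → ℝ} {Θ : ℝ → ℝ → ℝ} (hb : ContDiff ℝ ∞ b) (hk : ContDiff ℝ ∞ k)
    (hk0 : ∀ p, 0 < k p) (hΘ : ∀ θ s, HasDerivAt (Θ θ) (s ^ 2 * k (θ, s)) s)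
    (hε : Tendsto ε l (𝓝[>] 0)) (hz : z =O[l] fun _ => (1 : ℝ)) (hθ : θ =O[l] fun _ => (1 : ℝ)) :
    (fun i => ∫ s in (0 : ℝ)..r, (s : ℂ) ^ j * b (θ i, s) * scaledExp (Θ (θ i)) (z i) (ε i) s)
      =O[l] fun i => ε i ^ (j + 1) := by
  have hb' := (contDiff_derivSnd hb).continuous
  have hk' := (contDiff_derivSnd hk).continuous
  obtain ⟨K, hK⟩ := hz.bound
  obtain ⟨M, hM⟩ := hθ.bound
  have hQ : IsCompact (Icc (-M) M ×ˢ Icc 0 r) := isCompact_Icc.prod isCompact_Icc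
  obtain ⟨A, hA⟩ := hQ.exists_bound_of_continuousOn hb.continuous.continuousOn
  obtain ⟨A', hA'⟩ := hQ.exists_bound_of_continuousOn hb'.continuousOn
  obtain ⟨B, hB⟩ := hQ.exists_bound_of_continuousOn hk.continuous.continuousOn
  obtain ⟨B', hB'⟩ := hQ.exists_bound_of_continuousOn hk'.continuousOn
  obtain ⟨κ, hκ, hκk⟩ := hQ.exists_forall_le' hk.continuous.continuousOn fun p _ => hk0 p
  obtain ⟨R, hR, hKR⟩ := (eventually_two_mul_abs_le_sq (K / κ)).exists
  have hRε : ∀ᶠ i in l, R * ε i < r :=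
    ((tendsto_nhds_of_tendsto_nhdsWithin hε).const_mul R).eventually_lt_const (by simpa)
  refine IsBigO.of_bound ((A + A' * r) * (R ^ (j + 1) + (2 / κ) *
    (3 + 2 * (2 * B + B' * r) / κ) * (R ^ j / R ^ 2))) ?_
  filter_upwards [hK, hM, hRε, hε self_mem_nhdsWithin] with i hKi hMi hRi (hεi : 0 < ε i)
  simp only [norm_one, mul_one, Real.norm_eq_abs] at hKi hMi
  have hmem : ∀ s ∈ Icc 0 r, (θ i, s) ∈ Icc (-M) M ×ˢ Icc 0 r := fun s hs => ⟨abs_le.1 hMi, hs⟩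
  have hKR' : 2 * |z i| ≤ κ * R ^ 2 := by
    rw [← mul_div_assoc, div_le_iff₀' hκ] at hKR
    linarith
  rw [norm_pow, Real.norm_of_nonneg hεi.le]
  exact norm_integral_zero_pow_mul_scaledExp_le hj hR hκ hεi hKR' hRi.le
    (fun s _ => hasDerivAt_derivSnd hb _ s) (fun s _ => hasDerivAt_derivSnd hk _ s)
    (fun s _ => hΘ _ s) (by fun_prop) (by fun_prop) (fun s hs => hκk _ (hmem s hs))
    (fun s hs => hA _ (hmem s hs)) (fun s hs => hA' _ (hmem s hs))
    (fun s hs => hB _ (hmem s hs)) (fun s hs => hB' _ (hmem s hs))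

theorem isBigO_integral_pow_mul_scaledExp_of_le_one {j : ℕ} (hj : j ≤ 1) {r : ℝ} (hr : 0 < r)
    {b : ℝ × ℝ → ℂ} {k : ℝ × ℝ → ℝ} {Θ : ℝ → ℝ → ℝ} (hb : ContDiff ℝ ∞ b) (hk : ContDiff ℝ ∞ k)
    (hk0 : ∀ p, 0 < k p) (hΘ : ∀ θ s, HasDerivAt (Θ θ) (s ^ 2 * k (θ, s)) s)
    (hε : Tendsto ε l (𝓝[>] 0)) (hz : z =O[l] fun _ => (1 : ℝ)) (hθ : θ =O[l] fun _ => (1 : ℝ)) :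
    (fun i => ∫ s in (-r)..r, (s : ℂ) ^ j * b (θ i, s) * scaledExp (Θ (θ i)) (z i) (ε i) s)
      =O[l] fun i => ε i ^ (j + 1) := by
  have hflip : ContDiff ℝ ∞ fun p : ℝ × ℝ => (p.1, -p.2) := by fun_prop
  have hright := isBigO_integral_zero_pow_mul_scaledExp hj hr hb hk hk0 hΘ hε hz hθ
  have hleft := isBigO_integral_zero_pow_mul_scaledExp
    (b := fun p => (-1) ^ j * conj (b (p.1, -p.2)))
    (k := fun p => k (p.1, -p.2)) (Θ := fun θ s => -Θ θ (-s)) hj hr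
    (contDiff_const.mul (conjCLE.contDiff.comp (hb.comp hflip))) (hk.comp hflip) (fun p => hk0 _)
    (fun θ s => ((hΘ θ (-s)).scomp s (hasDerivAt_neg s)).fun_neg.congr_deriv (by simp)) hε hz hθ
  have hΘc : ∀ θ, Continuous (Θ θ) := fun θ =>
    continuous_iff_continuousAt.2 fun s => (hΘ θ s).continuousAt
  have hbc := hb.continuous
  refine ((isBigO_conj_left.2 hleft).add hright).congr_left fun i => ?_
  rw [integral_neg_mul_scaledExp (by fun_prop) (hΘc (θ i))]
  simp only [map_mul, map_pow, map_neg, map_one, conj_ofReal, ofReal_neg,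
    fun s : ℝ => neg_pow (s : ℂ) j, mul_assoc, mul_left_comm]

theorem isBigO_integral_pow_add_two_mul_scaledExp (m : ℕ) {r : ℝ} {c : ℝ × ℝ → ℂ} {k : ℝ × ℝ → ℝ}
    {Θ : ℝ → ℝ → ℝ} (hc : ContDiff ℝ ∞ c) (hcl : ∀ θ, c (θ, -r) = 0) (hcr : ∀ θ, c (θ, r) = 0)
    (hk : Continuous k) (hΘ : ∀ θ s, HasDerivAt (Θ θ) (s ^ 2 * k (θ, s)) s)
    (hε : Tendsto ε l (𝓝[>] 0)) (hz : z =O[l] fun _ => (1 : ℝ))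
    (hlower : (fun i => (m : ℂ) * ∫ s in (-r)..r, (s : ℂ) ^ (m - 1) * c (θ i, s) *
      scaledExp (Θ (θ i)) (z i) (ε i) s) =O[l] fun i => ε i ^ m)
    (hsame : (fun i => ∫ s in (-r)..r, (s : ℂ) ^ m * c (θ i, s) *
      scaledExp (Θ (θ i)) (z i) (ε i) s) =O[l] fun i => ε i ^ (m + 1))
    (hderiv : (fun i => ∫ s in (-r)..r, (s : ℂ) ^ m * derivSnd c (θ i, s) *
      scaledExp (Θ (θ i)) (z i) (ε i) s) =O[l] fun i => ε i ^ (m + 1)) :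
    (fun i => ∫ s in (-r)..r, (s : ℂ) ^ (m + 2) * ((k (θ i, s) : ℂ) * c (θ i, s)) *
      scaledExp (Θ (θ i)) (z i) (ε i) s) =O[l] fun i => ε i ^ (m + 3) := by
  have hc' := (contDiff_derivSnd hc).continuous
  have hε1 : ε =O[l] fun _ => (1 : ℝ) := (tendsto_nhds_of_tendsto_nhdsWithin hε).isBigO_one ℝ
  have hεc : ∀ n, (fun i => (ε i : ℂ) ^ n) =O[l] fun i => ε i ^ n := fun n =>
    IsBigO.of_bound' (Eventually.of_forall fun i => by simp)
  have hzc : (fun i => (z i : ℂ)) =O[l] fun _ => (1 : ℝ) := isBigO_ofReal_left.2 hz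
  refine IsBigO.congr' ((((hεc 3).const_mul_left I).mul
    (hlower.add (hderiv.trans (isBigO_pow_of_le hε1 m.le_succ)))).sub
    (((hzc.mul (hεc 2)).mul hsame).congr_right fun i => by ring)) ?_ (.of_eq (by ext; ring))
  filter_upwards [hε self_mem_nhdsWithin] with i (hεi : 0 < ε i)
  exact (integral_pow_add_two_mul_scaledExp m hεi.ne' (hasDerivAt_derivSnd hc _) (hΘ (θ i))
    (by fun_prop) (by fun_prop) (hcl _) (hcr _)).symm

theorem isBigO_integral_pow_mul_scaledExp (n : ℕ) {r : ℝ} (hr : 0 < r) {b : ℝ × ℝ → ℂ}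
    {k : ℝ × ℝ → ℝ} {Θ : ℝ → ℝ → ℝ} (hb : ContDiff ℝ ∞ b)
    (hbr : ∀ θ, tsupport (fun s => b (θ, s)) ⊆ Ioo (-r) r) (hk : ContDiff ℝ ∞ k)
    (hk0 : ∀ p, 0 < k p) (hΘ : ∀ θ s, HasDerivAt (Θ θ) (s ^ 2 * k (θ, s)) s)
    (hε : Tendsto ε l (𝓝[>] 0)) (hz : z =O[l] fun _ => (1 : ℝ)) (hθ : θ =O[l] fun _ => (1 : ℝ)) :
    (fun i => ∫ s in (-r)..r, (s : ℂ) ^ n * b (θ i, s) * scaledExp (Θ (θ i)) (z i) (ε i) s)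
      =O[l] fun i => ε i ^ (n + 1) := by
  induction n using Nat.strong_induction_on generalizing b with
  | _ n ih =>
  obtain hn | ⟨m, rfl⟩ : n ≤ 1 ∨ ∃ m, n = m + 2 := by
    obtain h | h := le_or_gt n 1
    exacts [.inl h, .inr ⟨n - 2, by omega⟩]
  · exact isBigO_integral_pow_mul_scaledExp_of_le_one hn hr hb hk hk0 hΘ hε hz hθ
  set c : ℝ × ℝ → ℂ := fun p => (k p : ℂ)⁻¹ * b p with hc_def
  have hk0' : ∀ p, (k p : ℂ) ≠ 0 := fun p => ofReal_ne_zero.2 (hk0 p).ne'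
  have hc : ContDiff ℝ ∞ c := ((ofRealCLM.contDiff.comp hk).inv hk0').mul hb
  have hcr : ∀ θ, tsupport (fun s => c (θ, s)) ⊆ Ioo (-r) r :=
    fun θ => tsupport_mul_subset_right.trans (hbr θ)
  have hvanish : ∀ θ, ∀ s ∉ Ioo (-r) r, c (θ, s) = 0 := fun θ s hs =>
    image_eq_zero_of_notMem_tsupport (f := fun s => c (θ, s)) fun h => hs (hcr _ h)
  have hlower : (fun i => (m : ℂ) * ∫ s in (-r)..r, (s : ℂ) ^ (m - 1) * c (θ i, s) *
      scaledExp (Θ (θ i)) (z i) (ε i) s) =O[l] fun i => ε i ^ m := by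
    obtain _ | m := m
    · simpa only [Nat.cast_zero, zero_mul] using isBigO_zero _ l
    · exact (ih m (by omega) hc hcr).const_mul_left _
  have hstep := isBigO_integral_pow_add_two_mul_scaledExp m hc (fun θ => hvanish θ _ (by simp))
    (fun θ => hvanish θ _ (by simp)) hk.continuous hΘ hε hz hlower (ih m (by omega) hc hcr)
    (ih m (by omega) (contDiff_derivSnd hc)
      fun θ => (tsupport_derivSnd_subset hc θ).trans (hcr θ))
  simpa only [hc_def, mul_inv_cancel_left₀ (hk0' _)] using hstep

end Moments

section Homotopy

variable {ι : Type*} {l : Filter ι} {ε z : ι → ℝ}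

/-- The homotopy `θ ↦ s³ τ(θ s)`, `τ = taylorMean 2 k`, from the cubic `k(0) s³ / 3` (at `θ = 0`)
to the primitive of `s² k(s)` (at `θ = 1`). -/
noncomputable def phaseHomotopy (k : ℝ → ℝ) (θ s : ℝ) : ℝ := s ^ 3 * taylorMean 2 k (θ * s)

theorem hasDerivAt_phaseHomotopy {k : ℝ → ℝ} (hk : ContDiff ℝ ∞ k) (θ s : ℝ) :
    HasDerivAt (phaseHomotopy k θ) (s ^ 2 * k (θ * s)) s := by
  have := hasDerivAt_pow_smul_taylorMean 2 (h := fun s => k (θ * s)) (by fun_prop) s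
  exact this.congr_of_eventuallyEq
    (.of_forall fun s => by simp only [phaseHomotopy, taylorMean, smul_eq_mul, mul_assoc])

theorem hasDerivAt_phaseHomotopy_param {k : ℝ → ℝ} (hk : ContDiff ℝ ∞ k) (θ s : ℝ) :
    HasDerivAt (fun θ => phaseHomotopy k θ s) (s ^ 4 * taylorMean 3 (deriv k) (θ * s)) θ := by
  refine (((hasDerivAt_taylorMean 2 hk (θ * s)).scomp θ
    ((hasDerivAt_id' θ).mul_const s)).const_mul (s ^ 3)).congr_deriv ?_
  rw [smul_eq_mul]
  ring

theorem continuous_phaseHomotopy {k : ℝ → ℝ} (hk : ContDiff ℝ ∞ k) :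
    Continuous (Function.uncurry (phaseHomotopy k)) := by
  have := (contDiff_taylorMean 2 hk).continuous
  simp only [Function.uncurry_def, phaseHomotopy]
  fun_prop

theorem hasDerivAt_integral_mul_scaledExp_phaseHomotopy {k : ℝ → ℝ} {u : ℝ → ℂ} (hu : Continuous u)
    (hk : ContDiff ℝ ∞ k) (r z ε θ : ℝ) :
    HasDerivAt (fun θ => ∫ s in (-r)..r, u s * scaledExp (phaseHomotopy k θ) z ε s)
      (I / ε ^ 3 * ∫ s in (-r)..r, (s : ℂ) ^ 4 * (taylorMean 3 (deriv k) (θ * s) * u s) *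
        scaledExp (phaseHomotopy k θ) z ε s) θ := by
  have hc := continuous_phaseHomotopy hk
  have hτ := (contDiff_taylorMean 3 (contDiff_infty_iff_deriv.1 hk).2).continuous
  simp only [Function.uncurry_def] at hc
  rw [← intervalIntegral.integral_const_mul]
  refine hasDerivAt_intervalIntegral_of_continuous
    (F := fun θ s => u s * scaledExp (phaseHomotopy k θ) z ε s)
    (F' := fun θ s => I / ε ^ 3 * ((s : ℂ) ^ 4 * (taylorMean 3 (deriv k) (θ * s) * u s) *
      scaledExp (phaseHomotopy k θ) z ε s)) (-r) r ?_ ?_ (fun θ s => ?_) θ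
  · simp only [Function.uncurry_def, scaledExp]; fun_prop
  · simp only [Function.uncurry_def, scaledExp]; fun_prop
  · refine ((hasDerivAt_cexp_phase (((hasDerivAt_phaseHomotopy_param hk θ s).div_const
      (ε ^ 3)).const_add (z * (s / ε)))).const_mul (u s)).congr_deriv ?_
    rw [scaledExp]
    push_cast
    ring

/-- Moving the phase along `phaseHomotopy` brings down a factor `s⁴ / ε³`, which costs one power of
`ε`. -/
theorem isBigO_integral_scaledExp_sub_cube (n : ℕ) {r : ℝ} (hr : 0 < r) {u : ℝ → ℂ} {k Θ : ℝ → ℝ}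
    (hu : ContDiff ℝ ∞ u) (hur : tsupport u ⊆ Ioo (-r) r) (hk : ContDiff ℝ ∞ k)
    (hk_pos : ∀ s, 0 < k s) (hk0 : k 0 = 1) (hΘ : ∀ s, HasDerivAt Θ (s ^ 2 * k s) s)
    (hΘ0 : Θ 0 = 0) (hε : Tendsto ε l (𝓝[>] 0)) (hz : z =O[l] fun _ => (1 : ℝ)) :
    (fun i => (∫ s in (-r)..r, (s : ℂ) ^ n * u s * scaledExp Θ (z i) (ε i) s) -
      ∫ s in (-r)..r, (s : ℂ) ^ n * u s * scaledExp (fun s => s ^ 3 / 3) (z i) (ε i) s)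
      =O[l] fun i => ε i ^ (n + 2) := by
  have hτ := contDiff_taylorMean 3 (contDiff_infty_iff_deriv.1 hk).2
  have hone : phaseHomotopy k 1 = Θ := funext fun s => by
    rw [phaseHomotopy, one_mul, eq_pow_smul_taylorMean hk (by simpa using hΘ) hΘ0, smul_eq_mul]
  have hzero : phaseHomotopy k 0 = fun s => s ^ 3 / 3 := funext fun s => by
    rw [phaseHomotopy, zero_mul, taylorMean_zero_right, hk0]
    norm_num [div_eq_mul_inv]
  have hmoment := isBigO_integral_pow_mul_scaledExp (n + 4) (l := l ×ˢ 𝓟 (Icc (0 : ℝ) 1))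
    (ε := fun p => ε p.1) (z := fun p => z p.1) (θ := Prod.snd) hr
    (b := fun p => taylorMean 3 (deriv k) (p.1 * p.2) * u p.2) (k := fun p => k (p.1 * p.2))
    (Θ := phaseHomotopy k)
    ((ofRealCLM.contDiff.comp (hτ.comp (contDiff_fst.mul contDiff_snd))).mul
      (hu.comp contDiff_snd)) (fun θ => tsupport_mul_subset_right.trans hur)
    (hk.comp (contDiff_fst.mul contDiff_snd)) (fun p => hk_pos _)
    (hasDerivAt_phaseHomotopy hk) (hε.comp tendsto_fst) (hz.comp_tendsto tendsto_fst)
    (IsBigO.of_bound 1 ((tendsto_snd.eventually (eventually_mem_principal _)).mono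
      fun p hp => by simpa [abs_of_nonneg hp.1] using hp.2))
  obtain ⟨C, hC⟩ := hmoment.bound
  rw [eventually_prod_principal_iff] at hC
  refine IsBigO.of_bound C ?_
  filter_upwards [hC, hε self_mem_nhdsWithin] with i hCi (hεi : 0 < ε i)
  have hlip := norm_image_sub_le_of_norm_deriv_le_segment_01' (C := C * ε i ^ (n + 2))
    (fun θ _ => (hasDerivAt_integral_mul_scaledExp_phaseHomotopy (u := fun s => (s : ℂ) ^ n * u s)
      (have := hu.continuous; by fun_prop) hk r (z i) (ε i) θ).hasDerivWithinAt) (fun θ hθ => ?_)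
  · simpa only [hone, hzero, norm_pow, Real.norm_of_nonneg hεi.le] using hlip
  · have hmom := hCi θ (Ico_subset_Icc_self hθ)
    have hcollect : ∀ s : ℝ, (s : ℂ) ^ 4 * (taylorMean 3 (deriv k) (θ * s) * ((s : ℂ) ^ n * u s)) =
        (s : ℂ) ^ (n + 4) * (taylorMean 3 (deriv k) (θ * s) * u s) := fun s => by ring
    simp only [hcollect, norm_mul, norm_div, norm_pow, norm_I, norm_real,
      Real.norm_of_nonneg hεi.le] at hmom ⊢
    refine (mul_le_mul_of_nonneg_left hmom (by positivity)).trans_eq ?_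
    field_simp
    ring

end Homotopy

section Airy

variable {ι : Type*} {l : Filter ι} {ε z : ι → ℝ}

theorem eventually_two_mul_abs_mul_sq_le {m : ℝ} (hm : 0 < m) (hε : Tendsto ε l (𝓝[>] 0))
    (hz : z =O[l] fun _ => (1 : ℝ)) : ∀ᶠ i in l, 2 * |z i| * ε i ^ 2 ≤ m := by
  have hlim : Tendsto (fun i => z i * ε i ^ 2) l (𝓝 0) :=
    (hz.mul (isBigO_refl (ε · ^ 2) l)).trans_tendsto
      (by simpa using (tendsto_nhds_of_tendsto_nhdsWithin hε).pow 2)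
  filter_upwards [(hlim.abs.const_mul 2).eventually_le_const (u := m) (by simpa)] with i hi
  rwa [abs_mul, abs_sq, ← mul_assoc] at hi

theorem isBigO_integral_mul_scaledExp_of_pos {c d : ℝ} (hc : 0 < c) (hcd : c ≤ d) {v : ℝ → ℂ}
    {Θ f : ℝ → ℝ} (hv : ContDiff ℝ 1 v) (hΘ : ∀ s, HasDerivAt Θ (f s) s) (hf : ContDiff ℝ 1 f)
    (hpos : ∀ s ∈ Icc c d, 0 < f s) (hε : Tendsto ε l (𝓝[>] 0)) (hz : z =O[l] fun _ => (1 : ℝ)) :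
    (fun i => ∫ s in c..d, v s * scaledExp Θ (z i) (ε i) s) =O[l] fun i => ε i ^ 3 := by
  obtain ⟨hvd, hvc⟩ := contDiff_one_iff_deriv.1 hv
  obtain ⟨hfd, hfc⟩ := contDiff_one_iff_deriv.1 hf
  have hd : 0 < d := hc.trans_le hcd
  obtain ⟨m, hm, hmf⟩ := isCompact_Icc.exists_forall_le' hf.continuous.continuousOn hpos
  obtain ⟨A, hA⟩ := isCompact_Icc.exists_bound_of_continuousOn hv.continuous.continuousOn
  obtain ⟨A', hA'⟩ := isCompact_Icc.exists_bound_of_continuousOn hvc.continuousOn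
  obtain ⟨B, hB⟩ := isCompact_Icc.exists_bound_of_continuousOn hfc.continuousOn
  refine IsBigO.of_bound ((A + A' * d) * (2 / (m / d ^ 2)) * (3 + 2 * (B / c) / (m / d ^ 2)) *
    (c ^ 0 / c ^ 2)) ?_
  filter_upwards [eventually_two_mul_abs_mul_sq_le (m := m / d ^ 2 * c ^ 2) (by positivity) hε hz,
    hε self_mem_nhdsWithin] with i hi (hεi : 0 < ε i)
  have hA0 : 0 ≤ A := (norm_nonneg _).trans (hA c (left_mem_Icc.2 hcd))
  have hA'0 : 0 ≤ A' := (norm_nonneg _).trans (hA' c (left_mem_Icc.2 hcd))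
  have hB0 : 0 ≤ B := (norm_nonneg _).trans (hB c (left_mem_Icc.2 hcd))
  rw [norm_pow, Real.norm_of_nonneg hεi.le]
  refine norm_integral_mul_scaledExp_le zero_le_one hc hcd (by positivity) hεi hi
    (fun s _ => (hvd s).hasDerivAt) (fun s _ => hΘ s)
    (fun s _ => (hfd s).hasDerivAt) hvc.continuousOn hfc.continuousOn (fun s hs => ?_)
    (fun s hs => ?_) (fun s hs => ?_) (fun s hs => ?_)
  all_goals have hs0 : 0 < s := hc.trans_le hs.1
  · refine le_trans ?_ (hmf s hs)
    rw [div_mul_eq_mul_div, div_le_iff₀ (by positivity)]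
    have := hs.2
    gcongr
  · refine (hB s hs).trans ?_
    rw [div_mul_eq_mul_div, le_div_iff₀ hc]
    have := hs.1
    gcongr
  · rw [pow_zero, mul_one]
    exact (hA s hs).trans (le_add_of_nonneg_right (by positivity))
  · rw [pow_zero, mul_one]
    exact (mul_le_mul (hA' s hs) hs.2 hs0.le hA'0).trans (le_add_of_nonneg_left hA0)

theorem isBigO_integral_neg_mul_scaledExp_of_pos {c d : ℝ} (hc : 0 < c) (hcd : c ≤ d) {v : ℝ → ℂ}
    {Θ f : ℝ → ℝ} (hv : ContDiff ℝ 1 v) (hΘ : ∀ s, HasDerivAt Θ (f s) s) (hf : ContDiff ℝ 1 f)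
    (hpos : ∀ s ∈ Icc (-d) (-c), 0 < f s) (hε : Tendsto ε l (𝓝[>] 0))
    (hz : z =O[l] fun _ => (1 : ℝ)) :
    (fun i => ∫ s in (-d)..(-c), v s * scaledExp Θ (z i) (ε i) s) =O[l] fun i => ε i ^ 3 := by
  simp only [integral_neg_zero_mul_scaledExp]
  exact isBigO_conj_left.2 (isBigO_integral_mul_scaledExp_of_pos hc hcd
    (v := fun s => conj (v (-s))) (f := fun s => f (-s))
    (conjCLE.contDiff.comp (hv.comp contDiff_neg))
    (fun s => ((hΘ (-s)).scomp s (hasDerivAt_neg s)).fun_neg.congr_deriv (by simp))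
    (hf.comp contDiff_neg) (fun s hs => hpos _ ⟨neg_le_neg hs.2, neg_le_neg hs.1⟩) hε hz)

theorem integral_zero_pow_mul_scaledExp_cube (j : ℕ) {ε : ℝ} (hε : ε ≠ 0) (z r : ℝ) :
    ∫ s in (0 : ℝ)..r, (s : ℂ) ^ j * scaledExp (fun s => s ^ 3 / 3) z ε s =
      ε ^ (j + 1) * airyCut j z (r / ε) := by
  have hscale : ∀ s : ℝ, (s : ℂ) ^ j * scaledExp (fun s => s ^ 3 / 3) z ε s =
      ε ^ j * (((s / ε : ℝ) : ℂ) ^ j * airyExp z (s / ε)) := fun s => by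
    rw [scaledExp, airyExp, ← mul_assoc, ← mul_pow, ← ofReal_mul, mul_div_cancel₀ _ hε, div_pow,
      div_right_comm]
  simp only [hscale, intervalIntegral.integral_const_mul]
  rw [intervalIntegral.integral_comp_div (fun σ : ℝ => (σ : ℂ) ^ j * airyExp z σ) hε, zero_div,
    airyCut, real_smul, ← mul_assoc, ← pow_succ]

variable (χ : ContDiffBump (0 : ℝ))

theorem integral_bump_mul_eq {a b : ℝ} (ha : a ≤ -χ.rOut) (hb : χ.rOut ≤ b) (F : ℝ → ℂ) :
    ∫ s in a..b, (χ s : ℂ) * F s = ∫ s, (χ s : ℂ) * F s := by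
  refine intervalIntegral.integral_eq_integral_of_support_subset fun s hs => ?_
  have hs' : s ∈ Function.support χ := fun h => hs (by simp [h])
  rw [χ.support_eq, Real.ball_eq_Ioo, zero_sub, zero_add] at hs'
  exact ⟨ha.trans_lt hs'.1, hs'.2.le.trans hb⟩

theorem integral_one_sub_bump_mul_eq_zero {a b : ℝ} (ha : |a| ≤ χ.rIn) (hb : |b| ≤ χ.rIn)
    (F : ℝ → ℂ) : ∫ s in a..b, (1 - χ s : ℂ) * F s = 0 := by
  refine intervalIntegral.integral_zero_ae (.of_forall fun s hs => ?_)
  have hs' : s ∈ Icc (-χ.rIn) χ.rIn :=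
    uIcc_subset_Icc (abs_le.1 ha) (abs_le.1 hb) (uIoc_subset_uIcc hs)
  rw [χ.one_of_mem_closedBall (by simpa [abs_le] using hs'), ofReal_one, sub_self, zero_mul]

theorem isBigO_integral_zero_bump_mul_scaledExp_cube {j : ℕ} (hj : j ≤ 1) {r : ℝ}
    (hχr : χ.rOut < r) (hε : Tendsto ε l (𝓝[>] 0)) (hz : z =O[l] fun _ => (1 : ℝ)) :
    (fun i => (∫ s in (0 : ℝ)..r, (s : ℂ) ^ j * χ s * scaledExp (fun s => s ^ 3 / 3) (z i) (ε i) s)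
      - ε i ^ (j + 1) * airyMoment j (z i)) =O[l] fun i => ε i ^ 3 := by
  have hr : χ.rIn ≤ r := χ.rIn_lt_rOut.le.trans hχr.le
  have hr0 : 0 < r := χ.rIn_pos.trans_le hr
  have hcut : (fun i => (ε i : ℂ) ^ (j + 1) * (airyMoment j (z i) - airyCut j (z i) (r / ε i)))
      =O[l] fun i => ε i ^ 3 := by
    refine IsBigO.of_bound (14 * (r ^ j / r ^ 2)) ?_
    filter_upwards [eventually_two_mul_abs_mul_sq_le (pow_pos hr0 2) hε hz,
      hε self_mem_nhdsWithin] with i hi (hεi : 0 < ε i)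
    have hzr : 2 * |z i| ≤ (r / ε i) ^ 2 := by
      rwa [div_pow, le_div_iff₀ (by positivity)]
    have := norm_airyMoment_sub_le hj (div_pos hr0 hεi) hzr
    rw [norm_mul, norm_pow, norm_pow, norm_real, Real.norm_of_nonneg hεi.le]
    refine (mul_le_mul_of_nonneg_left this (by positivity)).trans_eq ?_
    simp only [div_pow]
    field_simp
    ring
  have hχ : ContDiff ℝ 1 fun s => (χ s : ℂ) := ofRealCLM.contDiff.comp χ.contDiff
  have htail := isBigO_integral_mul_scaledExp_of_pos (v := fun s => (1 - χ s) * (s : ℂ) ^ j)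
    (Θ := fun s => s ^ 3 / 3) (f := fun s => s ^ 2) χ.rIn_pos hr
    ((contDiff_const.sub hχ).mul (ofRealCLM.contDiff.pow j))
    (fun s => ((hasDerivAt_pow 3 s).div_const 3).congr_deriv (by norm_num)) (by fun_prop)
    (fun s hs => pow_pos (χ.rIn_pos.trans_le hs.1) 2) hε hz
  refine (hcut.add htail).neg_left.congr' ?_ .rfl
  filter_upwards [hε self_mem_nhdsWithin] with i (hεi : 0 < ε i)
  have hχc := χ.continuous
  have hE := continuous_scaledExp (Θ := fun s => s ^ 3 / 3) (by fun_prop) (z i) (ε i)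
  have hint : ∀ {F : ℝ → ℂ}, Continuous F → ∀ c d, IntervalIntegrable F volume c d :=
    fun hF => hF.intervalIntegrable
  have hone := integral_one_sub_bump_mul_eq_zero χ (a := 0) (b := χ.rIn)
    (by simpa using χ.rIn_pos.le) (abs_of_pos χ.rIn_pos).le
    fun s => (s : ℂ) ^ j * scaledExp (fun s => s ^ 3 / 3) (z i) (ε i) s
  simp only [← mul_assoc] at hone
  rw [mul_sub, ← integral_zero_pow_mul_scaledExp_cube j hεi.ne', ← zero_add (∫ s in χ.rIn..r, _),
    ← hone, intervalIntegral.integral_add_adjacent_intervals (hint (by fun_prop) _ _)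
      (hint (by fun_prop) _ _), sub_add, ← intervalIntegral.integral_sub (hint (by fun_prop) _ _)
      (hint (by fun_prop) _ _), neg_sub]
  congr 1
  exact intervalIntegral.integral_congr fun s _ => by ring

theorem isBigO_integral_bump_mul_scaledExp_cube {j : ℕ} (hj : j ≤ 1) {r : ℝ}
    (hχr : χ.rOut < r) (hε : Tendsto ε l (𝓝[>] 0)) (hz : z =O[l] fun _ => (1 : ℝ)) :
    (fun i => (∫ s in (-r)..r, (s : ℂ) ^ j * χ s * scaledExp (fun s => s ^ 3 / 3) (z i) (ε i) s) -
      ε i ^ (j + 1) * airyLineMoment j (z i)) =O[l] fun i => ε i ^ 3 := by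
  have hright := isBigO_integral_zero_bump_mul_scaledExp_cube χ hj hχr hε hz
  have hχc := χ.continuous
  refine (hright.add ((isBigO_conj_left.2 hright).const_mul_left ((-1) ^ j))).congr_left fun i => ?_
  rw [integral_neg_mul_scaledExp (by fun_prop) (by fun_prop)]
  have hrefl : ∀ s : ℝ, conj (((-s : ℝ) : ℂ) ^ j * χ (-s)) *
      scaledExp (fun s => -((-s) ^ 3 / 3)) (z i) (ε i) s =
      (-1) ^ j * ((s : ℂ) ^ j * χ s * scaledExp (fun s => s ^ 3 / 3) (z i) (ε i) s) := fun s => by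
    simp only [map_mul, map_pow, conj_ofReal, χ.neg, ofReal_neg, neg_pow (s : ℂ) j,
      (show Odd 3 by decide).neg_pow, neg_div, neg_neg, mul_assoc, map_neg, map_one]
  rw [intervalIntegral.integral_congr fun s _ => hrefl s]
  simp only [intervalIntegral.integral_const_mul, airyLineMoment, map_sub, map_mul, map_pow,
    map_neg, map_one, conj_ofReal]
  ring

theorem exists_sq_mul_eq {f : ℝ → ℝ} (hf : ContDiff ℝ ∞ f) (hf0 : f 0 = 0) (hf1 : deriv f 0 = 0) :
    ∃ k : ℝ → ℝ, ContDiff ℝ ∞ k ∧ (∀ s, f s = s ^ 2 * k s) ∧ k 0 = deriv (deriv f) 0 / 2 := by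
  obtain ⟨k, hk, hfk, hk0⟩ := exists_eq_add_smul_add_sq_smul hf
  refine ⟨k, hk, fun s => ?_, ?_⟩
  · rw [hfk, hf0, hf1, zero_add, smul_zero, zero_add, smul_eq_mul]
  · rw [hk0, smul_eq_mul]; ring

theorem exists_eqOn_hasDerivAt_sq_mul {Θ f : ℝ → ℝ} {r R : ℝ} (hr : 0 < r) (hrR : r < R)
    (hΘ : ∀ s, HasDerivAt Θ (f s) s) (hΘ0 : Θ 0 = 0) (hf : ContDiff ℝ ∞ f)
    (hf0 : f 0 = 0) (hf1 : deriv f 0 = 0) (hf2 : deriv (deriv f) 0 = 2)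
    (hpos : ∀ s, |s| ≤ R → s ≠ 0 → 0 < f s) :
    ∃ k Θ₁ : ℝ → ℝ, ContDiff ℝ ∞ k ∧ (∀ s, 0 < k s) ∧ k 0 = 1 ∧
      (∀ s, HasDerivAt Θ₁ (s ^ 2 * k s) s) ∧ Θ₁ 0 = 0 ∧ EqOn Θ₁ Θ (Icc (-r) r) := by
  obtain ⟨h, hh, hfh, hh0⟩ := exists_sq_mul_eq hf hf0 hf1
  rw [hf2, div_self two_ne_zero] at hh0
  have hh_pos : ∀ s, |s| ≤ R → 0 < h s := fun s hs => by
    rcases eq_or_ne s 0 with rfl | hs0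
    · rw [hh0]; exact one_pos
    · exact pos_of_mul_pos_right (hfh s ▸ hpos s hs hs0) (sq_nonneg s)
  let χ : ContDiffBump (0 : ℝ) := ⟨r, R, hr, hrR⟩
  have hk : ContDiff ℝ ∞ fun s => χ s * h s + (1 - χ s) :=
    (χ.contDiff.mul hh).add (contDiff_const.sub χ.contDiff)
  have hΘ₁ : ∀ s, HasDerivAt (phaseHomotopy (fun s => χ s * h s + (1 - χ s)) 1)
      (s ^ 2 * (χ s * h s + (1 - χ s))) s := fun s => by
    simpa only [one_mul] using hasDerivAt_phaseHomotopy hk 1 s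
  refine ⟨_, _, hk, fun s => ?_, ?_, hΘ₁, by simp [phaseHomotopy], fun s hs => ?_⟩
  · rcases le_or_gt |s| R with hsR | hsR
    · simpa using convex_Ioi (0 : ℝ) (hh_pos s hsR) (mem_Ioi.2 one_pos) χ.nonneg
        (sub_nonneg.2 χ.le_one) (add_sub_cancel (χ s) 1)
    · have := χ.zero_of_le_dist (x := s) (by simpa using hsR.le)
      norm_num [this]
  · rw [hh0]; ring
  · have hagree : EqOn (fun s => s ^ 2 * (χ s * h s + (1 - χ s))) f (uIcc 0 s) := fun u hu => by
      have hu' : |u| ≤ r :=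
        abs_le.2 (uIcc_subset_Icc ⟨neg_nonpos.2 hr.le, hr.le⟩ hs hu)
      have := χ.one_of_mem_closedBall (x := u) (by simpa using hu')
      simp [this, hfh]
    have h₁ := intervalIntegral.integral_eq_sub_of_hasDerivAt (fun u _ => hΘ₁ u)
      (Continuous.intervalIntegrable (by have := hk.continuous; fun_prop) 0 s)
    rw [intervalIntegral.integral_congr hagree, intervalIntegral.integral_eq_sub_of_hasDerivAt
      (fun u _ => hΘ u) (hf.continuous.intervalIntegrable 0 s), hΘ0] at h₁
    simpa [phaseHomotopy] using h₁.symm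

theorem tsupport_bump_subset {r : ℝ} (hχr : χ.rOut < r) :
    tsupport (fun s => (χ s : ℂ)) ⊆ Ioo (-r) r := by
  refine (closure_mono (Function.support_comp_subset ofReal_zero χ)).trans ?_
  rw [← tsupport, χ.tsupport_eq, Real.closedBall_eq_Icc]
  exact Icc_subset_Ioo (by linarith) (by linarith)

theorem isBigO_integral_bump_mul_scaledExp (χ : ContDiffBump (0 : ℝ)) {j : ℕ} (hj : j ≤ 1) {r : ℝ}
    (hχr : χ.rOut < r) {k Θ : ℝ → ℝ} (hk : ContDiff ℝ ∞ k) (hk_pos : ∀ s, 0 < k s) (hk0 : k 0 = 1)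
    (hΘ : ∀ s, HasDerivAt Θ (s ^ 2 * k s) s) (hΘ0 : Θ 0 = 0) (hε : Tendsto ε l (𝓝[>] 0))
    (hz : z =O[l] fun _ => (1 : ℝ)) :
    (fun i => (∫ s in (-r)..r, (s : ℂ) ^ j * χ s * scaledExp Θ (z i) (ε i) s) -
      ε i ^ (j + 1) * airyLineMoment j (z i)) =O[l] fun i => ε i ^ (j + 2) := by
  have hr : 0 < r := χ.rOut_pos.trans hχr
  have hε1 : ε =O[l] fun _ => (1 : ℝ) := (tendsto_nhds_of_tendsto_nhdsWithin hε).isBigO_one ℝ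
  refine ((isBigO_integral_scaledExp_sub_cube j hr (ofRealCLM.contDiff.comp χ.contDiff)
    (tsupport_bump_subset χ hχr) hk hk_pos hk0 hΘ hΘ0 hε hz).add
    ((isBigO_integral_bump_mul_scaledExp_cube χ hj hχr hε hz).trans
      (isBigO_pow_of_le hε1 (by omega)))).congr_left fun i => ?_
  exact sub_add_sub_cancel _ _ _

theorem isBigO_add_of_nonneg_left {f g : ι → ℝ} (hf : ∀ᶠ i in l, 0 ≤ f i)
    (hg : ∀ᶠ i in l, 0 ≤ g i) : f =O[l] fun i => f i + g i := by
  refine IsBigO.of_bound' ?_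
  filter_upwards [hf, hg] with i hfi hgi
  rw [Real.norm_of_nonneg hfi, Real.norm_of_nonneg (by positivity)]
  exact le_add_of_nonneg_right hgi

theorem isBigO_add_of_nonneg_right {f g : ι → ℝ} (hf : ∀ᶠ i in l, 0 ≤ f i)
    (hg : ∀ᶠ i in l, 0 ≤ g i) : g =O[l] fun i => f i + g i := by
  simpa only [add_comm] using isBigO_add_of_nonneg_left hg hf

theorem isBigO_integral_bump_mul_mul_scaledExp (χ : ContDiffBump (0 : ℝ)) {r : ℝ}
    (hχr : χ.rOut < r) {k Θ : ℝ → ℝ} (hk : ContDiff ℝ ∞ k) (hk_pos : ∀ s, 0 < k s) (hk0 : k 0 = 1)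
    (hΘ : ∀ s, HasDerivAt Θ (s ^ 2 * k s) s) (hΘ0 : Θ 0 = 0) {g : ℝ → ℂ} (hg : ContDiff ℝ ∞ g)
    (hε : Tendsto ε l (𝓝[>] 0)) (hz : z =O[l] fun _ => (1 : ℝ)) :
    (fun i => (∫ s in (-r)..r, χ s * g s * scaledExp Θ (z i) (ε i) s) -
      2 * Real.pi * ε i * (g 0 * airyAi (z i) - I * ε i * deriv g 0 * airyAiDeriv (z i)))
      =O[l] fun i => ε i ^ 2 * ‖g 0‖ + ε i ^ 3 := by
  obtain ⟨h, hh, hgh, -⟩ := exists_eq_add_smul_add_sq_smul hg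
  have hr : 0 < r := χ.rOut_pos.trans hχr
  have hM := fun {j : ℕ} (hj : j ≤ 1) =>
    isBigO_integral_bump_mul_scaledExp χ hj hχr hk hk_pos hk0 hΘ hΘ0 hε hz
  have hχ : ContDiff ℝ ∞ fun s => (χ s : ℂ) := ofRealCLM.contDiff.comp χ.contDiff
  have hrest := isBigO_integral_pow_mul_scaledExp 2 hr (b := fun p => χ p.2 * h p.2)
    (k := fun p => k p.2) (Θ := fun _ => Θ) (θ := fun _ => 0)
    ((hχ.mul hh).comp contDiff_snd)
    (fun _ => tsupport_mul_subset_left.trans (tsupport_bump_subset χ hχr)) (hk.comp contDiff_snd)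
    (fun _ => hk_pos _) (fun _ => hΘ) hε hz (isBigO_const_const _ one_ne_zero _)
  have hg0 : (fun _ => g 0) =O[l] fun _ => ‖g 0‖ := (isBigO_refl _ l).norm_right
  have hε_pos : ∀ᶠ i in l, 0 < ε i := hε self_mem_nhdsWithin
  have hsq : ∀ᶠ i in l, 0 ≤ ε i ^ 2 * ‖g 0‖ := .of_forall fun _ => by positivity
  have hcube : ∀ᶠ i in l, 0 ≤ ε i ^ 3 := hε_pos.mono fun _ h => by positivity
  have hzeroth := (hg0.mul (hM zero_le_one)).congr_right fun i => mul_comm _ _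
  have hfirst := ((hM le_rfl).const_mul_left (deriv g 0)).add hrest
  refine ((hzeroth.trans (isBigO_add_of_nonneg_left hsq hcube)).add
    (hfirst.trans (isBigO_add_of_nonneg_right hsq hcube))).congr_left fun i => ?_
  have hχc := χ.continuous
  have hhc := hh.continuous
  have hE : Continuous (scaledExp Θ (z i) (ε i)) :=
    continuous_scaledExp (continuous_iff_continuousAt.2 fun s => (hΘ s).continuousAt) _ _
  have hexpand : ∀ s : ℝ, χ s * g s * scaledExp Θ (z i) (ε i) s =
      g 0 * ((s : ℂ) ^ 0 * χ s * scaledExp Θ (z i) (ε i) s) +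
        (deriv g 0 * ((s : ℂ) ^ 1 * χ s * scaledExp Θ (z i) (ε i) s) +
          (s : ℂ) ^ 2 * (χ s * h s) * scaledExp Θ (z i) (ε i) s) := fun s => by
    rw [hgh, real_smul, real_smul, ofReal_pow]
    ring
  simp only [hexpand]
  rw [intervalIntegral.integral_add, intervalIntegral.integral_add,
    intervalIntegral.integral_const_mul, intervalIntegral.integral_const_mul,
    airyLineMoment_zero, airyLineMoment_one]
  · ring
  all_goals exact Continuous.intervalIntegrable (by fun_prop) _ _

theorem integral_eq_bump_add {χ : ContDiffBump (0 : ℝ)} {a b r : ℝ} (hχr : χ.rOut < r) (ha : a ≤ -r)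
    (hb : r ≤ b) {F : ℝ → ℂ} (hF : Continuous F) :
    ∫ s in a..b, F s = (∫ s in (-r)..r, χ s * F s) +
      ((∫ s in a..(-χ.rIn), (1 - χ s : ℂ) * F s) + ∫ s in χ.rIn..b, (1 - χ s : ℂ) * F s) := by
  have hχc := χ.continuous
  have hint : ∀ c d, IntervalIntegrable (fun s => (1 - χ s : ℂ) * F s) volume c d :=
    Continuous.intervalIntegrable (by fun_prop)
  have hmid := integral_one_sub_bump_mul_eq_zero χ (a := -χ.rIn) (b := χ.rIn)
    (by rw [abs_neg, abs_of_pos χ.rIn_pos]) (abs_of_pos χ.rIn_pos).le F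
  have hsplit : ∫ s in a..b, F s = (∫ s in a..b, χ s * F s) + ∫ s in a..b, (1 - χ s : ℂ) * F s := by
    rw [← intervalIntegral.integral_add (Continuous.intervalIntegrable (by fun_prop) _ _)
      (hint _ _)]
    exact intervalIntegral.integral_congr fun s _ => by ring
  rw [hsplit, integral_bump_mul_eq χ (by linarith) (by linarith),
    ← integral_bump_mul_eq χ (a := -r) (b := r) (by linarith) hχr.le,
    ← intervalIntegral.integral_add_adjacent_intervals (hint a (-χ.rIn)) (hint _ b),
    ← intervalIntegral.integral_add_adjacent_intervals (hint (-χ.rIn) χ.rIn) (hint _ b), hmid,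
    zero_add]

theorem isBigO_integral_add_integral_mul_scaledExp {a b c : ℝ} (hc : 0 < c) (ha : a ≤ -c)
    (hb : c ≤ b) {v : ℝ → ℂ} {Θ f : ℝ → ℝ} (hv : ContDiff ℝ 1 v)
    (hΘ : ∀ s, HasDerivAt Θ (f s) s) (hf : ContDiff ℝ 1 f)
    (hpos : ∀ s ∈ Icc a b, s ≠ 0 → 0 < f s) (hε : Tendsto ε l (𝓝[>] 0))
    (hz : z =O[l] fun _ => (1 : ℝ)) :
    (fun i => (∫ s in a..(-c), v s * scaledExp Θ (z i) (ε i) s) +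
      ∫ s in c..b, v s * scaledExp Θ (z i) (ε i) s) =O[l] fun i => ε i ^ 3 := by
  have hleft := isBigO_integral_neg_mul_scaledExp_of_pos hc (le_neg.1 ha) hv hΘ hf
    (fun s hs => hpos s ⟨by linarith [hs.1], by linarith [hs.2]⟩
      (by linarith [hs.2] : s < 0).ne) hε hz
  have hright := isBigO_integral_mul_scaledExp_of_pos hc hb hv hΘ hf
    (fun s hs => hpos s ⟨by linarith [hs.1], hs.2⟩ (hc.trans_le hs.1).ne') hε hz
  simpa only [neg_neg] using hleft.add hright

theorem isBigO_integral_mul_scaledExp {a b : ℝ} (ha : a < 0) (hb : 0 < b) {Θ f : ℝ → ℝ}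
    (hΘ : ∀ s, HasDerivAt Θ (f s) s) (hΘ0 : Θ 0 = 0) (hf : ContDiff ℝ ∞ f) (hf0 : f 0 = 0)
    (hf1 : deriv f 0 = 0) (hf2 : deriv (deriv f) 0 = 2) (hpos : ∀ s ∈ Icc a b, s ≠ 0 → 0 < f s)
    {g : ℝ → ℂ} (hg : ContDiff ℝ ∞ g) (hε : Tendsto ε l (𝓝[>] 0))
    (hz : z =O[l] fun _ => (1 : ℝ)) :
    (fun i => (∫ s in a..b, g s * scaledExp Θ (z i) (ε i) s) -
      2 * Real.pi * ε i * (g 0 * airyAi (z i) - I * ε i * deriv g 0 * airyAiDeriv (z i)))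
      =O[l] fun i => ε i ^ 2 * ‖g 0‖ + ε i ^ 3 := by
  obtain ⟨R, hR, hRa, hRb⟩ : ∃ R > 0, a ≤ -R ∧ R ≤ b :=
    ⟨min (-a) b, lt_min (neg_pos.2 ha) hb, le_neg.2 (min_le_left _ _), min_le_right _ _⟩
  obtain ⟨r, hr, hrR⟩ := exists_between hR
  let χ : ContDiffBump (0 : ℝ) := ⟨r / 3, r / 2, by linarith, by linarith⟩
  have hχr : χ.rOut < r := half_lt_self hr
  obtain ⟨k, Θ₁, hk, hk_pos, hk0, hΘ₁, hΘ₁0, hΘΘ₁⟩ := exists_eqOn_hasDerivAt_sq_mul hr hrR hΘ hΘ0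
    hf hf0 hf1 hf2 fun s hs => hpos s ⟨by linarith [neg_abs_le s], by linarith [le_abs_self s]⟩
  have hnear := isBigO_integral_bump_mul_mul_scaledExp χ hχr hk hk_pos hk0 hΘ₁ hΘ₁0 hg hε hz
  have hcut : ContDiff ℝ ∞ fun s => (1 - χ s : ℂ) * g s :=
    (contDiff_const.sub (ofRealCLM.contDiff.comp χ.contDiff)).mul hg
  have hfar := isBigO_integral_add_integral_mul_scaledExp (a := a) (b := b) χ.rIn_pos
    (by linarith [χ.rIn_lt_rOut]) (by linarith [χ.rIn_lt_rOut]) (hcut.of_le (mod_cast le_top)) hΘ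
    (hf.of_le (mod_cast le_top)) hpos hε hz
  have hcube : (fun i => ε i ^ 3) =O[l] fun i => ε i ^ 2 * ‖g 0‖ + ε i ^ 3 :=
    isBigO_add_of_nonneg_right (.of_forall fun _ => by positivity)
      ((tendsto_nhdsWithin_iff.1 hε).2.mono fun _ h => pow_nonneg (le_of_lt h) 3)
  refine (hnear.add (hfar.trans hcube)).congr_left fun i => ?_
  have hgc := hg.continuous
  have hΘc : Continuous Θ := continuous_iff_continuousAt.2 fun s => (hΘ s).continuousAt
  have hE := continuous_scaledExp hΘc (z i) (ε i)
  have hagree : ∫ s in (-r)..r, χ s * g s * scaledExp Θ₁ (z i) (ε i) s =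
      ∫ s in (-r)..r, χ s * g s * scaledExp Θ (z i) (ε i) s := by
    refine intervalIntegral.integral_congr fun s hs => ?_
    rw [uIcc_of_le (by linarith)] at hs
    simp only [scaledExp, hΘΘ₁ hs]
  rw [integral_eq_bump_add hχr (by linarith) (by linarith)
    (show Continuous fun s => g s * scaledExp Θ (z i) (ε i) s by fun_prop), hagree]
  simp only [mul_assoc]
  ring

end Airy

/-! ### The dispersion relation -/

section Dispersion

variable {γ₁ γ₂ : ℝ}

theorem auxC_arg_pos (hγ₁ : 0 < γ₁) (hγ : γ₁ < γ₂) (p : ℝ) :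
    0 < γ₁ ^ 2 + γ₂ ^ 2 + 2 * γ₁ * γ₂ * Real.cos p := by
  have h := Real.neg_one_le_cos p
  have h2 : 0 < γ₁ * γ₂ := mul_pos hγ₁ (hγ₁.trans hγ)
  nlinarith [mul_nonneg h2.le (by linarith : 0 ≤ Real.cos p + 1), pow_pos (sub_pos.2 hγ) 2]

theorem auxC_pos (hγ₁ : 0 < γ₁) (hγ : γ₁ < γ₂) (p : ℝ) : 0 < auxC γ₁ γ₂ p :=
  Real.sqrt_pos.2 (auxC_arg_pos hγ₁ hγ p)

theorem auxC_sq (hγ₁ : 0 < γ₁) (hγ : γ₁ < γ₂) (p : ℝ) :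
    auxC γ₁ γ₂ p ^ 2 = γ₁ ^ 2 + γ₂ ^ 2 + 2 * γ₁ * γ₂ * Real.cos p :=
  Real.sq_sqrt (auxC_arg_pos hγ₁ hγ p).le

theorem omega₂_pos (hγ₁ : 0 < γ₁) (hγ : γ₁ < γ₂) (p : ℝ) : 0 < omega₂ γ₁ γ₂ p :=
  Real.sqrt_pos.2 (by linarith [auxC_pos hγ₁ hγ (2 * p)])

theorem omega₂_sq (hγ₁ : 0 < γ₁) (hγ : γ₁ < γ₂) (p : ℝ) :
    omega₂ γ₁ γ₂ p ^ 2 = γ₁ + γ₂ + auxC γ₁ γ₂ (2 * p) :=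
  Real.sq_sqrt (by linarith [auxC_pos hγ₁ hγ (2 * p)])

theorem contDiff_auxC_two_mul (hγ₁ : 0 < γ₁) (hγ : γ₁ < γ₂) :
    ContDiff ℝ ∞ fun p => auxC γ₁ γ₂ (2 * p) := by
  have h : ContDiff ℝ ∞ fun p : ℝ => γ₁ ^ 2 + γ₂ ^ 2 + 2 * γ₁ * γ₂ * Real.cos (2 * p) :=
    contDiff_const.add (contDiff_const.mul
      (Real.contDiff_cos.comp (contDiff_const.mul contDiff_id)))
  exact h.sqrt fun p => (auxC_arg_pos hγ₁ hγ (2 * p)).ne'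

theorem contDiff_omega₂ (hγ₁ : 0 < γ₁) (hγ : γ₁ < γ₂) : ContDiff ℝ ∞ (omega₂ γ₁ γ₂) :=
  (contDiff_const.add (contDiff_auxC_two_mul hγ₁ hγ)).sqrt fun p => by
    have := auxC_pos hγ₁ hγ (2 * p)
    linarith

theorem hasDerivAt_auxC_two_mul (hγ₁ : 0 < γ₁) (hγ : γ₁ < γ₂) (p : ℝ) :
    HasDerivAt (fun p => auxC γ₁ γ₂ (2 * p))
      (-(2 * γ₁ * γ₂ * Real.sin (2 * p)) / auxC γ₁ γ₂ (2 * p)) p := by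
  have h := ((((hasDerivAt_id' p).const_mul 2).cos.const_mul (2 * γ₁ * γ₂)).const_add
    (γ₁ ^ 2 + γ₂ ^ 2)).sqrt (auxC_arg_pos hγ₁ hγ (2 * p)).ne'
  have hc := auxC_pos hγ₁ hγ (2 * p)
  refine h.congr_deriv ?_
  change _ / (2 * auxC γ₁ γ₂ (2 * p)) = _
  field_simp

theorem hasDerivAt_omega₂ (hγ₁ : 0 < γ₁) (hγ : γ₁ < γ₂) (p : ℝ) :
    HasDerivAt (omega₂ γ₁ γ₂)
      (-(γ₁ * γ₂ * Real.sin (2 * p)) / (auxC γ₁ γ₂ (2 * p) * omega₂ γ₁ γ₂ p)) p := by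
  have hc := auxC_pos hγ₁ hγ (2 * p)
  have hw := omega₂_pos hγ₁ hγ p
  have h := ((hasDerivAt_auxC_two_mul hγ₁ hγ p).const_add (γ₁ + γ₂)).sqrt (by linarith)
  refine h.congr_deriv ?_
  change _ / (2 * omega₂ γ₁ γ₂ p) = _
  field_simp

theorem deriv_omega₂ (hγ₁ : 0 < γ₁) (hγ : γ₁ < γ₂) : deriv (omega₂ γ₁ γ₂) =
    fun p => -(γ₁ * γ₂ * Real.sin (2 * p)) / (auxC γ₁ γ₂ (2 * p) * omega₂ γ₁ γ₂ p) :=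
  funext fun p => (hasDerivAt_omega₂ hγ₁ hγ p).deriv

/-- The cubic polynomial in `C(2p)` whose sign is the sign of `ω₂''(p)`. -/
noncomputable def bendingPoly (γ₁ γ₂ c : ℝ) : ℝ :=
  2 * (γ₁ + γ₂) * (γ₂ - γ₁) ^ 2 - (γ₂ - γ₁) ^ 2 * c - c ^ 3

theorem bendingPoly_strictAnti (γ₁ γ₂ : ℝ) : StrictAnti (bendingPoly γ₁ γ₂) := by
  intro a b hab
  have h1 : a ^ 3 < b ^ 3 := Odd.strictMono_pow (by decide) hab
  have h2 := mul_le_mul_of_nonneg_left hab.le (sq_nonneg (γ₂ - γ₁))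
  simp only [bendingPoly]
  linarith

theorem sq_two_mul_mul_sin (hγ₁ : 0 < γ₁) (hγ : γ₁ < γ₂) (p : ℝ) :
    (2 * γ₁ * γ₂ * Real.sin p) ^ 2 =
      4 * γ₁ ^ 2 * γ₂ ^ 2 - (auxC γ₁ γ₂ p ^ 2 - γ₁ ^ 2 - γ₂ ^ 2) ^ 2 := by
  rw [auxC_sq hγ₁ hγ]
  linear_combination 4 * γ₁ ^ 2 * γ₂ ^ 2 * Real.sin_sq_add_cos_sq p

theorem hasDerivAt_deriv_omega₂ (hγ₁ : 0 < γ₁) (hγ : γ₁ < γ₂) (p : ℝ) :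
    HasDerivAt (deriv (omega₂ γ₁ γ₂))
      (omega₂ γ₁ γ₂ p / (4 * auxC γ₁ γ₂ (2 * p) ^ 3) *
        bendingPoly γ₁ γ₂ (auxC γ₁ γ₂ (2 * p))) p := by
  have hc := auxC_pos hγ₁ hγ (2 * p)
  have hw := omega₂_pos hγ₁ hγ p
  have hcos : 2 * γ₁ * γ₂ * Real.cos (2 * p) = auxC γ₁ γ₂ (2 * p) ^ 2 - γ₁ ^ 2 - γ₂ ^ 2 := by
    linarith [auxC_sq hγ₁ hγ (2 * p)]
  have hsin := sq_two_mul_mul_sin hγ₁ hγ (2 * p)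
  have hquot := ((((hasDerivAt_id' p).const_mul 2).sin.const_mul (γ₁ * γ₂)).fun_neg).fun_div
    ((hasDerivAt_auxC_two_mul hγ₁ hγ p).fun_mul (hasDerivAt_omega₂ hγ₁ hγ p)) (mul_pos hc hw).ne'
  rw [deriv_omega₂ hγ₁ hγ]
  refine hquot.congr_deriv ?_
  have hw2 := omega₂_sq hγ₁ hγ p
  set c := auxC γ₁ γ₂ (2 * p)
  set w := omega₂ γ₁ γ₂ p
  set S := Real.sin (2 * p)
  set Q := Real.cos (2 * p)
  calc _ = (-4 * (2 * γ₁ * γ₂ * Q) * c ^ 2 * w ^ 2 - 2 * (2 * γ₁ * γ₂ * S) ^ 2 * w ^ 2 -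
        (2 * γ₁ * γ₂ * S) ^ 2 * c) / (4 * c ^ 3 * w ^ 3) := by
        field_simp
        ring
    _ = (w ^ 2) ^ 2 * bendingPoly γ₁ γ₂ c / (4 * c ^ 3 * w ^ 3) := by
        rw [hcos, hsin, hw2, bendingPoly]
        congr 1
        ring
    _ = w / (4 * c ^ 3) * bendingPoly γ₁ γ₂ c := by field_simp

theorem iteratedDeriv_two_eq_deriv_deriv (f : ℝ → ℝ) : iteratedDeriv 2 f = deriv (deriv f) := by
  rw [iteratedDeriv_succ, iteratedDeriv_one]

theorem iteratedDeriv_two_omega₂ (hγ₁ : 0 < γ₁) (hγ : γ₁ < γ₂) :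
    iteratedDeriv 2 (omega₂ γ₁ γ₂) = fun p => omega₂ γ₁ γ₂ p / (4 * auxC γ₁ γ₂ (2 * p) ^ 3) *
        bendingPoly γ₁ γ₂ (auxC γ₁ γ₂ (2 * p)) := by
  rw [iteratedDeriv_two_eq_deriv_deriv]
  exact funext fun p => (hasDerivAt_deriv_omega₂ hγ₁ hγ p).deriv

theorem sign_iteratedDeriv_two_omega₂ (hγ₁ : 0 < γ₁) (hγ : γ₁ < γ₂) (p : ℝ) :
    SignType.sign (iteratedDeriv 2 (omega₂ γ₁ γ₂) p) =
      SignType.sign (bendingPoly γ₁ γ₂ (auxC γ₁ γ₂ (2 * p))) := by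
  have hc := auxC_pos hγ₁ hγ (2 * p)
  have hw := omega₂_pos hγ₁ hγ p
  rw [iteratedDeriv_two_omega₂ hγ₁ hγ, sign_mul, sign_pos (by positivity), one_mul]

theorem iteratedDeriv_two_omega₂_eq_zero_iff (hγ₁ : 0 < γ₁) (hγ : γ₁ < γ₂) {p : ℝ} :
    iteratedDeriv 2 (omega₂ γ₁ γ₂) p = 0 ↔ bendingPoly γ₁ γ₂ (auxC γ₁ γ₂ (2 * p)) = 0 := by
  rw [← sign_eq_zero_iff, sign_iteratedDeriv_two_omega₂ hγ₁ hγ, sign_eq_zero_iff]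

theorem auxC_lt_auxC (hγ₁ : 0 < γ₁) (hγ : γ₁ < γ₂) {p p' : ℝ} (hp : 0 ≤ p) (hpp' : p < p')
    (hp' : p' ≤ Real.pi) : auxC γ₁ γ₂ p' < auxC γ₁ γ₂ p := by
  refine Real.sqrt_lt_sqrt (auxC_arg_pos hγ₁ hγ _).le ?_
  have hcos := Real.cos_lt_cos_of_nonneg_of_le_pi hp hp' hpp'
  have := hγ₁.trans hγ
  gcongr

theorem auxC_zero (hγ₁ : 0 < γ₁) (hγ : γ₁ < γ₂) : auxC γ₁ γ₂ 0 = γ₁ + γ₂ := by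
  rw [auxC, Real.cos_zero, show γ₁ ^ 2 + γ₂ ^ 2 + 2 * γ₁ * γ₂ * 1 = (γ₁ + γ₂) ^ 2 by ring,
    Real.sqrt_sq (by linarith)]

theorem auxC_pi (hγ : γ₁ ≤ γ₂) : auxC γ₁ γ₂ Real.pi = γ₂ - γ₁ := by
  rw [auxC, Real.cos_pi, show γ₁ ^ 2 + γ₂ ^ 2 + 2 * γ₁ * γ₂ * -1 = (γ₂ - γ₁) ^ 2 by ring,
    Real.sqrt_sq (sub_nonneg.2 hγ)]

theorem bendingPoly_add_neg (hγ₁ : 0 < γ₁) (hγ₂ : 0 < γ₂) :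
    bendingPoly γ₁ γ₂ (γ₁ + γ₂) < 0 := by
  rw [show bendingPoly γ₁ γ₂ (γ₁ + γ₂) = -((γ₁ + γ₂) * (4 * γ₁ * γ₂)) by rw [bendingPoly]; ring]
  exact neg_neg_of_pos (by positivity)

theorem bendingPoly_sub_pos (hγ₁ : 0 < γ₁) (hγ : γ₁ ≠ γ₂) :
    0 < bendingPoly γ₁ γ₂ (γ₂ - γ₁) := by
  rw [show bendingPoly γ₁ γ₂ (γ₂ - γ₁) = 4 * γ₁ * (γ₂ - γ₁) ^ 2 by rw [bendingPoly]; ring]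
  have := sub_ne_zero.2 hγ.symm
  positivity

theorem exists_iteratedDeriv_two_omega₂_eq_zero (hγ₁ : 0 < γ₁) (hγ : γ₁ < γ₂) :
    ∃ p ∈ Ioo (0 : ℝ) (Real.pi / 2), iteratedDeriv 2 (omega₂ γ₁ γ₂) p = 0 := by
  have hcont : Continuous fun p => bendingPoly γ₁ γ₂ (auxC γ₁ γ₂ (2 * p)) := by
    have := (contDiff_auxC_two_mul hγ₁ hγ).continuous
    unfold bendingPoly
    fun_prop
  have hleft : bendingPoly γ₁ γ₂ (auxC γ₁ γ₂ (2 * 0)) < 0 := by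
    rw [mul_zero, auxC_zero hγ₁ hγ]
    exact bendingPoly_add_neg hγ₁ (hγ₁.trans hγ)
  have hright : 0 < bendingPoly γ₁ γ₂ (auxC γ₁ γ₂ (2 * (Real.pi / 2))) := by
    rw [mul_div_cancel₀ _ two_ne_zero, auxC_pi hγ.le]
    exact bendingPoly_sub_pos hγ₁ hγ.ne
  obtain ⟨p, hp, hroot⟩ :=
    intermediate_value_Ioo Real.pi_div_two_pos.le hcont.continuousOn ⟨hleft, hright⟩
  exact ⟨p, hp, (iteratedDeriv_two_omega₂_eq_zero_iff hγ₁ hγ).2 hroot⟩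

theorem sin_two_mul_pos {p : ℝ} (hp : p ∈ Ioo 0 (Real.pi / 2)) : 0 < Real.sin (2 * p) :=
  Real.sin_pos_of_pos_of_lt_pi (by linarith [hp.1]) (by linarith [hp.2])

theorem cStar_pos (hγ₁ : 0 < γ₁) (hγ : γ₁ < γ₂) {p : ℝ} (hp : p ∈ Ioo 0 (Real.pi / 2)) :
    0 < cStar γ₁ γ₂ p := by
  have hγ₂ := hγ₁.trans hγ
  have hsin := sin_two_mul_pos hp
  have hc := auxC_pos hγ₁ hγ (2 * p)
  have hw := omega₂_pos hγ₁ hγ p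
  rw [cStar, (hasDerivAt_omega₂ hγ₁ hγ p).deriv, neg_div, neg_neg]
  positivity

theorem deriv_omega₂_nonneg (hγ₁ : 0 < γ₁) (hγ : γ₁ < γ₂) {p : ℝ}
    (hp : p ∈ Icc (-(Real.pi / 2)) 0) : 0 ≤ deriv (omega₂ γ₁ γ₂) p := by
  have hγ₂ := hγ₁.trans hγ
  have hc := auxC_pos hγ₁ hγ (2 * p)
  have hw := omega₂_pos hγ₁ hγ p
  have hsin : Real.sin (2 * p) ≤ 0 :=
    Real.sin_nonpos_of_nonpos_of_neg_pi_le (by linarith [hp.2]) (by linarith [hp.1])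
  rw [(hasDerivAt_omega₂ hγ₁ hγ p).deriv]
  exact div_nonneg (neg_nonneg.2 (mul_nonpos_of_nonneg_of_nonpos (by positivity) hsin))
    (by positivity)

section Inflection

variable {pstar p : ℝ}

theorem iteratedDeriv_two_omega₂_neg (hγ₁ : 0 < γ₁) (hγ : γ₁ < γ₂)
    (hpstar : pstar ≤ Real.pi / 2) (hzero : iteratedDeriv 2 (omega₂ γ₁ γ₂) pstar = 0)
    (hp : p ∈ Ioo 0 pstar) : iteratedDeriv 2 (omega₂ γ₁ γ₂) p < 0 := by
  rw [← sign_eq_neg_one_iff, sign_iteratedDeriv_two_omega₂ hγ₁ hγ, sign_eq_neg_one_iff,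
    ← (iteratedDeriv_two_omega₂_eq_zero_iff hγ₁ hγ).1 hzero]
  exact bendingPoly_strictAnti γ₁ γ₂
    (auxC_lt_auxC hγ₁ hγ (by linarith [hp.1]) (by linarith [hp.2]) (by linarith))

theorem iteratedDeriv_two_omega₂_pos (hγ₁ : 0 < γ₁) (hγ : γ₁ < γ₂)
    (hpstar : 0 ≤ pstar) (hzero : iteratedDeriv 2 (omega₂ γ₁ γ₂) pstar = 0)
    (hp : p ∈ Ioo pstar (Real.pi / 2)) : 0 < iteratedDeriv 2 (omega₂ γ₁ γ₂) p := by
  rw [← sign_eq_one_iff, sign_iteratedDeriv_two_omega₂ hγ₁ hγ, sign_eq_one_iff,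
    ← (iteratedDeriv_two_omega₂_eq_zero_iff hγ₁ hγ).1 hzero]
  exact bendingPoly_strictAnti γ₁ γ₂
    (auxC_lt_auxC hγ₁ hγ (by linarith) (by linarith [hp.1]) (by linarith [hp.2]))

theorem hasDerivAt_bendingPoly (γ₁ γ₂ c : ℝ) :
    HasDerivAt (bendingPoly γ₁ γ₂) (-((γ₂ - γ₁) ^ 2 + 3 * c ^ 2)) c :=
  ((((hasDerivAt_id' c).const_mul ((γ₂ - γ₁) ^ 2)).const_sub _).fun_sub
    (hasDerivAt_pow 3 c)).congr_deriv (by push_cast; ring)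

theorem qStar_pos (hγ₁ : 0 < γ₁) (hγ : γ₁ < γ₂) (hpstar : pstar ∈ Ioo 0 (Real.pi / 2))
    (hzero : iteratedDeriv 2 (omega₂ γ₁ γ₂) pstar = 0) : 0 < qStar γ₁ γ₂ pstar := by
  have hγ₂ := hγ₁.trans hγ
  have hsin := sin_two_mul_pos hpstar
  have hc := auxC_pos hγ₁ hγ (2 * pstar)
  have hw := omega₂_pos hγ₁ hγ pstar
  have hroot := (iteratedDeriv_two_omega₂_eq_zero_iff hγ₁ hγ).1 hzero
  have hfactor : DifferentiableAt ℝ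
      (fun p => omega₂ γ₁ γ₂ p / (4 * auxC γ₁ γ₂ (2 * p) ^ 3)) pstar :=
    (hasDerivAt_omega₂ hγ₁ hγ pstar).differentiableAt.fun_div
      (((hasDerivAt_auxC_two_mul hγ₁ hγ pstar).differentiableAt.fun_pow 3).const_mul 4)
      (by positivity)
  have hprod := hfactor.hasDerivAt.fun_mul ((hasDerivAt_bendingPoly γ₁ γ₂ _).comp pstar
    (hasDerivAt_auxC_two_mul hγ₁ hγ pstar))
  simp only [Function.comp_apply] at hprod
  rw [qStar, iteratedDeriv_succ, iteratedDeriv_two_omega₂ hγ₁ hγ, hprod.deriv, hroot, mul_zero,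
    zero_add, neg_div, neg_mul_neg]
  positivity

theorem deriv_omega₂_lt (hγ₁ : 0 < γ₁) (hγ : γ₁ < γ₂) (hpstar : pstar ∈ Ioo 0 (Real.pi / 2))
    (hzero : iteratedDeriv 2 (omega₂ γ₁ γ₂) pstar = 0)
    (hp : p ∈ Icc (-(Real.pi / 2)) (Real.pi / 2)) (hne : p ≠ pstar) :
    deriv (omega₂ γ₁ γ₂) pstar < deriv (omega₂ γ₁ γ₂) p := by
  have hcont := (contDiff_infty_iff_deriv.1 (contDiff_omega₂ hγ₁ hγ)).2.continuous
  have hderiv := iteratedDeriv_two_eq_deriv_deriv (omega₂ γ₁ γ₂)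
  rcases le_or_gt p 0 with hp0 | hp0
  · exact (neg_pos.1 (cStar_pos hγ₁ hγ hpstar)).trans_le (deriv_omega₂_nonneg hγ₁ hγ ⟨hp.1, hp0⟩)
  rcases hne.lt_or_gt with hlt | hgt
  · refine strictAntiOn_of_deriv_neg (convex_Icc 0 pstar) hcont.continuousOn (fun q hq => ?_)
      ⟨hp0.le, hlt.le⟩ ⟨hpstar.1.le, le_rfl⟩ hlt
    rw [interior_Icc] at hq
    rw [← hderiv]
    exact iteratedDeriv_two_omega₂_neg hγ₁ hγ hpstar.2.le hzero hq
  · refine strictMonoOn_of_deriv_pos (convex_Icc pstar (Real.pi / 2)) hcont.continuousOn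
      (fun q hq => ?_) ⟨le_rfl, hpstar.2.le⟩ ⟨hgt.le, hp.2⟩ hgt
    rw [interior_Icc] at hq
    rw [← hderiv]
    exact iteratedDeriv_two_omega₂_pos hγ₁ hγ hpstar.1.le hzero hq

end Inflection

end Dispersion

/-! ### The amplitude -/

theorem iteratedDeriv_const_mul_cexp (w c : ℂ) (m : ℕ) :
    iteratedDeriv m (fun p : ℝ => w * cexp (c * p)) = fun p : ℝ => w * c ^ m * cexp (c * p) := by
  induction m with
  | zero => simp
  | succ m ih =>
    rw [iteratedDeriv_succ, ih]
    funext p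
    have h : HasDerivAt (fun p : ℝ => c * (p : ℂ)) c p := by
      simpa using (hasDerivAt_id' p).ofReal_comp.const_mul c
    rw [(h.cexp.const_mul (w * c ^ m)).deriv]
    ring

theorem summable_abs_pow_mul_schwartz (W : SchwartzMap ℝ ℝ) {x : ℤ → ℝ}
    (hx : ∀ k : ℤ, (k : ℝ) ^ 2 ≤ 1 + x k ^ 2) (m : ℕ) :
    Summable fun k => |x k| ^ m * |W (x k)| := by
  obtain ⟨C₁, -, h₁⟩ := W.decay m 0
  obtain ⟨C₂, -, h₂⟩ := W.decay (m + 2) 0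
  simp only [norm_iteratedFDeriv_zero, Real.norm_eq_abs] at h₁ h₂
  refine Summable.of_norm_bounded_eventually (g := fun k : ℤ => (C₁ + C₂) * (1 / (k : ℝ) ^ 2))
    ((Real.summable_one_div_int_pow.2 one_lt_two).mul_left _) ?_
  filter_upwards [(Set.finite_singleton (0 : ℤ)).compl_mem_cofinite] with k hk
  have hk0 : (k : ℝ) ≠ 0 := by exact_mod_cast hk
  have hk2 : 0 < (k : ℝ) ^ 2 := by positivity
  rw [Real.norm_eq_abs, abs_of_nonneg (by positivity), mul_one_div, le_div_iff₀ hk2]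
  have hdecay := h₂ (x k)
  rw [pow_add, sq_abs] at hdecay
  calc |x k| ^ m * |W (x k)| * (k : ℝ) ^ 2 ≤ |x k| ^ m * |W (x k)| * (1 + x k ^ 2) :=
        mul_le_mul_of_nonneg_left (hx k) (by positivity)
    _ = |x k| ^ m * |W (x k)| + |x k| ^ m * x k ^ 2 * |W (x k)| := by ring
    _ ≤ _ := add_le_add (h₁ (x k)) hdecay

theorem contDiff_tsum_schwartz_mul_cexp (W : SchwartzMap ℝ ℝ) {x : ℤ → ℝ}
    (hx : ∀ k : ℤ, (k : ℝ) ^ 2 ≤ 1 + x k ^ 2) :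
    ContDiff ℝ ∞ fun p : ℝ => ∑' k : ℤ, (W (x k) : ℂ) * cexp (-I * (p : ℂ) * (x k : ℂ)) := by
  have hcomm : ∀ k : ℤ, (fun p : ℝ => (W (x k) : ℂ) * cexp (-I * (p : ℂ) * (x k : ℂ))) =
      fun p : ℝ => (W (x k) : ℂ) * cexp ((-I * x k) * p) := fun k => by
    funext p
    congr 2
    ring
  refine contDiff_tsum (N := ⊤) (v := fun m k => |x k| ^ m * |W (x k)|) (fun k => ?_)
    (fun m _ => summable_abs_pow_mul_schwartz W hx m) (fun m k p _ => ?_)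
  · exact contDiff_const.mul ((((contDiff_const.mul ofRealCLM.contDiff)).mul contDiff_const).cexp)
  · rw [norm_iteratedFDeriv_eq_norm_iteratedDeriv, hcomm, iteratedDeriv_const_mul_cexp]
    have hphase : ‖cexp (-I * x k * p)‖ = 1 := by
      rw [show -I * (x k : ℂ) * p = I * ((-(x k * p) : ℝ) : ℂ) by push_cast; ring]
      exact norm_exp_I_mul_ofReal _
    rw [norm_mul, hphase, norm_mul, norm_pow, norm_mul, norm_neg, norm_I, norm_real, norm_real,
      Real.norm_eq_abs, Real.norm_eq_abs]
    exact le_of_eq (by ring)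

theorem tildeV_apply_zero (W : SchwartzMap ℝ ℝ) (p : ℝ) : tildeV W p 0 =
    ∑' k : ℤ, (W (2 * (k : ℝ)) : ℂ) * cexp (-I * (p : ℂ) * ((2 * (k : ℝ) : ℝ) : ℂ)) := by
  simp [tildeV]

theorem tildeV_apply_one (W : SchwartzMap ℝ ℝ) (p : ℝ) : tildeV W p 1 =
    ∑' k : ℤ, (W (2 * (k : ℝ) + 1) : ℂ) * cexp (-I * (p : ℂ) * ((2 * (k : ℝ) + 1 : ℝ) : ℂ)) := by
  simp [tildeV]

theorem contDiff_tildeV (W : SchwartzMap ℝ ℝ) (i : Fin 2) :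
    ContDiff ℝ ∞ fun p => tildeV W p i := by
  fin_cases i
  · simp only [Fin.zero_eta, tildeV_apply_zero]
    exact contDiff_tsum_schwartz_mul_cexp W fun k => by nlinarith [sq_nonneg (k : ℝ)]
  · simp only [Fin.mk_one, tildeV_apply_one]
    exact contDiff_tsum_schwartz_mul_cexp W fun k => by nlinarith [sq_nonneg (3 * (k : ℝ) + 2)]

theorem tildeV_neg (W : SchwartzMap ℝ ℝ) (p : ℝ) (i : Fin 2) :
    tildeV W (-p) i = conj (tildeV W p i) := by
  have hconj : ∀ w x : ℝ, (w : ℂ) * cexp (-I * ((-p : ℝ) : ℂ) * (x : ℂ)) =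
      conj ((w : ℂ) * cexp (-I * (p : ℂ) * (x : ℂ))) := fun w x => by
    rw [map_mul, ← exp_conj, conj_ofReal]
    simp only [map_mul, map_neg, conj_I, conj_ofReal]
    congr 2
    push_cast
    ring
  fin_cases i
  · simp only [Fin.zero_eta, tildeV_apply_zero, conj_tsum, hconj]
  · simp only [Fin.mk_one, tildeV_apply_one, conj_tsum, hconj]

section Projection

variable {γ₁ γ₂ : ℝ}

theorem applyB_apply (γ₁ γ₂ p : ℝ) (v : Fin 2 → ℂ) (j : Fin 2) :
    applyB γ₁ γ₂ p v j = matB γ₁ γ₂ p j 0 * v 0 + matB γ₁ γ₂ p j 1 * v 1 := by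
  simp [applyB, Matrix.mulVec, dotProduct, Fin.sum_univ_two]

theorem matB_neg (γ₁ γ₂ p : ℝ) : matB γ₁ γ₂ (-p) = matB γ₁ γ₂ p := by
  simp [matB, auxJ, auxG, auxC]

theorem contDiff_matB (hγ₁ : 0 < γ₁) (hγ : γ₁ < γ₂) (i j : Fin 2) :
    ContDiff ℝ ∞ fun p => matB γ₁ γ₂ p i j := by
  have hG : ContDiff ℝ ∞ fun p => auxG γ₁ γ₂ (2 * p) :=
    contDiff_const.add (contDiff_auxC_two_mul hγ₁ hγ)
  have hcos := Real.contDiff_cos (n := ∞)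
  have hγ₂ : 0 < γ₂ := hγ₁.trans hγ
  have hJ : ContDiff ℝ ∞ fun p => auxJ γ₁ γ₂ p :=
    (hG.pow 2).add (contDiff_const.mul (hcos.pow 2))
  have hJ0 : ∀ p, auxJ γ₁ γ₂ p ≠ 0 := fun p => by
    have hG0 : 0 < auxG γ₁ γ₂ (2 * p) := by
      rw [auxG]
      linarith [auxC_pos hγ₁ hγ (2 * p)]
    unfold auxJ
    positivity
  have hinv : ContDiff ℝ ∞ fun p => 1 / auxJ γ₁ γ₂ p := contDiff_const.div hJ hJ0
  fin_cases i <;> fin_cases j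
  · exact hinv.mul (contDiff_const.mul (hcos.pow 2))
  · exact hinv.mul ((contDiff_const.mul hG).mul hcos).neg
  · exact hinv.mul ((contDiff_const.mul hG).mul hcos).neg
  · exact hinv.mul (hG.pow 2)

theorem contDiff_applyB_tildeV (hγ₁ : 0 < γ₁) (hγ : γ₁ < γ₂) (W : SchwartzMap ℝ ℝ) (j : Fin 2) :
    ContDiff ℝ ∞ fun p => applyB γ₁ γ₂ p (tildeV W p) j := by
  simp only [applyB_apply]
  exact ((ofRealCLM.contDiff.comp (contDiff_matB hγ₁ hγ j 0)).mul (contDiff_tildeV W 0)).add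
    ((ofRealCLM.contDiff.comp (contDiff_matB hγ₁ hγ j 1)).mul (contDiff_tildeV W 1))

theorem applyB_tildeV_neg (γ₁ γ₂ : ℝ) (W : SchwartzMap ℝ ℝ) (p : ℝ) (j : Fin 2) :
    applyB γ₁ γ₂ (-p) (tildeV W (-p)) j = conj (applyB γ₁ γ₂ p (tildeV W p) j) := by
  simp only [applyB_apply, matB_neg, tildeV_neg, map_add, map_mul, conj_ofReal]

theorem omega₂_neg (γ₁ γ₂ p : ℝ) : omega₂ γ₁ γ₂ (-p) = omega₂ γ₁ γ₂ p := by
  simp [omega₂, auxC]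

end Projection

theorem norm_threePointExt_sub_le (F : ℝ → Fin 2 → ℂ) (η : ℝ) (i : Fin 2) :
    ‖threePointExt F η i - F 0 i‖ ≤ 3 * ‖F |η| i - F 0 i‖ + ‖F (2 * |η|) i - F 0 i‖ := by
  rcases le_or_gt 0 η with hη | hη
  · rw [threePointExt, if_pos hη, abs_of_nonneg hη]
    linarith [norm_nonneg (F η i - F 0 i), norm_nonneg (F (2 * η) i - F 0 i)]
  · rw [threePointExt, if_neg hη.not_ge, abs_of_neg hη, neg_mul, ← mul_neg]
    calc _ = ‖-3 * (F (-η) i - F 0 i) + (F (2 * -η) i - F 0 i)‖ := by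
          simp only [Pi.add_apply, Pi.sub_apply, Pi.smul_apply, smul_eq_mul]
          ring_nf
      _ ≤ _ := (norm_add_le _ _).trans (by simp)

theorem isBigO_threePointExt_sub {F : ℝ → Fin 2 → ℂ} {i : Fin 2} {n : ℕ}
    (hF : (fun η => F η i - F 0 i) =O[𝓝[≥] 0] fun η => √η ^ n) :
    (fun η => threePointExt F η i - F 0 i) =O[𝓝 0] fun η => √|η| ^ n := by
  have habs : Tendsto (fun η : ℝ => |η|) (𝓝 0) (𝓝[≥] 0) :=
    tendsto_nhdsWithin_iff.2 ⟨by simpa using (continuous_abs.tendsto (0 : ℝ)),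
      Eventually.of_forall abs_nonneg⟩
  have hdouble : Tendsto (fun η : ℝ => 2 * |η|) (𝓝 0) (𝓝[≥] 0) :=
    tendsto_nhdsWithin_iff.2 ⟨by simpa using (continuous_abs.tendsto (0 : ℝ)).const_mul 2,
      Eventually.of_forall fun η => mem_Ici.2 (by positivity)⟩
  have hF2 : (fun η => F (2 * |η|) i - F 0 i) =O[𝓝 0] fun η => √|η| ^ n := by
    refine (hF.comp_tendsto hdouble).trans ?_
    simp only [Function.comp_def, Real.sqrt_mul zero_le_two, mul_pow]
    exact isBigO_const_mul_self _ _ _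
  exact (IsBigO.of_norm_le fun η => norm_threePointExt_sub_le F η i).trans
    (((hF.comp_tendsto habs).norm_left.const_mul_left 3).add hF2.norm_left)

section EvenOdd

variable {v : ℝ → ℂ}

theorem isBigO_evenPart_sub (hv : ContDiff ℝ ∞ v) :
    (fun s => 1 / 2 * (v (-s) + v s) - v 0) =O[𝓝 0] fun s => s ^ 2 := by
  obtain ⟨h, hh, hv, -⟩ := exists_eq_add_smul_add_sq_smul hv
  have hbdd : (fun s => 1 / 2 * (h (-s) + h s)) =O[𝓝 0] fun _ => (1 : ℝ) :=
    (by have := hh.continuous; fun_prop : Continuous fun s => 1 / 2 * (h (-s) + h s)).tendsto 0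
      |>.isBigO_one ℝ
  refine ((isBigO_refl (fun s : ℝ => s ^ 2) _).smul hbdd).congr (fun s => ?_) fun s => ?_
  · rw [hv s, hv (-s)]
    simp only [real_smul]
    push_cast
    ring
  · simp

theorem isBigO_oddPart_add_deriv (hv : ContDiff ℝ ∞ v) :
    (fun s : ℝ => 1 / (2 * (s : ℂ)) * (v (-s) - v s) + deriv v 0) =O[𝓝[≠] 0] fun s => s := by
  obtain ⟨h, hh, hv, -⟩ := exists_eq_add_smul_add_sq_smul hv
  have hbdd : (fun s => 1 / 2 * (h (-s) - h s)) =O[𝓝[≠] 0] fun _ => (1 : ℝ) :=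
    ((by have := hh.continuous; fun_prop : Continuous fun s => 1 / 2 * (h (-s) - h s)).tendsto 0
      |>.isBigO_one ℝ).mono nhdsWithin_le_nhds
  refine ((isBigO_refl (fun s : ℝ => s) _).smul hbdd).congr' ?_ (by simp)
  filter_upwards [self_mem_nhdsWithin] with s hs
  have : (s : ℂ) ≠ 0 := ofReal_ne_zero.2 hs
  rw [hv s, hv (-s)]
  simp only [real_smul]
  push_cast
  field_simp
  ring

end EvenOdd

theorem contDiff_tildeV_add (W : SchwartzMap ℝ ℝ) (p : ℝ) (i : Fin 2) :
    ContDiff ℝ ∞ fun s => tildeV W (s + p) i :=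
  (contDiff_tildeV W i).comp (contDiff_id.add contDiff_const)

theorem hasDerivAt_tildeV_apply (W : SchwartzMap ℝ ℝ) (p : ℝ) (i : Fin 2) :
    HasDerivAt (fun p => tildeV W p i) (deriv (tildeV W) p i) p := by
  have hdiff i : DifferentiableAt ℝ (fun p => tildeV W p i) p :=
    (contDiff_tildeV W i).differentiable (by simp) p
  rw [deriv_pi hdiff]
  exact (hdiff i).hasDerivAt

theorem tendsto_sqrt_nhdsGE : Tendsto Real.sqrt (𝓝[≥] 0) (𝓝 0) := by
  simpa using (Real.continuous_sqrt.tendsto 0).mono_left nhdsWithin_le_nhds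

theorem isBigO_F₁_sub (W : SchwartzMap ℝ ℝ) (p : ℝ) (i : Fin 2) :
    (fun η => F₁ W p η i - tildeV W p i) =O[𝓝 0] fun η => √|η| ^ 2 := by
  have hzero : ((1 / 2 : ℂ) • (tildeV W (-√0 + p) + tildeV W (√0 + p))) i = tildeV W p i := by
    simp only [Pi.smul_apply, Pi.add_apply, smul_eq_mul, Real.sqrt_zero, neg_zero, zero_add]
    ring
  have heven := (isBigO_evenPart_sub (contDiff_tildeV_add W p i)).comp_tendsto tendsto_sqrt_nhdsGE
  rw [← hzero]
  exact isBigO_threePointExt_sub (heven.congr_left fun η => by simp [← two_mul])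

theorem isBigO_F₂_add (W : SchwartzMap ℝ ℝ) (p : ℝ) (i : Fin 2) :
    (fun η => F₂ W p η i + deriv (tildeV W) p i) =O[𝓝 0] fun η => √|η| := by
  have hsqrt : Tendsto Real.sqrt (𝓝[>] 0) (𝓝[≠] 0) :=
    tendsto_nhdsWithin_iff.2 ⟨tendsto_sqrt_nhdsGE.mono_left (nhdsWithin_mono _ Ioi_subset_Ici_self),
      eventually_mem_nhdsWithin.mono fun η hη => (Real.sqrt_pos.2 hη).ne'⟩
  have hderiv : deriv (fun s => tildeV W (s + p) i) 0 = deriv (tildeV W) p i := by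
    rw [deriv_comp_add_const (fun p => tildeV W p i), zero_add,
      (hasDerivAt_tildeV_apply W p i).deriv]
  have hodd := (isBigO_oddPart_add_deriv (contDiff_tildeV_add W p i)).comp_tendsto hsqrt
  have hext := isBigO_threePointExt_sub (i := i) (n := 1) (F := fun η =>
    if η = 0 then -deriv (tildeV W) p
    else (1 / (2 * (√η : ℂ))) • (tildeV W (-√η + p) - tildeV W (√η + p))) ?_
  · simpa [F₂] using hext
  rw [← Ioi_insert, nhdsWithin_insert, isBigO_sup]
  refine ⟨isBigO_pure.2 (by simp), hodd.congr' ?_ (by simp [Function.comp_def])⟩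
  filter_upwards [self_mem_nhdsWithin] with η hη
  simp [(mem_Ioi.1 hη).ne', hderiv]

section Amplitude

variable {γ₁ γ₂ : ℝ}

theorem deriv_applyB_tildeV (hγ₁ : 0 < γ₁) (hγ : γ₁ < γ₂) (W : SchwartzMap ℝ ℝ) (p : ℝ)
    (j : Fin 2) :
    deriv (fun p => applyB γ₁ γ₂ p (tildeV W p) j) p =
      applyB γ₁ γ₂ p (deriv (tildeV W) p) j +
        ∑ i, ((deriv (fun p => matB γ₁ γ₂ p j i) p : ℝ) : ℂ) * tildeV W p i := by
  have hB i : HasDerivAt (fun p => ((matB γ₁ γ₂ p j i : ℝ) : ℂ))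
      ((deriv (fun p => matB γ₁ γ₂ p j i) p : ℝ) : ℂ) p :=
    ((contDiff_matB hγ₁ hγ j i).differentiable (by simp) p).hasDerivAt.ofReal_comp
  have hV := hasDerivAt_tildeV_apply W p
  simp only [applyB_apply, Fin.sum_univ_two]
  rw [(((hB 0).fun_mul (hV 0)).fun_add ((hB 1).fun_mul (hV 1))).deriv]
  ring

variable {ι : Type*} {l : Filter ι}

theorem isBigO_applyB {v : ι → Fin 2 → ℂ} {φ : ι → ℝ} (hv : ∀ k, (fun i => v i k) =O[l] φ)
    (γ₁ γ₂ p : ℝ) (j : Fin 2) : (fun i => applyB γ₁ γ₂ p (v i) j) =O[l] φ := by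
  simp only [applyB_apply]
  exact ((hv 0).const_mul_left _).add ((hv 1).const_mul_left _)

theorem isBigO_sqrt_abs {η ε : ι → ℝ} (hη : η =O[l] fun i => ε i ^ 2) :
    (fun i => √|η i|) =O[l] ε := by
  obtain ⟨C, hC, hbound⟩ := hη.exists_nonneg
  refine IsBigO.of_bound √C (hbound.bound.mono fun i hi => ?_)
  rw [norm_pow, Real.norm_eq_abs, Real.norm_eq_abs] at hi
  calc ‖√|η i|‖ = √|η i| := Real.norm_of_nonneg (Real.sqrt_nonneg _)
    _ ≤ √(C * |ε i| ^ 2) := Real.sqrt_le_sqrt hi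
    _ = √C * ‖ε i‖ := by rw [Real.sqrt_mul hC, Real.sqrt_sq (abs_nonneg _), Real.norm_eq_abs]

theorem isBigO_evenOdd_sub (W : SchwartzMap ℝ ℝ) (p : ℝ) (k : Fin 2) {ε η : ι → ℝ}
    {c₁ c₂ : ι → ℂ} (hε : Tendsto ε l (𝓝 0)) (hη : η =O[l] fun i => ε i ^ 2)
    (hc₁ : c₁ =O[l] fun _ => (1 : ℝ)) (hc₂ : c₂ =O[l] fun _ => (1 : ℝ)) :
    (fun i => c₁ i * (F₁ W p (η i) k - tildeV W p k) +
      ε i * c₂ i * (F₂ W p (η i) k + deriv (tildeV W) p k)) =O[l] fun i => ε i ^ 2 := by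
  have hη0 : Tendsto η l (𝓝 0) := hη.trans_tendsto (by simpa using hε.pow 2)
  have hsqrt := isBigO_sqrt_abs hη
  have hF₁ := ((isBigO_F₁_sub W p k).comp_tendsto hη0).trans (hsqrt.pow 2)
  have hF₂ := ((isBigO_F₂_add W p k).comp_tendsto hη0).trans hsqrt
  have hε' : (fun i => (ε i : ℂ)) =O[l] ε := isBigO_ofReal_left.2 (isBigO_refl ε l)
  exact ((hc₁.mul hF₁).congr_right fun i => one_mul _).add
    (((hε'.mul hc₂).mul hF₂).congr_right fun i => by ring)

theorem isBigO_applyB_evenOdd_sub (hγ₁ : 0 < γ₁) (hγ : γ₁ < γ₂) (W : SchwartzMap ℝ ℝ) (p : ℝ)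
    (j : Fin 2) {ε η : ι → ℝ} {c₁ c₂ : ι → ℂ} (hε : Tendsto ε l (𝓝[>] 0))
    (hη : η =O[l] fun i => ε i ^ 2)
    (hc₁ : c₁ =O[l] fun _ => (1 : ℝ)) (hc₂ : c₂ =O[l] fun _ => (1 : ℝ)) :
    (fun i => applyB γ₁ γ₂ p (c₁ i • F₁ W p (η i) + (ε i * c₂ i) • F₂ W p (η i)) j -
      (c₁ i * applyB γ₁ γ₂ p (tildeV W p) j -
        ε i * c₂ i * deriv (fun p => applyB γ₁ γ₂ p (tildeV W p) j) p)) =O[l]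
      fun i => ε i * (‖tildeV W p‖ + ε i) := by
  have hε₀ : ∀ᶠ i in l, 0 ≤ ε i := (tendsto_nhdsWithin_iff.1 hε).2.mono fun _ h => le_of_lt h
  have hrem := isBigO_applyB (fun k => isBigO_evenOdd_sub W p k (tendsto_nhdsWithin_iff.1 hε).1
    hη hc₁ hc₂) γ₁ γ₂ p j
  have hMV : (fun _ : ι => ∑ k, ((deriv (fun p => matB γ₁ γ₂ p j k) p : ℝ) : ℂ) * tildeV W p k)
      =O[l] fun _ => ‖tildeV W p‖ :=
    IsBigO.fun_sum fun k _ => (IsBigO.of_norm_le fun _ => norm_le_pi_norm _ k).const_mul_left _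
  have hε' : (fun i => (ε i : ℂ)) =O[l] ε := isBigO_ofReal_left.2 (isBigO_refl ε l)
  have hN₀ : ∀ᶠ _ in l, 0 ≤ ‖tildeV W p‖ := .of_forall fun _ => norm_nonneg _
  have hsum₁ := (isBigO_refl ε l).mul (isBigO_add_of_nonneg_right hN₀ hε₀)
  have hsum₂ := (isBigO_refl ε l).mul (isBigO_add_of_nonneg_left hN₀ hε₀)
  have hamp := ((hε'.mul hc₂).mul hMV).trans (hsum₂.congr_left fun i => by ring)
  have hrem' := hrem.trans (hsum₁.congr_left fun i => (sq (ε i)).symm)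
  refine (hrem'.add hamp).congr_left fun i => ?_
  rw [deriv_applyB_tildeV hγ₁ hγ]
  simp only [applyB_apply, Fin.sum_univ_two, Pi.add_apply, Pi.smul_apply, smul_eq_mul]
  ring

end Amplitude

theorem FactorApprox.of_norm_sub_le {C μ ε N : ℝ} {u a w : ℂ} (hC : 0 ≤ C) (hμ : 0 < μ)
    (hε : 0 < ε) (hN : 0 ≤ N) (huw : u.re = w.re)
    (h : ‖w - 2 * ε * a‖ ≤ C * μ ^ (1 / 3 : ℝ) * (ε * (N + ε))) : FactorApprox C μ ε N u a := by
  set d : ℝ := u.re - 2 * ε * a.re with hd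
  have hre : (w - 2 * ε * a).re = d := by
    rw [hd, huw, sub_re, mul_assoc, ← ofReal_ofNat, re_ofReal_mul, re_ofReal_mul]
    ring
  have hd_le : |d| ≤ C * μ ^ (1 / 3 : ℝ) * (ε * (N + ε)) := hre ▸ (abs_re_le_norm _).trans h
  refine ⟨hd_le, fun κ hκ ha => ⟨((d / (2 * ε) : ℝ) : ℂ) / a, ?_, ?_⟩⟩ <;>
    have ha0 : 0 < ‖a‖ := (by positivity : 0 < κ * (N + ε)).trans_le ha
  · rw [norm_div, norm_real, Real.norm_eq_abs, abs_div, abs_of_pos (by positivity : 0 < 2 * ε),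
      div_le_iff₀ ha0, div_le_iff₀ (by positivity)]
    calc |d| ≤ C * μ ^ (1 / 3 : ℝ) * (ε * (N + ε)) := hd_le
      _ ≤ C * μ ^ (1 / 3 : ℝ) * (ε * (N + ε)) * 2 :=
          le_mul_of_one_le_right (by positivity) one_le_two
      _ = C / κ * μ ^ (1 / 3 : ℝ) * (κ * (N + ε)) * (2 * ε) := by field_simp
      _ ≤ C / κ * μ ^ (1 / 3 : ℝ) * ‖a‖ * (2 * ε) := by gcongr
  · rw [mul_add, mul_one, mul_div_cancel₀ _ (norm_pos_iff.1 ha0), add_re, ofReal_re, hd]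
    field_simp
    ring

/-! ### Asymptotics at the fronts -/

theorem rpow_one_third_pow_three {a : ℝ} (ha : 0 ≤ a) : (a ^ (1 / 3 : ℝ)) ^ 3 = a := by
  rw [← Real.rpow_natCast, ← Real.rpow_mul ha]
  norm_num

theorem rpow_two_thirds_eq {a : ℝ} (ha : 0 ≤ a) : a ^ (2 / 3 : ℝ) = (a ^ (1 / 3 : ℝ)) ^ 2 := by
  rw [← Real.rpow_natCast, ← Real.rpow_mul ha]
  norm_num

/-- The argument `z = y / (μ^{2/3} (q* t)^{1/3})` of the Airy function at the signed distance `y`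
from a front. -/
noncomputable def frontVar (γ₁ γ₂ pstar μ t y : ℝ) : ℝ :=
  y / (μ ^ (2 / 3 : ℝ) * (qStar γ₁ γ₂ pstar * t) ^ (1 / 3 : ℝ))

section Scaling

variable {γ₁ γ₂ pstar : ℝ}

theorem frontVar_neg (γ₁ γ₂ pstar μ t y : ℝ) :
    frontVar γ₁ γ₂ pstar μ t (-y) = -frontVar γ₁ γ₂ pstar μ t y :=
  neg_div _ _

section Pointwise

variable {μ t : ℝ}

theorem eps_pos (hq : 0 < qStar γ₁ γ₂ pstar) (hμ : 0 < μ) (ht : 0 < t) :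
    0 < eps γ₁ γ₂ pstar μ t :=
  Real.rpow_pos_of_pos (by positivity) _

theorem eps_eq (hq : 0 < qStar γ₁ γ₂ pstar) (hμ : 0 < μ) (ht : 0 < t) :
    eps γ₁ γ₂ pstar μ t = μ ^ (1 / 3 : ℝ) * ((qStar γ₁ γ₂ pstar * t) ^ (1 / 3 : ℝ))⁻¹ := by
  rw [eps, Real.div_rpow hμ.le (by positivity), div_eq_mul_inv]

theorem eps_cube (hq : 0 < qStar γ₁ γ₂ pstar) (hμ : 0 < μ) (ht : 0 < t) :
    eps γ₁ γ₂ pstar μ t ^ 3 = μ / (qStar γ₁ γ₂ pstar * t) :=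
  rpow_one_third_pow_three (by positivity)

theorem frontVar_mul_eps_sq (hq : 0 < qStar γ₁ γ₂ pstar) (hμ : 0 < μ) (ht : 0 < t) (y : ℝ) :
    frontVar γ₁ γ₂ pstar μ t y * eps γ₁ γ₂ pstar μ t ^ 2 = y / (qStar γ₁ γ₂ pstar * t) := by
  have hQ := rpow_one_third_pow_three (mul_pos hq ht).le
  rw [frontVar, eps_eq hq hμ ht, rpow_two_thirds_eq hμ.le]
  nth_rewrite 3 [← hQ]
  field_simp

theorem frontVar_div_eps (hq : 0 < qStar γ₁ γ₂ pstar) (hμ : 0 < μ) (ht : 0 < t) (y : ℝ) :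
    frontVar γ₁ γ₂ pstar μ t y / eps γ₁ γ₂ pstar μ t = y / μ := by
  have hε := (eps_pos hq hμ ht).ne'
  calc frontVar γ₁ γ₂ pstar μ t y / eps γ₁ γ₂ pstar μ t
      = frontVar γ₁ γ₂ pstar μ t y * eps γ₁ γ₂ pstar μ t ^ 2 / eps γ₁ γ₂ pstar μ t ^ 3 := by
        field_simp
    _ = y / μ := by
        rw [frontVar_mul_eps_sq hq hμ ht, eps_cube hq hμ ht]
        field_simp

end Pointwise

variable {ι : Type*} {l : Filter ι} {μ t : ι → ℝ} {t₀ : ℝ}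

theorem isBigO_inv_rpow_qStar_mul (hq : 0 < qStar γ₁ γ₂ pstar) (ht₀ : 0 < t₀)
    (ht : ∀ᶠ i in l, t₀ ≤ t i) :
    (fun i => ((qStar γ₁ γ₂ pstar * t i) ^ (1 / 3 : ℝ))⁻¹) =O[l] fun _ => (1 : ℝ) := by
  refine IsBigO.of_bound ((qStar γ₁ γ₂ pstar * t₀) ^ (1 / 3 : ℝ))⁻¹ (ht.mono fun i hi => ?_)
  have hti : 0 < t i := ht₀.trans_le hi
  rw [norm_one, mul_one, Real.norm_of_nonneg (by positivity)]
  gcongr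

theorem isBigO_eps (hq : 0 < qStar γ₁ γ₂ pstar) (hμ : Tendsto μ l (𝓝[>] 0)) (ht₀ : 0 < t₀)
    (ht : ∀ᶠ i in l, t₀ ≤ t i) :
    (fun i => eps γ₁ γ₂ pstar (μ i) (t i)) =O[l] fun i => μ i ^ (1 / 3 : ℝ) := by
  refine ((isBigO_refl _ l).mul (isBigO_inv_rpow_qStar_mul hq ht₀ ht)).congr' ?_
    (Eventually.of_forall fun i => mul_one _)
  filter_upwards [(tendsto_nhdsWithin_iff.1 hμ).2, ht] with i hμi hti
  exact (eps_eq hq hμi (ht₀.trans_le hti)).symm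

theorem tendsto_eps (hq : 0 < qStar γ₁ γ₂ pstar) (hμ : Tendsto μ l (𝓝[>] 0)) (ht₀ : 0 < t₀)
    (ht : ∀ᶠ i in l, t₀ ≤ t i) :
    Tendsto (fun i => eps γ₁ γ₂ pstar (μ i) (t i)) l (𝓝[>] 0) := by
  have hμ' := tendsto_nhdsWithin_iff.1 hμ
  refine tendsto_nhdsWithin_iff.2 ⟨(isBigO_eps hq hμ ht₀ ht).trans_tendsto ?_, ?_⟩
  · simpa using hμ'.1.rpow_const (p := 1 / 3) (Or.inr (by norm_num))
  · filter_upwards [hμ'.2, ht] with i hμi hti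
    exact eps_pos hq hμi (ht₀.trans_le hti)

theorem isBigO_frontVar (hq : 0 < qStar γ₁ γ₂ pstar) (hμ : Tendsto μ l (𝓝[>] 0)) (ht₀ : 0 < t₀)
    (ht : ∀ᶠ i in l, t₀ ≤ t i) {y : ι → ℝ} (hy : y =O[l] fun i => μ i ^ (2 / 3 : ℝ)) :
    (fun i => frontVar γ₁ γ₂ pstar (μ i) (t i) (y i)) =O[l] fun _ => (1 : ℝ) := by
  have hdiv : (fun i => y i * (μ i ^ (2 / 3 : ℝ))⁻¹) =O[l] fun _ => (1 : ℝ) := by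
    refine (hy.mul (isBigO_refl _ l)).congr' (.refl _ _) ?_
    filter_upwards [(tendsto_nhdsWithin_iff.1 hμ).2] with i hμi
    exact mul_inv_cancel₀ (Real.rpow_pos_of_pos hμi _).ne'
  refine (hdiv.mul (isBigO_inv_rpow_qStar_mul hq ht₀ ht)).congr (fun i => ?_) fun _ => mul_one 1
  simp only [frontVar, div_eq_mul_inv, mul_inv, mul_assoc]

theorem isBigO_div_qStar_mul (hq : 0 < qStar γ₁ γ₂ pstar) (hμ : Tendsto μ l (𝓝[>] 0))
    (ht₀ : 0 < t₀) (ht : ∀ᶠ i in l, t₀ ≤ t i) {y : ι → ℝ}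
    (hy : y =O[l] fun i => μ i ^ (2 / 3 : ℝ)) :
    (fun i => y i / (qStar γ₁ γ₂ pstar * t i)) =O[l]
      fun i => eps γ₁ γ₂ pstar (μ i) (t i) ^ 2 := by
  refine ((isBigO_frontVar hq hμ ht₀ ht hy).mul (isBigO_refl _ l)).congr' ?_
    (Eventually.of_forall fun i => one_mul _)
  filter_upwards [(tendsto_nhdsWithin_iff.1 hμ).2, ht] with i hμi hti
  exact frontVar_mul_eps_sq hq hμi (ht₀.trans_le hti) (y i)

end Scaling

/-- The deviation of `ω₂(p* + s)` from its tangent at the inflection point `p*`, normalised so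
that it is `s³ / 3` to leading order. -/
noncomputable def frontPhase (γ₁ γ₂ pstar s : ℝ) : ℝ :=
  (omega₂ γ₁ γ₂ (s + pstar) - omega₂ γ₁ γ₂ pstar + cStar γ₁ γ₂ pstar * s) / qStar γ₁ γ₂ pstar

section FrontPhase

variable {γ₁ γ₂ pstar : ℝ}

theorem hasDerivAt_frontPhase (hγ₁ : 0 < γ₁) (hγ : γ₁ < γ₂) (pstar s : ℝ) :
    HasDerivAt (frontPhase γ₁ γ₂ pstar)
      ((deriv (omega₂ γ₁ γ₂) (s + pstar) + cStar γ₁ γ₂ pstar) / qStar γ₁ γ₂ pstar) s := by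
  have hω := ((contDiff_omega₂ hγ₁ hγ).differentiable (by simp) (s + pstar)).hasDerivAt
  exact ((((hω.comp_add_const s pstar).sub_const _).fun_add
    ((hasDerivAt_id' s).const_mul (cStar γ₁ γ₂ pstar))).div_const _).congr_deriv (by ring)

theorem deriv_frontPhase (hγ₁ : 0 < γ₁) (hγ : γ₁ < γ₂) (pstar : ℝ) :
    deriv (frontPhase γ₁ γ₂ pstar) = fun s =>
      (deriv (omega₂ γ₁ γ₂) (s + pstar) + cStar γ₁ γ₂ pstar) / qStar γ₁ γ₂ pstar :=
  funext fun s => (hasDerivAt_frontPhase hγ₁ hγ pstar s).deriv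

theorem contDiff_deriv_frontPhase (hγ₁ : 0 < γ₁) (hγ : γ₁ < γ₂) (pstar : ℝ) :
    ContDiff ℝ ∞ (deriv (frontPhase γ₁ γ₂ pstar)) := by
  have hω' := (contDiff_infty_iff_deriv.1 (contDiff_omega₂ hγ₁ hγ)).2
  rw [deriv_frontPhase hγ₁ hγ]
  exact ((hω'.comp (contDiff_id.add contDiff_const)).add contDiff_const).div_const _

theorem deriv_deriv_frontPhase (hγ₁ : 0 < γ₁) (hγ : γ₁ < γ₂) (pstar : ℝ) :
    deriv (deriv (frontPhase γ₁ γ₂ pstar)) =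
      fun s => deriv (deriv (omega₂ γ₁ γ₂)) (s + pstar) / qStar γ₁ γ₂ pstar := by
  rw [deriv_frontPhase hγ₁ hγ]
  funext s
  rw [deriv_div_const, deriv_add_const, deriv_comp_add_const (deriv (omega₂ γ₁ γ₂))]

theorem deriv_deriv_deriv_frontPhase_zero (hγ₁ : 0 < γ₁) (hγ : γ₁ < γ₂)
    (hq : qStar γ₁ γ₂ pstar ≠ 0) : deriv (deriv (deriv (frontPhase γ₁ γ₂ pstar))) 0 = 2 := by
  rw [deriv_deriv_frontPhase hγ₁ hγ, deriv_div_const,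
    deriv_comp_add_const (deriv (deriv (omega₂ γ₁ γ₂))), zero_add, div_eq_iff hq, qStar,
    iteratedDeriv_succ, iteratedDeriv_two_eq_deriv_deriv]
  ring

theorem deriv_frontPhase_pos (hγ₁ : 0 < γ₁) (hγ : γ₁ < γ₂)
    (hpstar : pstar ∈ Ioo 0 (Real.pi / 2)) (hzero : iteratedDeriv 2 (omega₂ γ₁ γ₂) pstar = 0)
    {s : ℝ} (hs : s + pstar ∈ Icc (-(Real.pi / 2)) (Real.pi / 2)) (hs0 : s ≠ 0) :
    0 < deriv (frontPhase γ₁ γ₂ pstar) s := by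
  have hlt := deriv_omega₂_lt hγ₁ hγ hpstar hzero hs (by simpa using hs0)
  rw [deriv_frontPhase hγ₁ hγ, cStar]
  exact div_pos (by linarith) (qStar_pos hγ₁ hγ hpstar hzero)

theorem integral_mul_cexp_eq_integral_mul_scaledExp {μ t : ℝ} (hq : 0 < qStar γ₁ γ₂ pstar)
    (hμ : 0 < μ) (ht : 0 < t) (g : ℝ → ℂ) (x a b : ℝ) :
    ∫ p in a..b, g p * cexp (I * (((p * x + omega₂ γ₁ γ₂ p * t) / μ : ℝ) : ℂ)) =
      cexp (I * ((Phi₁ γ₁ γ₂ pstar x t / μ : ℝ) : ℂ)) * ∫ s in (a - pstar)..(b - pstar),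
        g (s + pstar) * scaledExp (frontPhase γ₁ γ₂ pstar)
          (frontVar γ₁ γ₂ pstar μ t (x - cStar γ₁ γ₂ pstar * t)) (eps γ₁ γ₂ pstar μ t) s := by
  have hshift := intervalIntegral.integral_comp_add_right (a := a - pstar) (b := b - pstar)
    (fun p => g p * cexp (I * (((p * x + omega₂ γ₁ γ₂ p * t) / μ : ℝ) : ℂ))) pstar
  rw [sub_add_cancel, sub_add_cancel] at hshift
  rw [← intervalIntegral.integral_const_mul, ← hshift]
  refine intervalIntegral.integral_congr fun s _ => ?_
  have hphase : ((s + pstar) * x + omega₂ γ₁ γ₂ (s + pstar) * t) / μ =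
      Phi₁ γ₁ γ₂ pstar x t / μ + (frontVar γ₁ γ₂ pstar μ t (x - cStar γ₁ γ₂ pstar * t) *
        (s / eps γ₁ γ₂ pstar μ t) + frontPhase γ₁ γ₂ pstar s / eps γ₁ γ₂ pstar μ t ^ 3) := by
    rw [mul_div_left_comm, frontVar_div_eps hq hμ ht, eps_cube hq hμ ht, frontPhase, Phi₁]
    field_simp
    ring
  simp only [hphase, scaledExp]
  rw [ofReal_add, mul_add, exp_add]
  ring

end FrontPhase

/-- The leading amplitude, at signed distance `y` from a front, of the oscillatory integral of `g`:
only the value and the slope of `g` at `p*` enter. The direction of the front is encoded in `ζ`,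
which is `i` at the right front and `-i` at the left one. -/
noncomputable def airyAmplitude (γ₁ γ₂ pstar : ℝ) (g : ℝ → ℂ) (ζ : ℂ) (μ t y : ℝ) : ℂ :=
  g pstar * airyAi (frontVar γ₁ γ₂ pstar μ t y) -
    ζ * eps γ₁ γ₂ pstar μ t * deriv g pstar * airyAiDeriv (frontVar γ₁ γ₂ pstar μ t y)

section Front

variable {γ₁ γ₂ pstar t₀ : ℝ} {ι : Type*} {l : Filter ι} {μ t x : ι → ℝ}

theorem isBigO_integral_sub_airy (hγ₁ : 0 < γ₁) (hγ : γ₁ < γ₂)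
    (hpstar : pstar ∈ Ioo 0 (Real.pi / 2)) (hzero : iteratedDeriv 2 (omega₂ γ₁ γ₂) pstar = 0)
    {g : ℝ → ℂ} (hg : ContDiff ℝ ∞ g) (hμ : Tendsto μ l (𝓝[>] 0)) (ht₀ : 0 < t₀)
    (ht : ∀ᶠ i in l, t₀ ≤ t i)
    (hx : (fun i => x i - cStar γ₁ γ₂ pstar * t i) =O[l] fun i => μ i ^ (2 / 3 : ℝ)) :
    (fun i => 1 / (Real.pi : ℂ) * (∫ p in (-(Real.pi / 2))..(Real.pi / 2),
        g p * cexp (I * (((p * x i + omega₂ γ₁ γ₂ p * t i) / μ i : ℝ) : ℂ))) -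
      2 * (eps γ₁ γ₂ pstar (μ i) (t i) : ℂ) *
        (cexp (I * ((Phi₁ γ₁ γ₂ pstar (x i) (t i) / μ i : ℝ) : ℂ)) *
          airyAmplitude γ₁ γ₂ pstar g I (μ i) (t i) (x i - cStar γ₁ γ₂ pstar * t i))) =O[l]
      fun i => eps γ₁ γ₂ pstar (μ i) (t i) ^ 2 * ‖g pstar‖ + eps γ₁ γ₂ pstar (μ i) (t i) ^ 3 := by
  have hq := qStar_pos hγ₁ hγ hpstar hzero
  have hairy := isBigO_integral_mul_scaledExp (g := fun s => g (s + pstar))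
    (a := -(Real.pi / 2) - pstar) (b := Real.pi / 2 - pstar) (by linarith [hpstar.1, Real.pi_pos])
    (by linarith [hpstar.2])
    (fun s => (hasDerivAt_frontPhase hγ₁ hγ pstar s).differentiableAt.hasDerivAt)
    (by simp [frontPhase]) (contDiff_deriv_frontPhase hγ₁ hγ pstar)
    (by simp [deriv_frontPhase hγ₁ hγ, cStar])
    (by simp [deriv_deriv_frontPhase hγ₁ hγ, ← iteratedDeriv_two_eq_deriv_deriv, hzero])
    (deriv_deriv_deriv_frontPhase_zero hγ₁ hγ hq.ne')
    (fun s hs => deriv_frontPhase_pos hγ₁ hγ hpstar hzero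
      ⟨by linarith [hs.1], by linarith [hs.2]⟩)
    (hg.comp (contDiff_id.add contDiff_const)) (tendsto_eps hq hμ ht₀ ht)
    (isBigO_frontVar hq hμ ht₀ ht hx)
  have hunit : (fun i => cexp (I * ((Phi₁ γ₁ γ₂ pstar (x i) (t i) / μ i : ℝ) : ℂ)) *
      (1 / (Real.pi : ℂ))) =O[l] fun _ => (1 : ℝ) :=
    IsBigO.of_bound ‖1 / (Real.pi : ℂ)‖ (.of_forall fun i => by
      rw [norm_mul, norm_exp_I_mul_ofReal]; simp)
  refine (hunit.mul hairy).congr' ?_ (.of_forall fun i => by simp)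
  filter_upwards [(tendsto_nhdsWithin_iff.1 hμ).2, ht] with i hμi hti
  rw [integral_mul_cexp_eq_integral_mul_scaledExp hq hμi (ht₀.trans_le hti)]
  have hπ : (Real.pi : ℂ) ≠ 0 := ofReal_ne_zero.2 Real.pi_ne_zero
  simp only [airyAmplitude, zero_add, deriv_comp_add_const g]
  field_simp

end Front

theorem isBigO_one_comp_of_continuous {ι E : Type*} [NormedAddCommGroup E] {l : Filter ι}
    {f : ℝ → E} {z : ι → ℝ} (hf : Continuous f) (hz : z =O[l] fun _ => (1 : ℝ)) :
    (fun i => f (z i)) =O[l] fun _ => (1 : ℝ) := by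
  obtain ⟨L, hL⟩ := hz.bound
  obtain ⟨A, hA⟩ := (isCompact_closedBall (0 : ℝ) L).exists_bound_of_continuousOn hf.continuousOn
  exact IsBigO.of_bound A (hL.mono fun i hi => by
    simpa using hA (z i) (mem_closedBall_zero_iff.2 (by simpa using hi)))

theorem Iopt_eq_reflect (γ₁ γ₂ : ℝ) (W : SchwartzMap ℝ ℝ) (μ x t : ℝ) (j : Fin 2) :
    Iopt γ₁ γ₂ W μ x t j = (1 / (Real.pi : ℂ)) * ∫ p in (-(Real.pi / 2))..(Real.pi / 2),
      conj (applyB γ₁ γ₂ p (tildeV W p) j) *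
        cexp (I * (((p * -x + omega₂ γ₁ γ₂ p * t) / μ : ℝ) : ℂ)) := by
  have hneg := intervalIntegral.integral_comp_neg (a := -(Real.pi / 2)) (b := Real.pi / 2)
    fun p => applyB γ₁ γ₂ p (tildeV W p) j *
      cexp (I * (((p * x + omega₂ γ₁ γ₂ p * t) / μ : ℝ) : ℂ))
  rw [neg_neg] at hneg
  simp only [Iopt, ← hneg, applyB_tildeV_neg, omega₂_neg, neg_mul_comm]

theorem conj_cexp_Phi₁_neg (γ₁ γ₂ p μ x t : ℝ) :
    conj (cexp (I * ((Phi₁ γ₁ γ₂ p (-x) t / μ : ℝ) : ℂ))) =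
      cexp (I * ((Phi₂ γ₁ γ₂ p x t / μ : ℝ) : ℂ)) := by
  rw [← exp_conj, map_mul, conj_I, conj_ofReal, Phi₁, Phi₂]
  congr 1
  push_cast
  ring

/-- The amplitude at signed distance `y` from a front in terms of `F₁` and `F₂`, without its phase
factor; `ζ` is `i` at the right front and `-i` at the left one. -/
noncomputable def evenOddAmplitude (γ₁ γ₂ : ℝ) (W : SchwartzMap ℝ ℝ) (pstar : ℝ) (ζ : ℂ)
    (μ t y : ℝ) : Fin 2 → ℂ :=
  applyB γ₁ γ₂ pstar
    ((airyAi (frontVar γ₁ γ₂ pstar μ t y) : ℂ) •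
        F₁ W pstar (-(y / (qStar γ₁ γ₂ pstar * t))) +
      ((eps γ₁ γ₂ pstar μ t : ℂ) * (ζ * airyAiDeriv (frontVar γ₁ γ₂ pstar μ t y))) •
        F₂ W pstar (-(y / (qStar γ₁ γ₂ pstar * t))))

theorem ampRight_apply (γ₁ γ₂ : ℝ) (W : SchwartzMap ℝ ℝ) (pstar μ x t : ℝ) (j : Fin 2) :
    ampRight γ₁ γ₂ W pstar μ x t j =
      cexp (I * ((Phi₁ γ₁ γ₂ pstar x t / μ : ℝ) : ℂ)) *
        evenOddAmplitude γ₁ γ₂ W pstar I μ t (x - cStar γ₁ γ₂ pstar * t) j := by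
  rw [evenOddAmplitude, mul_left_comm, ← mul_assoc I]
  rfl

theorem ampLeft_apply (γ₁ γ₂ : ℝ) (W : SchwartzMap ℝ ℝ) (pstar μ x t : ℝ) (j : Fin 2) :
    ampLeft γ₁ γ₂ W pstar μ x t j =
      cexp (I * ((Phi₂ γ₁ γ₂ pstar x t / μ : ℝ) : ℂ)) *
        evenOddAmplitude γ₁ γ₂ W pstar (-I) μ t (-x - cStar γ₁ γ₂ pstar * t) j := by
  rw [evenOddAmplitude, ← neg_add', frontVar_neg, neg_div, neg_neg, neg_mul, mul_neg, neg_smul,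
    ← sub_eq_add_neg, mul_left_comm, ← mul_assoc I]
  rfl

theorem conj_airyAmplitude_conj {g : ℝ → ℂ} {pstar : ℝ} (hg : DifferentiableAt ℝ g pstar)
    (γ₁ γ₂ : ℝ) (ζ : ℂ) (μ t y : ℝ) :
    conj (airyAmplitude γ₁ γ₂ pstar (fun p => conj (g p)) ζ μ t y) =
      airyAmplitude γ₁ γ₂ pstar g (conj ζ) μ t y := by
  have hderiv : deriv (fun p => conj (g p)) pstar = conj (deriv g pstar) :=
    (conjCLE.hasFDerivAt.comp_hasDerivAt pstar hg.hasDerivAt).deriv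
  simp only [airyAmplitude, hderiv, map_sub, map_mul, conj_conj, conj_ofReal]

section Front

variable {γ₁ γ₂ pstar t₀ : ℝ} {ι : Type*} {l : Filter ι} {μ t x y : ι → ℝ}

theorem isBigO_evenOddAmplitude_sub_airyAmplitude (hγ₁ : 0 < γ₁) (hγ : γ₁ < γ₂)
    (hq : 0 < qStar γ₁ γ₂ pstar) (W : SchwartzMap ℝ ℝ) (ζ : ℂ) (j : Fin 2)
    (hμ : Tendsto μ l (𝓝[>] 0)) (ht₀ : 0 < t₀) (ht : ∀ᶠ i in l, t₀ ≤ t i)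
    (hy : y =O[l] fun i => μ i ^ (2 / 3 : ℝ)) :
    (fun i => evenOddAmplitude γ₁ γ₂ W pstar ζ (μ i) (t i) (y i) j -
      airyAmplitude γ₁ γ₂ pstar (fun p => applyB γ₁ γ₂ p (tildeV W p) j) ζ (μ i) (t i) (y i)) =O[l]
      fun i => eps γ₁ γ₂ pstar (μ i) (t i) *
        (‖tildeV W pstar‖ + eps γ₁ γ₂ pstar (μ i) (t i)) := by
  have hz := isBigO_frontVar hq hμ ht₀ ht hy
  have hAi := isBigO_one_comp_of_continuous (continuous_ofReal.comp continuous_airyAi) hz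
  have hAi' := isBigO_one_comp_of_continuous (continuous_ofReal.comp continuous_airyAiDeriv) hz
  refine (isBigO_applyB_evenOdd_sub hγ₁ hγ W pstar j (tendsto_eps hq hμ ht₀ ht)
    (isBigO_div_qStar_mul hq hμ ht₀ ht hy).neg_left hAi (hAi'.const_mul_left ζ)).congr_left
    fun i => ?_
  simp only [evenOddAmplitude, airyAmplitude, Function.comp_apply]
  ring

theorem isBigO_sub_evenOddAmplitude (hγ₁ : 0 < γ₁) (hγ : γ₁ < γ₂)
    (hq : 0 < qStar γ₁ γ₂ pstar) (W : SchwartzMap ℝ ℝ) (ζ : ℂ) (j : Fin 2)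
    (hμ : Tendsto μ l (𝓝[>] 0)) (ht₀ : 0 < t₀) (ht : ∀ᶠ i in l, t₀ ≤ t i)
    (hy : y =O[l] fun i => μ i ^ (2 / 3 : ℝ)) {u e : ι → ℂ} (he : ∀ i, ‖e i‖ = 1)
    (hu : (fun i => u i - 2 * (eps γ₁ γ₂ pstar (μ i) (t i) : ℂ) * (e i *
        airyAmplitude γ₁ γ₂ pstar (fun p => applyB γ₁ γ₂ p (tildeV W p) j) ζ (μ i) (t i) (y i)))
      =O[l] fun i => eps γ₁ γ₂ pstar (μ i) (t i) ^ 2 *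
        ‖applyB γ₁ γ₂ pstar (tildeV W pstar) j‖ + eps γ₁ γ₂ pstar (μ i) (t i) ^ 3) :
    (fun i => u i - 2 * (eps γ₁ γ₂ pstar (μ i) (t i) : ℂ) *
        (e i * evenOddAmplitude γ₁ γ₂ W pstar ζ (μ i) (t i) (y i) j)) =O[l]
      fun i => μ i ^ (1 / 3 : ℝ) * (eps γ₁ γ₂ pstar (μ i) (t i) *
        (‖tildeV W pstar‖ + eps γ₁ γ₂ pstar (μ i) (t i))) := by
  set ε := fun i => eps γ₁ γ₂ pstar (μ i) (t i)
  set N := ‖tildeV W pstar‖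
  have hunit : e =O[l] fun _ => (1 : ℝ) := IsBigO.of_bound 1 (.of_forall fun i => by simp [he])
  have hε : (fun i => 2 * (ε i : ℂ)) =O[l] ε :=
    (isBigO_ofReal_left.2 (isBigO_refl ε l)).const_mul_left 2
  have hamp := (hε.mul (hunit.mul (isBigO_evenOddAmplitude_sub_airyAmplitude
    hγ₁ hγ hq W ζ j hμ ht₀ ht hy))).congr_right fun i => by rw [one_mul]
  have hu' : (fun i => ε i ^ 2 * ‖applyB γ₁ γ₂ pstar (tildeV W pstar) j‖ + ε i ^ 3) =O[l]
      fun i => ε i * (ε i * (N + ε i)) := by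
    have hN : (fun _ : ι => ‖applyB γ₁ γ₂ pstar (tildeV W pstar) j‖) =O[l] fun _ => N :=
      (isBigO_applyB (fun k => .of_norm_le fun _ => norm_le_pi_norm _ k) γ₁ γ₂ pstar j).norm_left
    have hε₀ : ∀ᶠ i in l, 0 ≤ ε i :=
      (tendsto_nhdsWithin_iff.1 (tendsto_eps hq hμ ht₀ ht)).2.mono fun _ h => le_of_lt h
    have hN₀ : ∀ᶠ _ in l, 0 ≤ N := .of_forall fun _ => norm_nonneg _
    have hεε := (isBigO_refl ε l).mul (isBigO_refl ε l)
    refine ((hεε.mul (hN.trans (isBigO_add_of_nonneg_left hN₀ hε₀))).add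
      (hεε.mul (isBigO_add_of_nonneg_right hN₀ hε₀))).congr (fun i => ?_) fun i => mul_assoc _ _ _
    ring
  refine IsBigO.trans (((hu.trans hu').sub hamp).congr_left fun i => ?_)
    ((isBigO_eps hq hμ ht₀ ht).mul (isBigO_refl _ l))
  ring

theorem isBigO_Iopt_sub_ampRight (hγ₁ : 0 < γ₁) (hγ : γ₁ < γ₂)
    (hpstar : pstar ∈ Ioo 0 (Real.pi / 2)) (hzero : iteratedDeriv 2 (omega₂ γ₁ γ₂) pstar = 0)
    (W : SchwartzMap ℝ ℝ) (j : Fin 2) (hμ : Tendsto μ l (𝓝[>] 0)) (ht₀ : 0 < t₀)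
    (ht : ∀ᶠ i in l, t₀ ≤ t i)
    (hx : (fun i => x i - cStar γ₁ γ₂ pstar * t i) =O[l] fun i => μ i ^ (2 / 3 : ℝ)) :
    (fun i => Iopt γ₁ γ₂ W (μ i) (x i) (t i) j - 2 * (eps γ₁ γ₂ pstar (μ i) (t i) : ℂ) *
        ampRight γ₁ γ₂ W pstar (μ i) (x i) (t i) j) =O[l]
      fun i => μ i ^ (1 / 3 : ℝ) * (eps γ₁ γ₂ pstar (μ i) (t i) *
        (‖tildeV W pstar‖ + eps γ₁ γ₂ pstar (μ i) (t i))) := by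
  simp only [ampRight_apply]
  exact isBigO_sub_evenOddAmplitude hγ₁ hγ (qStar_pos hγ₁ hγ hpstar hzero) W I j hμ ht₀ ht hx
    (fun i => norm_exp_I_mul_ofReal _) (isBigO_integral_sub_airy hγ₁ hγ hpstar hzero
      (contDiff_applyB_tildeV hγ₁ hγ W j) hμ ht₀ ht hx)

theorem isBigO_conj_Iopt_sub_ampLeft (hγ₁ : 0 < γ₁) (hγ : γ₁ < γ₂)
    (hpstar : pstar ∈ Ioo 0 (Real.pi / 2)) (hzero : iteratedDeriv 2 (omega₂ γ₁ γ₂) pstar = 0)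
    (W : SchwartzMap ℝ ℝ) (j : Fin 2) (hμ : Tendsto μ l (𝓝[>] 0)) (ht₀ : 0 < t₀)
    (ht : ∀ᶠ i in l, t₀ ≤ t i)
    (hx : (fun i => x i + cStar γ₁ γ₂ pstar * t i) =O[l] fun i => μ i ^ (2 / 3 : ℝ)) :
    (fun i => conj (Iopt γ₁ γ₂ W (μ i) (x i) (t i) j) -
        2 * (eps γ₁ γ₂ pstar (μ i) (t i) : ℂ) * ampLeft γ₁ γ₂ W pstar (μ i) (x i) (t i) j) =O[l]
      fun i => μ i ^ (1 / 3 : ℝ) * (eps γ₁ γ₂ pstar (μ i) (t i) *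
        (‖tildeV W pstar‖ + eps γ₁ γ₂ pstar (μ i) (t i))) := by
  have hg := contDiff_applyB_tildeV hγ₁ hγ W j
  have hneg : (fun i => -x i - cStar γ₁ γ₂ pstar * t i) =O[l] fun i => μ i ^ (2 / 3 : ℝ) :=
    hx.neg_left.congr_left fun i => neg_add' _ _
  have hairy := isBigO_conj_left.2 (isBigO_integral_sub_airy hγ₁ hγ hpstar hzero
    (conjCLE.contDiff.comp hg) hμ ht₀ ht hneg)
  simp only [ampLeft_apply]
  refine isBigO_sub_evenOddAmplitude hγ₁ hγ (qStar_pos hγ₁ hγ hpstar hzero) W (-I) j hμ ht₀ ht hneg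
    (fun i => norm_exp_I_mul_ofReal _) (hairy.congr (fun i => ?_) fun i => ?_)
  · rw [Iopt_eq_reflect, ← conj_cexp_Phi₁_neg, ← conj_I, ← conj_airyAmplitude_conj
      (hg.differentiable (by simp) pstar)]
    simp only [map_sub, map_mul, map_ofNat, conj_ofReal, Function.comp_def, conjCLE_apply]
  · simp only [Function.comp_apply, conjCLE_apply, RCLike.norm_conj]

end Front

/-- Triples `(μ, t, x)` with `μ → 0+`, at times `t ≥ t₀` and at distance at most `K μ^{2/3}` from
the front `x = v t`. -/
def frontFilter (v t₀ K : ℝ) : Filter (ℝ × ℝ × ℝ) :=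
  comap Prod.fst (𝓝[>] 0) ⊓
    𝓟 {i | t₀ ≤ i.2.1 ∧ |i.2.2 - v * i.2.1| ≤ K * i.1 ^ (2 / 3 : ℝ)}

section FrontFilter

variable {v t₀ K : ℝ}

theorem eventually_frontFilter {P : ℝ × ℝ × ℝ → Prop} :
    (∀ᶠ i in frontFilter v t₀ K, P i) ↔ ∃ μ₀ > 0, ∀ μ, 0 < μ → μ < μ₀ → ∀ t, t₀ ≤ t → ∀ x,
      |x - v * t| ≤ K * μ ^ (2 / 3 : ℝ) → P (μ, t, x) := by
  rw [frontFilter, (((nhdsGT_basis (0 : ℝ)).comap Prod.fst).inf_principal _).eventually_iff]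
  simp only [mem_inter_iff, mem_preimage, mem_Ioo, mem_ofPred_eq, Prod.forall, and_imp, gt_iff_lt]
  grind

theorem tendsto_fst_frontFilter : Tendsto Prod.fst (frontFilter v t₀ K) (𝓝[>] 0) :=
  tendsto_comap.mono_left inf_le_left

theorem eventually_mem_frontFilter : ∀ᶠ i in frontFilter v t₀ K,
    t₀ ≤ i.2.1 ∧ |i.2.2 - v * i.2.1| ≤ K * i.1 ^ (2 / 3 : ℝ) :=
  mem_inf_of_right (mem_principal_self _)

theorem isBigO_sub_frontFilter :
    (fun i : ℝ × ℝ × ℝ => i.2.2 - v * i.2.1) =O[frontFilter v t₀ K]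
      fun i => i.1 ^ (2 / 3 : ℝ) := by
  refine IsBigO.of_bound K ?_
  filter_upwards [eventually_mem_frontFilter, tendsto_fst_frontFilter self_mem_nhdsWithin]
    with i hi hμ
  rw [Real.norm_of_nonneg (Real.rpow_nonneg (le_of_lt hμ) _)]
  exact hi.2

end FrontFilter

theorem eventually_factorApprox {ι κ : Type*} [Finite κ] {l : Filter ι} {μ ε : ι → ℝ} {N : ℝ}
    {u w a : κ → ι → ℂ} (hμ : ∀ᶠ i in l, 0 < μ i) (hε : ∀ᶠ i in l, 0 < ε i) (hN : 0 ≤ N)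
    (huw : ∀ j i, (u j i).re = (w j i).re) (h : ∀ j, (fun i => w j i - 2 * ε i * a j i) =O[l]
      fun i => μ i ^ (1 / 3 : ℝ) * (ε i * (N + ε i))) :
    ∀ᶠ C in atTop, ∀ᶠ i in l, ∀ j, FactorApprox C (μ i) (ε i) N (u j i) (a j i) := by
  filter_upwards [eventually_all.2 fun j => isBigO_iff_eventually.1 (h j), eventually_ge_atTop 0]
    with C hC hC0
  filter_upwards [eventually_all.2 hC, hμ, hε] with i hi hμi hεi j
  refine .of_norm_sub_le hC0 hμi hεi hN (huw j i) ((hi j).trans_eq ?_)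
  rw [Real.norm_of_nonneg (by positivity), mul_assoc]

section Eventually

variable {γ₁ γ₂ pstar t₀ : ℝ}

theorem eventually_eps_pos (hq : 0 < qStar γ₁ γ₂ pstar) (ht₀ : 0 < t₀) (v K : ℝ) :
    ∀ᶠ i in frontFilter v t₀ K, 0 < eps γ₁ γ₂ pstar i.1 i.2.1 :=
  tendsto_eps hq tendsto_fst_frontFilter ht₀ (eventually_mem_frontFilter.mono fun _ h => h.1)
    self_mem_nhdsWithin

theorem eventually_factorApprox_ampRight (hγ₁ : 0 < γ₁) (hγ : γ₁ < γ₂)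
    (hpstar : pstar ∈ Ioo 0 (Real.pi / 2)) (hzero : iteratedDeriv 2 (omega₂ γ₁ γ₂) pstar = 0)
    (W : SchwartzMap ℝ ℝ) (ht₀ : 0 < t₀) (K : ℝ) :
    ∀ᶠ C in atTop, ∀ᶠ i in frontFilter (cStar γ₁ γ₂ pstar) t₀ K, ∀ j,
      FactorApprox C i.1 (eps γ₁ γ₂ pstar i.1 i.2.1) ‖tildeV W pstar‖
        (Iopt γ₁ γ₂ W i.1 i.2.2 i.2.1 j) (ampRight γ₁ γ₂ W pstar i.1 i.2.2 i.2.1 j) :=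
  eventually_factorApprox (tendsto_fst_frontFilter self_mem_nhdsWithin)
    (eventually_eps_pos (qStar_pos hγ₁ hγ hpstar hzero) ht₀ _ K) (norm_nonneg _) (fun _ _ => rfl)
    fun j => isBigO_Iopt_sub_ampRight hγ₁ hγ hpstar hzero W j tendsto_fst_frontFilter ht₀
      (eventually_mem_frontFilter.mono fun _ h => h.1) isBigO_sub_frontFilter

theorem eventually_factorApprox_ampLeft (hγ₁ : 0 < γ₁) (hγ : γ₁ < γ₂)
    (hpstar : pstar ∈ Ioo 0 (Real.pi / 2)) (hzero : iteratedDeriv 2 (omega₂ γ₁ γ₂) pstar = 0)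
    (W : SchwartzMap ℝ ℝ) (ht₀ : 0 < t₀) (K : ℝ) :
    ∀ᶠ C in atTop, ∀ᶠ i in frontFilter (-cStar γ₁ γ₂ pstar) t₀ K, ∀ j,
      FactorApprox C i.1 (eps γ₁ γ₂ pstar i.1 i.2.1) ‖tildeV W pstar‖
        (Iopt γ₁ γ₂ W i.1 i.2.2 i.2.1 j) (ampLeft γ₁ γ₂ W pstar i.1 i.2.2 i.2.1 j) :=
  eventually_factorApprox (tendsto_fst_frontFilter self_mem_nhdsWithin)
    (eventually_eps_pos (qStar_pos hγ₁ hγ hpstar hzero) ht₀ _ K) (norm_nonneg _)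
    (fun _ _ => (conj_re _).symm)
    fun j => isBigO_conj_Iopt_sub_ampLeft hγ₁ hγ hpstar hzero W j tendsto_fst_frontFilter ht₀
      (eventually_mem_frontFilter.mono fun _ h => h.1)
      (isBigO_sub_frontFilter.congr_left fun _ => by ring)

end Eventually

end DiatomicLattice

open DiatomicLattice in
theorem mainTheorem9_general (γ₁ γ₂ : ℝ) (hγ₁ : 0 < γ₁) (hγ : γ₁ < γ₂) :
    ∃ pstar ∈ Set.Ioo (0 : ℝ) (Real.pi / 2),
      iteratedDeriv 2 (omega₂ γ₁ γ₂) pstar = 0 ∧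
      (∀ p ∈ Set.Ioo 0 pstar, iteratedDeriv 2 (omega₂ γ₁ γ₂) p < 0) ∧
      (∀ p ∈ Set.Ioo pstar (Real.pi / 2), 0 < iteratedDeriv 2 (omega₂ γ₁ γ₂) p) ∧
      0 < cStar γ₁ γ₂ pstar ∧
      0 < qStar γ₁ γ₂ pstar ∧
      ∀ (W : SchwartzMap ℝ ℝ) (t₀ K : ℝ), 0 < t₀ →
        ∃ C > 0, ∃ μ₀ > 0, ∀ μ : ℝ, 0 < μ → μ < μ₀ → ∀ t : ℝ, t₀ ≤ t → ∀ x : ℝ,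
          (|x - cStar γ₁ γ₂ pstar * t| ≤ K * μ ^ (2 / 3 : ℝ) → ∀ j : Fin 2,
            FactorApprox C μ (eps γ₁ γ₂ pstar μ t) ‖tildeV W pstar‖
              (Iopt γ₁ γ₂ W μ x t j) (ampRight γ₁ γ₂ W pstar μ x t j)) ∧
          (|x + cStar γ₁ γ₂ pstar * t| ≤ K * μ ^ (2 / 3 : ℝ) → ∀ j : Fin 2,
            FactorApprox C μ (eps γ₁ γ₂ pstar μ t) ‖tildeV W pstar‖
              (Iopt γ₁ γ₂ W μ x t j) (ampLeft γ₁ γ₂ W pstar μ x t j)) := by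
  obtain ⟨pstar, hpstar, hzero⟩ := exists_iteratedDeriv_two_omega₂_eq_zero hγ₁ hγ
  refine ⟨pstar, hpstar, hzero, fun p => iteratedDeriv_two_omega₂_neg hγ₁ hγ hpstar.2.le hzero,
    fun p => iteratedDeriv_two_omega₂_pos hγ₁ hγ hpstar.1.le hzero, cStar_pos hγ₁ hγ hpstar,
    qStar_pos hγ₁ hγ hpstar hzero, fun W t₀ K ht₀ => ?_⟩
  obtain ⟨C, hright, hleft, hC⟩ :=
    ((eventually_factorApprox_ampRight hγ₁ hγ hpstar hzero W ht₀ K).and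
      ((eventually_factorApprox_ampLeft hγ₁ hγ hpstar hzero W ht₀ K).and
        (Filter.eventually_gt_atTop 0))).exists
  obtain ⟨μ₁, hμ₁, hright⟩ := eventually_frontFilter.1 hright
  obtain ⟨μ₂, hμ₂, hleft⟩ := eventually_frontFilter.1 hleft
  simp only [neg_mul, sub_neg_eq_add] at hleft
  exact ⟨C, hC, min μ₁ μ₂, lt_min hμ₁ hμ₂, fun μ hμ hμlt t ht x =>
    ⟨hright μ hμ (lt_min_iff.1 hμlt).1 t ht x, hleft μ hμ (lt_min_iff.1 hμlt).2 t ht x⟩⟩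

open DiatomicLattice in
theorem mainTheorem9 (γ₁ γ₂ : ℝ) (hγ₁ : 0 < γ₁) (hγ : γ₁ < γ₂) :
    ∃ pstar ∈ Set.Ioo (0 : ℝ) (Real.pi / 2),
      iteratedDeriv 2 (omega₂ γ₁ γ₂) pstar = 0 ∧
      (∀ p ∈ Set.Ioo 0 pstar, iteratedDeriv 2 (omega₂ γ₁ γ₂) p < 0) ∧
      (∀ p ∈ Set.Ioo pstar (Real.pi / 2), 0 < iteratedDeriv 2 (omega₂ γ₁ γ₂) p) ∧
      0 < cStar γ₁ γ₂ pstar ∧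
      0 < qStar γ₁ γ₂ pstar ∧
      ∀ (W : SchwartzMap ℝ ℝ) (t₀ t₁ K : ℝ), 0 < t₀ → t₀ ≤ t₁ → 0 < K →
        ∃ C > 0, ∃ μ₀ > 0, ∀ μ : ℝ, 0 < μ → μ < μ₀ → ∀ t ∈ Set.Icc t₀ t₁, ∀ x : ℝ,
          (|x - cStar γ₁ γ₂ pstar * t| ≤ K * μ ^ (2 / 3 : ℝ) → ∀ j : Fin 2,
            FactorApprox C μ (eps γ₁ γ₂ pstar μ t) ‖tildeV W pstar‖
              (Iopt γ₁ γ₂ W μ x t j) (ampRight γ₁ γ₂ W pstar μ x t j)) ∧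
          (|x + cStar γ₁ γ₂ pstar * t| ≤ K * μ ^ (2 / 3 : ℝ) → ∀ j : Fin 2,
            FactorApprox C μ (eps γ₁ γ₂ pstar μ t) ‖tildeV W pstar‖
              (Iopt γ₁ γ₂ W μ x t j) (ampLeft γ₁ γ₂ W pstar μ x t j)) := by
  obtain ⟨pstar, hpstar, hzero, hneg, hpos, hc, hq, happrox⟩ := mainTheorem9_general γ₁ γ₂ hγ₁ hγ
  refine ⟨pstar, hpstar, hzero, hneg, hpos, hc, hq, fun W t₀ t₁ K ht₀ _ _ => ?_⟩
  obtain ⟨C, hC, μ₀, hμ₀, h⟩ := happrox W t₀ K ht₀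
  exact ⟨C, hC, μ₀, hμ₀, fun μ hμ hμlt t ht => h μ hμ hμlt t ht.1⟩
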